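/- Let $A$ be an expansive integer $d\times d$ matrix (all complex eigenvalues have modulus $>1$); put $B=A^t$, $N=|\det A|$. On $L^2(\mathbb R^d)$ let $[\tau_z f](t)=f(t+z)$ for $z\in\mathbb Z^d$ and $[\delta f](t)=\sqrt N f(At)$, and let $\widehat f(x)=\int f(t)e^{-2\pi i\langle t,x\rangle}dt$. A *generalized multiresolution analysis* (GMRA) is a sequence $\{V_j\}_{j\in\mathbb Z}$ of closed subspaces of $L^2(\mathbb R^d)$ with $V_j\subseteq V_{j+1}$, $V_{j+1}=\delta(V_j)$, $\bigcup V_j$ dense, $\bigcap V_j=\{0\}$, and $V_0$ invariant under all $\tau_z$. The *multiplicity function* of a translation-invariant closed subspace $V$ is a measurable $\mu:\mathbb T^d=\mathbb R^d/\mathbb Z^d\to\{0,1,2,\dots\}$ such that the representation $z\mapsto\tau_z|_V$ is unitarily equivalent to $z\mapsto$ multiplication by $e^{2\pi i\langle\omega,z\rangle}$ on $\bigoplus_{i\ge1}L^2(\{\mu\ge i\})$ (when such a bounded $\mu$ exists it is unique up to null sets). Let $\{U_j\}$ be a GMRA, let $m$ and $\widetilde m$ be the multiplicity functions of $U_0$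 and of $U_1\cap U_0^\perp$, and assume $m\le c$ and $\widetilde m\le\widetilde c$ almost everywhere, with $c\ge1$ and $\widetilde c\ge 0$ integers. Put $S_i=\{m\ge i\}$ and $\widetilde S_k=\{\widetilde m\ge k\}$. For $\omega\in\mathbb T^d$ let $\omega_0,\dots,\omega_{N-1}$ be the points that the endomorphism $\alpha$ of $\mathbb T^d$ induced by $B$ maps to $\omega$. Measurable functions on $\mathbb T^d$ are also regarded as $\mathbb Z^d$-periodic functions on $\mathbb R^d$. Let $H=[h_{i,j}]_{1\le i,j\le c}$ be a generalized low-pass filter, that is, the $h_{i,j}$ are measurable functions on $\mathbb T^d$, $h_{i,j}=0$ a.e. off $S_j$, $$\sum_{j}\sum_{l=0}^{N-1}h_{i,j}(\omega_l)\overline{h_{i',j}(\omega_l)}=\delta_{i,i'}N\chi_{S_i}(\omega)\ \text{ for a.e. }\omega,\qquad h_{i,j}(0)=\delta_{i,1}\delta_{j,1}\sqrt N .$$ Assume that every $h_{i,j}$ is Lipschitz on a neighbourhood of $0$. Let $G=[g_{k,j}]_{1\le k\le\widetilde c,\,1\le j\le c}$ be a corresponding generalized high-pass filter, that is, the $g_{k,j}$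 are measurable, $g_{k,j}=0$ a.e. off $S_j$, and for a.e. $\omega$ $$\sum_{j}\sum_{l}g_{k,j}(\omega_l)\overline{g_{k',j}(\omega_l)}=\delta_{k,k'}N\chi_{\widetilde S_k}(\omega),\qquad \sum_{j}\sum_{l}h_{i,j}(\omega_l)\overline{g_{k,j}(\omega_l)}=0 .$$ Then the infinite matrix product $P(x)=\prod_{q=1}^\infty N^{-1/2}H(B^{-q}x)$ (factors ordered from left to right) converges for a.e. $x\in\mathbb R^d$, and there are $\phi_1,\dots,\phi_c$ and $\psi_1,\dots,\psi_{\widetilde c}$ in $L^2(\mathbb R^d)$ with $\widehat{\phi_i}=P_{i,1}$ a.e. and $$\widehat{\psi_k}(x)=\frac1{\sqrt N}\sum_{j=1}^c g_{k,j}(B^{-1}x)\,\widehat{\phi_j}(B^{-1}x)\quad\text{for a.e. }x .$$ Moreover, $\{\psi_k\}$ is a Parseval frame multiwavelet, that is, $$\|f\|^2=\sum_{j\in\mathbb Z}\sum_{z\in\mathbb Z^d}\sum_{k}|\langle f,\delta^j\tau_z\psi_k\rangle|^2\qquad\text{for all } f\in L^2(\mathbb R^d);$$ and, with $V_0$ the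 closed linear span of $\{\tau_z\phi_i: z\in\mathbb Z^d,\ 1\le i\le c\}$, the spaces $V_j=\delta^j(V_0)$, $j\in\mathbb Z$, form a generalized multiresolution analysis of $L^2(\mathbb R^d)$. -/

import Mathlib

open MeasureTheory Filter Topology Matrix
open scoped ENNReal NNReal ComplexConjugate FourierTransform InnerProductSpace

noncomputable section

namespace GenFilter

/-! ### The ambient spaces -/

/-- `ℝ^d` with its Euclidean structure. -/
abbrev Rd (d : ℕ) : Type := EuclideanSpace ℝ (Fin d)

/-- The Hilbert space `L²(ℝ^d)` of complex functions. -/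
abbrev L2 (d : ℕ) : Type := Lp ℂ 2 (volume : Measure (Rd d))

/-- The torus `𝕋^d = ℝ^d / ℤ^d`. -/
abbrev Torus (d : ℕ) : Type := UnitAddTorus (Fin d)

/-- Normalised Haar measure on the torus. -/
abbrev torusHaar (d : ℕ) : Measure (Torus d) :=
  Measure.pi fun _ : Fin d => (AddCircle.haarAddCircle : Measure UnitAddCircle)

/-- The quotient map `ℝ^d → 𝕋^d`. -/
def toTorus {d : ℕ} (x : Rd d) : Torus d := fun i => ((x i : ℝ) : UnitAddCircle)

/-- An integer vector as a point of `ℝ^d`. -/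
def intVec {d : ℕ} (z : Fin d → ℤ) : Rd d := WithLp.toLp 2 fun i => (z i : ℝ)

/-! ### The dilation matrix -/

/-- The integer matrix `A` is expansive: every complex eigenvalue has modulus `> 1`. -/
def IsExpansive {d : ℕ} (A : Matrix (Fin d) (Fin d) ℤ) : Prop :=
  ∀ μ ∈ spectrum ℂ (A.map (Int.cast : ℤ → ℂ)), 1 < ‖μ‖

/-- An integer matrix as a real matrix. -/
def realMat {d : ℕ} (A : Matrix (Fin d) (Fin d) ℤ) : Matrix (Fin d) (Fin d) ℝ :=
  A.map (Int.cast : ℤ → ℝ)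

/-- `N = |det A|`, as a real number. -/
def detN {d : ℕ} (A : Matrix (Fin d) (Fin d) ℤ) : ℝ := ((A.det.natAbs : ℕ) : ℝ)

theorem det_realMat {d : ℕ} (A : Matrix (Fin d) (Fin d) ℤ) :
    (realMat A).det = (A.det : ℝ) := by
  rw [Int.cast_det]; rfl

theorem IsExpansive.det_ne_zero {d : ℕ} {A : Matrix (Fin d) (Fin d) ℤ} (hA : IsExpansive A) :
    A.det ≠ 0 := by
  intro h
  have h0 : (0 : ℂ) ∈ spectrum ℂ (A.map (Int.cast : ℤ → ℂ)) := by
    rw [spectrum.zero_mem_iff, Matrix.isUnit_iff_isUnit_det]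
    have : (A.map (Int.cast : ℤ → ℂ)).det = ((A.det : ℤ) : ℂ) := by
      rw [Int.cast_det]
    rw [this, h]
    simp
  have := hA 0 h0
  simp at this
  linarith

theorem detN_eq_abs {d : ℕ} (A : Matrix (Fin d) (Fin d) ℤ) : detN A = |(realMat A).det| := by
  rw [det_realMat, detN, Nat.cast_natAbs, Int.cast_abs]

theorem det_toEuclideanLin {d : ℕ} (M : Matrix (Fin d) (Fin d) ℝ) :
    LinearMap.det (Matrix.toEuclideanLin M) = M.det := by
  rw [Matrix.toEuclideanLin_eq_toLin_orthonormal, LinearMap.det_toLin]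

/-! ### Translation and dilation operators -/

/-- The translation operator `[τ_z f](t) = f(t + z)`. -/
def translate {d : ℕ} (z : Fin d → ℤ) : L2 d →ₗᵢ[ℂ] L2 d :=
  Lp.compMeasurePreservingₗᵢ ℂ (fun t : Rd d => t + intVec z)
    (measurePreserving_add_right volume (intVec z))

theorem map_matrix_volume {d : ℕ} (M : Matrix (Fin d) (Fin d) ℝ) (hM : M.det ≠ 0) :
    Measure.map (Matrix.toEuclideanLin M) (volume : Measure (Rd d))
      = ENNReal.ofReal |M.det⁻¹| • volume := by
  have h := Measure.map_linearMap_addHaar_eq_smul_addHaar (volume : Measure (Rd d))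
    (f := Matrix.toEuclideanLin M) (by rwa [det_toEuclideanLin])
  rwa [det_toEuclideanLin] at h

theorem memLp_comp_matrix {d : ℕ} (M : Matrix (Fin d) (Fin d) ℝ) (hM : M.det ≠ 0)
    {f : Rd d → ℂ} (hf : MemLp f 2 volume) :
    MemLp (fun t => ((√|M.det| : ℝ) : ℂ) * f (Matrix.toEuclideanLin M t)) 2 volume := by
  have hmeas : Measurable (Matrix.toEuclideanLin M) :=
    (Matrix.toEuclideanLin M).continuous_of_finiteDimensional.measurable
  have h1 : MemLp f 2 (Measure.map (Matrix.toEuclideanLin M) volume) := by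
    rw [map_matrix_volume M hM]
    exact hf.smul_measure ENNReal.ofReal_ne_top
  exact (h1.comp_of_map hmeas.aemeasurable).const_mul _

theorem eLpNorm_comp_matrix {d : ℕ} (M : Matrix (Fin d) (Fin d) ℝ) (hM : M.det ≠ 0)
    {f : Rd d → ℂ} (hf : AEStronglyMeasurable f volume) :
    eLpNorm (fun t => ((√|M.det| : ℝ) : ℂ) * f (Matrix.toEuclideanLin M t)) 2 volume
      = eLpNorm f 2 volume := by
  have hmeas : Measurable (Matrix.toEuclideanLin M) :=
    (Matrix.toEuclideanLin M).continuous_of_finiteDimensional.measurable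
  have hac : AEStronglyMeasurable f (Measure.map (Matrix.toEuclideanLin M) volume) := by
    rw [map_matrix_volume M hM]
    exact hf.smul_measure _
  have h1 : eLpNorm (fun t => f (Matrix.toEuclideanLin M t)) 2 volume
      = eLpNorm f 2 (Measure.map (Matrix.toEuclideanLin M) volume) :=
    (eLpNorm_map_measure hac hmeas.aemeasurable).symm
  have hpos : 0 < |M.det| := abs_pos.mpr hM
  have h2 : eLpNorm (fun t => ((√|M.det| : ℝ) : ℂ) * f (Matrix.toEuclideanLin M t)) 2 volume
      = ENNReal.ofReal (√|M.det|) *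
        eLpNorm (fun t => f (Matrix.toEuclideanLin M t)) 2 volume := by
    have := eLpNorm_const_smul ((√|M.det| : ℝ) : ℂ)
      (fun t => f (Matrix.toEuclideanLin M t)) 2 (volume : Measure (Rd d))
    rw [← ofReal_norm, Complex.norm_real, Real.norm_of_nonneg (Real.sqrt_nonneg _)] at this
    exact this
  rw [h2, h1, map_matrix_volume M hM, eLpNorm_smul_measure_of_ne_top (by simp), smul_eq_mul,
    ← mul_assoc]
  have h3 : ENNReal.ofReal |M.det⁻¹| ^ (1 / (2 : ℝ≥0∞)).toReal
      = ENNReal.ofReal ((√|M.det|)⁻¹) := by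
    rw [ENNReal.ofReal_rpow_of_nonneg (abs_nonneg _) (by simp), abs_inv]
    congr 1
    rw [← Real.sqrt_inv, Real.sqrt_eq_rpow]
    simp
  have h4 : ENNReal.ofReal (√|M.det|) * ENNReal.ofReal ((√|M.det|)⁻¹) = 1 := by
    rw [← ENNReal.ofReal_mul (Real.sqrt_nonneg _), mul_inv_cancel₀ (Real.sqrt_pos.mpr hpos).ne',
      ENNReal.ofReal_one]
  rw [h3, h4, one_mul]

theorem ae_comp_matrix {d : ℕ} (M : Matrix (Fin d) (Fin d) ℝ) (hM : M.det ≠ 0)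
    {p : Rd d → Prop} (hp : ∀ᵐ t, p t) : ∀ᵐ t, p (Matrix.toEuclideanLin M t) :=
  (MeasureTheory.Measure.LinearMap.quasiMeasurePreserving volume (Matrix.toEuclideanLin M)
    (by rwa [det_toEuclideanLin])).ae hp

/-- The isometry `f ↦ |det M|^{1/2} f(M ·)` of `L²(ℝ^d)`. -/
def dilateIsom {d : ℕ} (M : Matrix (Fin d) (Fin d) ℝ) (hM : M.det ≠ 0) : L2 d →ₗᵢ[ℂ] L2 d where
  toFun f := (memLp_comp_matrix M hM (Lp.memLp f)).toLp
    (fun t => ((√|M.det| : ℝ) : ℂ) * f (Matrix.toEuclideanLin M t))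
  map_add' f g := by
    rw [← MemLp.toLp_add]
    apply MemLp.toLp_congr
    filter_upwards [ae_comp_matrix M hM (Lp.coeFn_add f g)] with t ht
    simp only [ht, Pi.add_apply, mul_add]
  map_smul' a f := by
    rw [RingHom.id_apply, ← MemLp.toLp_const_smul]
    apply MemLp.toLp_congr
    filter_upwards [ae_comp_matrix M hM (Lp.coeFn_smul a f)] with t ht
    simp only [ht, Pi.smul_apply, smul_eq_mul]
    ring
  norm_map' f := by
    change ‖(memLp_comp_matrix M hM (Lp.memLp f)).toLp _‖ = ‖f‖
    rw [Lp.norm_toLp, eLpNorm_comp_matrix M hM (Lp.aestronglyMeasurable f), Lp.norm_def]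

theorem dilateIsom_ae {d : ℕ} (M : Matrix (Fin d) (Fin d) ℝ) (hM : M.det ≠ 0) (f : L2 d) :
    dilateIsom M hM f =ᵐ[volume]
      fun t => ((√|M.det| : ℝ) : ℂ) * f (Matrix.toEuclideanLin M t) :=
  MemLp.coeFn_toLp (memLp_comp_matrix M hM (Lp.memLp f))

theorem dilateIsom_surjective {d : ℕ} (M : Matrix (Fin d) (Fin d) ℝ) (hM : M.det ≠ 0) :
    Function.Surjective (dilateIsom M hM) := by
  intro f
  have hM' : (M⁻¹).det ≠ 0 := by
    rw [Matrix.det_nonsing_inv, Ring.inverse_eq_inv']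
    exact inv_ne_zero hM
  refine ⟨dilateIsom M⁻¹ hM' f, Lp.ext ?_⟩
  filter_upwards [dilateIsom_ae M hM (dilateIsom M⁻¹ hM' f),
    ae_comp_matrix M hM (dilateIsom_ae M⁻¹ hM' f)] with t h1 h2
  have h3 : Matrix.toEuclideanLin M⁻¹ (Matrix.toEuclideanLin M t) = t := by
    rw [Matrix.toLpLin_apply, Matrix.toLpLin_apply]
    simp [Matrix.mulVec_mulVec, Matrix.nonsing_inv_mul M (isUnit_iff_ne_zero.mpr hM)]
  have h4 : (√|M.det| : ℝ) * √|(M⁻¹).det| = 1 := by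
    rw [← Real.sqrt_mul (abs_nonneg _), ← abs_mul, ← Matrix.det_mul,
      Matrix.mul_nonsing_inv M (isUnit_iff_ne_zero.mpr hM)]
    simp
  rw [h1, h2, h3, ← mul_assoc, ← Complex.ofReal_mul, h4, Complex.ofReal_one, one_mul]

theorem realMat_det_ne_zero {d : ℕ} {A : Matrix (Fin d) (Fin d) ℤ} (hA : IsExpansive A) :
    (realMat A).det ≠ 0 := by
  rw [det_realMat]; exact_mod_cast hA.det_ne_zero

/-- The unitary dilation operator `[δ f](t) = √N f(A t)`. -/
def dilation {d : ℕ} {A : Matrix (Fin d) (Fin d) ℤ} (hA : IsExpansive A) :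
    L2 d ≃ₗᵢ[ℂ] L2 d :=
  LinearIsometryEquiv.ofSurjective (dilateIsom (realMat A) (realMat_det_ne_zero hA))
    (dilateIsom_surjective _ _)

theorem dilation_ae {d : ℕ} {A : Matrix (Fin d) (Fin d) ℤ} (hA : IsExpansive A) (f : L2 d) :
    dilation hA f =ᵐ[volume]
      fun t => ((√(detN A) : ℝ) : ℂ) * f (Matrix.toEuclideanLin (realMat A) t) := by
  rw [detN_eq_abs]
  exact dilateIsom_ae (realMat A) (realMat_det_ne_zero hA) f

theorem translate_ae {d : ℕ} (z : Fin d → ℤ) (f : L2 d) :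
    translate z f =ᵐ[volume] fun t => f (t + intVec z) :=
  Lp.coeFn_compMeasurePreserving f (measurePreserving_add_right volume (intVec z))

/-! ### Generalized multiresolution analyses and Parseval frames -/

/-- Generalized multiresolution analysis of `L²(ℝ^d)` for translation by `ℤ^d` and dilation
by `A`. -/
structure IsGMRA {d : ℕ} {A : Matrix (Fin d) (Fin d) ℤ} (hA : IsExpansive A)
    (V : ℤ → Submodule ℂ (L2 d)) : Prop where
  isClosed : ∀ j, IsClosed (V j : Set (L2 d))
  le_succ : ∀ j, V j ≤ V (j + 1)
  succ_eq : ∀ j, V (j + 1) = (V j).map (dilation hA).toLinearEquiv.toLinearMap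
  dense_union : Dense (⋃ j, (V j : Set (L2 d)))
  inter_eq : ⨅ j, V j = ⊥
  translate_mem : ∀ (z : Fin d → ℤ), ∀ f ∈ V 0, translate z f ∈ V 0

/-- `e` is a Parseval frame of `L²(ℝ^d)`: `∑ |⟨f, e i⟩|² = ‖f‖²` for all `f`. -/
def IsParsevalFrame {d : ℕ} {ι : Type*} (e : ι → L2 d) : Prop :=
  ∀ f : L2 d, HasSum (fun i => ‖⟪e i, f⟫_ℂ‖ ^ 2) (‖f‖ ^ 2)

/-- The finite family `ψ` is a Parseval frame multiwavelet: the functions `δ^j (τ_z ψ_k)`,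
`j ∈ ℤ`, `z ∈ ℤ^d`, form a Parseval frame of `L²(ℝ^d)`. -/
def IsParsevalMultiwavelet {d r : ℕ} {A : Matrix (Fin d) (Fin d) ℤ} (hA : IsExpansive A)
    (ψ : Fin r → L2 d) : Prop :=
  IsParsevalFrame fun p : ℤ × (Fin d → ℤ) × Fin r =>
    ((dilation hA) ^ p.1) (translate p.2.1 (ψ p.2.2))

/-- Closed linear span of the `ℤ^d`-translates of the `φ_i`. -/
def coreSpace {d c : ℕ} (φ : Fin c → L2 d) : Submodule ℂ (L2 d) :=
  (Submodule.span ℂ (Set.range fun p : (Fin d → ℤ) × Fin c =>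
    translate p.1 (φ p.2))).topologicalClosure

/-- The spaces `V_j = δ^j (V)`. -/
def dilates {d : ℕ} {A : Matrix (Fin d) (Fin d) ℤ} (hA : IsExpansive A)
    (V : Submodule ℂ (L2 d)) (j : ℤ) : Submodule ℂ (L2 d) :=
  V.map ((dilation hA) ^ j).toLinearEquiv.toLinearMap

/-! ### Multiplicity functions -/

/-- The set `S_i` of the multiplicity function `m`; the index is shifted, so that `levelSet m i`
is `{ω | m ω ≥ i + 1}`. -/
def levelSet {d : ℕ} (m : Torus d → ℕ) (i : ℕ) : Set (Torus d) := {ω | i < m ω}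

/-- `m` is the (spectral) multiplicity function, bounded by `c`, of the representation of `ℤ^d`
by translations on the translation-invariant space `V`: the representation is unitarily
equivalent to `z ↦ ` multiplication by `exp (2πi ⟨ω, z⟩)` on `⨁_i L²(S_i)`,
where `S_i = {m ≥ i}`. -/
def IsMultiplicityFunction {d : ℕ} (V : Submodule ℂ (L2 d)) (c : ℕ) (m : Torus d → ℕ) : Prop :=
  Measurable m ∧ (∀ᵐ ω ∂torusHaar d, m ω ≤ c) ∧
  ∃ J : V ≃ₗᵢ[ℂ] PiLp 2 fun i : Fin c => Lp ℂ 2 ((torusHaar d).restrict (levelSet m i)),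
    ∀ (z : Fin d → ℤ) (f : V), ∃ hf : translate z (f : L2 d) ∈ V, ∀ i : Fin c,
      J ⟨translate z (f : L2 d), hf⟩ i =ᵐ[(torusHaar d).restrict (levelSet m i)]
        fun ω => UnitAddTorus.mFourier z ω * J f i ω

/-! ### Generalized filters -/

/-- The endomorphism `α` of the torus induced by `B = Aᵗ`. -/
def torusEndo {d : ℕ} (A : Matrix (Fin d) (Fin d) ℤ) (ω : Torus d) : Torus d :=
  fun i => ∑ j, (Aᵀ i j) • ω j

/-- The sum `∑_l F(ω_l)` over the (finitely many) points `ω_l` with `α(ω_l) = ω`. -/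
def fiberSum {d : ℕ} (A : Matrix (Fin d) (Fin d) ℤ) (F : Torus d → ℂ) (ω : Torus d) : ℂ :=
  ∑ᶠ ζ : {ζ : Torus d // torusEndo A ζ = ω}, F ζ

/-- Generalized low-pass filter for the multiplicity function `m`. Indices start at `0`. -/
structure IsLowPass {d c : ℕ} [NeZero c] (A : Matrix (Fin d) (Fin d) ℤ) (m : Torus d → ℕ)
    (h : Fin c → Fin c → Torus d → ℂ) : Prop where
  measurable : ∀ i j, AEStronglyMeasurable (h i j) (torusHaar d)
  support : ∀ i j : Fin c, ∀ᵐ ω ∂torusHaar d, ω ∉ levelSet m j → h i j ω = 0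
  filter_eq : ∀ i i' : Fin c, ∀ᵐ ω ∂torusHaar d,
    ∑ j, fiberSum A (fun ζ => h i j ζ * conj (h i' j ζ)) ω
      = if i = i' then (levelSet m i).indicator (fun _ => (detN A : ℂ)) ω else 0
  low_pass : ∀ i j : Fin c, h i j 0 = if i = 0 ∧ j = 0 then ((√(detN A) : ℝ) : ℂ) else 0

/-- Generalized high-pass filter, for the multiplicity functions `m` and `m'`, complementing
the low-pass filter `h`. -/
structure IsHighPass {d c c' : ℕ} (A : Matrix (Fin d) (Fin d) ℤ) (m m' : Torus d → ℕ)
    (h : Fin c → Fin c → Torus d → ℂ) (g : Fin c' → Fin c → Torus d → ℂ) : Prop where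
  measurable : ∀ k j, AEStronglyMeasurable (g k j) (torusHaar d)
  support : ∀ (k : Fin c') (j : Fin c), ∀ᵐ ω ∂torusHaar d, ω ∉ levelSet m j → g k j ω = 0
  filter_eq : ∀ k k' : Fin c', ∀ᵐ ω ∂torusHaar d,
    ∑ j, fiberSum A (fun ζ => g k j ζ * conj (g k' j ζ)) ω
      = if k = k' then (levelSet m' k).indicator (fun _ => (detN A : ℂ)) ω else 0
  orthogonal : ∀ i k, ∀ᵐ ω ∂torusHaar d,
    ∑ j, fiberSum A (fun ζ => h i j ζ * conj (g k j ζ)) ω = 0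

/-- Every entry of `h` is Lipschitz on a neighbourhood of `0`. -/
def IsLipschitzNearZero {d c : ℕ} (h : Fin c → Fin c → Torus d → ℂ) : Prop :=
  ∀ i j, ∃ K : ℝ≥0, ∃ U ∈ 𝓝 (0 : Torus d), LipschitzOnWith K (h i j) U

/-- `B⁻¹ x`, where `B = Aᵗ`. -/
def invB {d : ℕ} (A : Matrix (Fin d) (Fin d) ℤ) (x : Rd d) : Rd d :=
  Matrix.toEuclideanLin ((realMat A)ᵀ)⁻¹ x

/-- The partial products `∏_{q=1}^n N^{-1/2} H(B^{-q} x)` (factors ordered from left to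
right). -/
def partialProd {d c : ℕ} (A : Matrix (Fin d) (Fin d) ℤ) (h : Fin c → Fin c → Torus d → ℂ) :
    ℕ → Rd d → Matrix (Fin c) (Fin c) ℂ
  | 0, _ => 1
  | n + 1, x => partialProd A h n x *
      Matrix.of fun i j => ((√(detN A) : ℝ) : ℂ)⁻¹ * h i j (toTorus ((invB A)^[n + 1] x))

end GenFilter

end

noncomputable section

namespace GenFilter

variable {d : ℕ}

/-! ### The torus as a quotient of `ℝ^d` -/

/-! On the Fourier side the coefficients `⟪translate z φ, f⟫` are the Fourier coefficients on the
torus of the bracket product of the transforms of `f` and `φ`, so sums of squares over `z` become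
integrals of squared brackets. By the refinement equations, the brackets of `f` with all `φ_i` and
`ψ_k` at a point `α ζ` are obtained from the brackets of `δ⁻¹ f` with the `φ_j` on the fibre `ζ +
ker α`, by applying `N⁻¹` times the entrywise conjugate of one finite matrix `K`: low-pass and
high-pass rows, columns indexed by fibre point and component (`filterMatrix`).

The filter equations say that `K Kᴴ = N D` for a coordinate projection `D`, and the support
conditions that `K E = K` for a coordinate projection `E`. What is needed is `Kᴴ K = N E`. Now `E -
N⁻¹ Kᴴ K` is a projection of trace `tr E - tr D ≥ 0`. The given GMRA supplies the rest: computing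
the size of `U 1` with two systems of Parseval generators (`sum_levelSet_eq`) shows that the two
traces have the same integral. So the projection vanishes almost everywhere (`ae_sum_levelSet_le`,
`ae_filter_isometry`), and the pyramid identity follows (`shiftSum_step`): the scaling energy of
`δ⁻¹ f` is the scaling energy of `f` plus its wavelet energy.

Square integrability of the infinite product comes from a row contraction and Fatou's lemma
(`lintegral_infProd_le`). At one end, the transform of `δ⁻ⁿ f` concentrates at the origin, where `∑
|P_{i,1}|²` tends to `1`, so its scaling energy tends to `‖f‖²` (`tendsto_shiftSum_scalingFn`). At
the other end `δⁿ f` concentrates at the origin in space, and its scaling energy tends to `0`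
(`tendsto_shiftSum_iterate_dilation`). Telescoping over all scales gives the Parseval identity.

The GMRA properties follow from the same facts, since `V_0ᗮ` is the kernel of the analysis operator
of the translates of the `φ_i`. Nesting comes from the pyramid identity and density from the limit
`‖f‖`. For the trivial intersection, `V_0` is first given generators that control inner products
with its elements, by polar decomposition of the analysis operator (`exists_generators_coreSpace`);
the second limit is then applied to those generators. -/

theorem intVec_add (z w : Fin d → ℤ) : intVec (z + w) = intVec z + intVec w := by
  ext i; simp [intVec]

theorem intVec_neg (z : Fin d → ℤ) : intVec (-z) = -intVec z := by
  ext i; simp [intVec]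

theorem intVec_zero : intVec (0 : Fin d → ℤ) = 0 := by
  ext i; simp [intVec]

theorem intVec_injective : Function.Injective (intVec (d := d)) := by
  intro z w h
  ext i
  have := congrArg (fun x : Rd d => x i) h
  simpa [intVec] using this

theorem toTorus_add (x y : Rd d) : toTorus (x + y) = toTorus x + toTorus y := by
  ext i; simp [toTorus]

theorem toTorus_zero : toTorus (0 : Rd d) = 0 := by
  ext i; simp [toTorus]

theorem toTorus_sub (x y : Rd d) : toTorus (x - y) = toTorus x - toTorus y := by
  ext i; simp [toTorus]

theorem toTorus_intVec (z : Fin d → ℤ) : toTorus (intVec z) = 0 := by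
  ext i
  simp only [toTorus, intVec, Pi.zero_apply]
  rw [AddCircle.coe_eq_zero_iff]
  exact ⟨z i, by simp⟩

theorem continuous_toTorus : Continuous (toTorus (d := d)) := by
  unfold toTorus
  refine continuous_pi fun i => ?_
  exact (AddCircle.continuous_mk' 1).comp (by fun_prop)

theorem toTorus_eq_zero_iff {x : Rd d} : toTorus x = 0 ↔ ∃ z, x = intVec z := by
  constructor
  · intro h
    have : ∀ i, ∃ n : ℤ, (n : ℝ) = x i := by
      intro i
      have hi := congrFun h i
      simp only [toTorus, Pi.zero_apply] at hi
      rw [AddCircle.coe_eq_zero_iff] at hi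
      obtain ⟨n, hn⟩ := hi
      exact ⟨n, by simpa using hn⟩
    choose z hz using this
    exact ⟨z, by ext i; simp [intVec, hz]⟩
  · rintro ⟨z, rfl⟩
    exact toTorus_intVec z

theorem toTorus_eq_iff {x y : Rd d} : toTorus x = toTorus y ↔ ∃ z, x = y + intVec z := by
  rw [← sub_eq_zero, ← toTorus_sub, toTorus_eq_zero_iff]
  simp only [sub_eq_iff_eq_add']

/-- The half-open unit cube centred at the origin. -/
def unitCube (d : ℕ) : Set (Rd d) := {x | ∀ i, x i ∈ Set.Ioc (-1 / 2 : ℝ) (-1 / 2 + 1)}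

/-- The representative of a point of the torus in the centred unit cube. -/
def torusLift (ω : Torus d) : Rd d :=
  WithLp.toLp 2 fun i => (AddCircle.equivIoc (1 : ℝ) (-1 / 2) (ω i)).1

theorem torusLift_mem (ω : Torus d) : torusLift ω ∈ unitCube d :=
  fun i => (AddCircle.equivIoc (1 : ℝ) (-1 / 2) (ω i)).2

theorem toTorus_torusLift (ω : Torus d) : toTorus (torusLift ω) = ω := by
  ext i
  exact (AddCircle.equivIoc (1 : ℝ) (-1 / 2)).symm_apply_apply (ω i)

theorem toTorus_surjective : Function.Surjective (toTorus (d := d)) :=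
  fun ω => ⟨_, toTorus_torusLift ω⟩

theorem measurableSet_unitCube : MeasurableSet (unitCube d) := by
  have : unitCube d = ⋂ i, (fun x : Rd d => x i) ⁻¹' Set.Ioc (-1 / 2 : ℝ) (-1 / 2 + 1) := by
    ext x; simp [unitCube]
  rw [this]
  exact MeasurableSet.iInter fun i => measurableSet_Ioc.preimage (by fun_prop)

theorem eq_zero_of_mem_unitCube {x : Rd d} {z : Fin d → ℤ} (hx : x ∈ unitCube d)
    (hz : x + intVec z ∈ unitCube d) : z = 0 := by
  ext i
  have h1 := hx i
  have h2 := hz i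
  simp only [intVec, PiLp.add_apply, Set.mem_Ioc] at h1 h2
  have h3 : (-1 : ℝ) < z i := by linarith
  have h4 : (z i : ℝ) < 1 := by linarith
  have h5 : -1 < z i := by exact_mod_cast h3
  have h6 : z i < 1 := by exact_mod_cast h4
  simp only [Pi.zero_apply]; omega

theorem measurePreserving_torusLift :
    MeasurePreserving (torusLift (d := d)) (torusHaar d) (volume.restrict (unitCube d)) := by
  have h1 := UnitAddTorus.measurePreserving_equivPiIoc (d := Fin d) (fun _ => (-1 / 2 : ℝ))
  have hs : MeasurableSet {x : Fin d → ℝ | ∀ i, x i ∈ Set.Ioc (-1 / 2 : ℝ) (-1 / 2 + 1)} :=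
    MeasurableSet.univ_pi' (fun i => measurableSet_Ioc)
  have h2 : MeasurePreserving
      (Subtype.val : {x : Fin d → ℝ // ∀ i, x i ∈ Set.Ioc (-1 / 2 : ℝ) (-1 / 2 + 1)} → _)
      (Measure.comap Subtype.val volume)
      (volume.restrict {x : Fin d → ℝ | ∀ i, x i ∈ Set.Ioc (-1 / 2 : ℝ) (-1 / 2 + 1)}) :=
    ⟨measurable_subtype_coe, map_comap_subtype_coe hs volume⟩
  have h3 : MeasurePreserving (WithLp.toLp 2 : (Fin d → ℝ) → Rd d)
      (volume.restrict {x : Fin d → ℝ | ∀ i, x i ∈ Set.Ioc (-1 / 2 : ℝ) (-1 / 2 + 1)})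
      (volume.restrict (unitCube d)) := by
    have := (EuclideanSpace.volume_preserving_symm_measurableEquiv_toLp (Fin d)).symm.restrict_preimage
      (measurableSet_unitCube (d := d))
    exact this
  exact h3.comp (h2.comp h1)

theorem measurable_torusLift : Measurable (torusLift (d := d)) :=
  measurePreserving_torusLift.measurable

/-- The bijection `𝕋^d × ℤ^d ≃ ℝ^d`. -/
def torusProdEquiv (d : ℕ) : Torus d × (Fin d → ℤ) ≃ Rd d :=
  Equiv.ofBijective (fun p => torusLift p.1 + intVec p.2) (by
    constructor
    · rintro ⟨ω, z⟩ ⟨ω', z'⟩ h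
      simp only at h
      have h1 : ω = ω' := by
        have := congrArg toTorus h
        simpa [toTorus_add, toTorus_intVec, toTorus_torusLift] using this
      subst h1
      rw [add_right_inj] at h
      rw [intVec_injective h]
    · intro x
      obtain ⟨z, hz⟩ := toTorus_eq_iff.mp (toTorus_torusLift (toTorus x)).symm
      exact ⟨(toTorus x, z), hz.symm⟩)

theorem torusProdEquiv_apply (p : Torus d × (Fin d → ℤ)) :
    torusProdEquiv d p = torusLift p.1 + intVec p.2 := rfl

theorem measurable_torusProdEquiv : Measurable (torusProdEquiv d) := by
  have h1 : Measurable fun p : Torus d × (Fin d → ℤ) => torusLift p.1 :=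
    measurable_torusLift.comp measurable_fst
  have h2 : Measurable fun p : Torus d × (Fin d → ℤ) => intVec p.2 :=
    (measurable_of_countable (intVec (d := d))).comp measurable_snd
  exact h1.add h2

/-- The integer translates of the unit cube tile space: the slice of a preimage at `z` has the
measure of the part of the set lying in the cube shifted by `z`, and these parts are disjoint and
exhaust the set. -/
theorem measurePreserving_torusProdEquiv :
    MeasurePreserving (torusProdEquiv d) ((torusHaar d).prod Measure.count) volume := by
  refine ⟨measurable_torusProdEquiv, ?_⟩
  ext s hs
  rw [Measure.map_apply measurable_torusProdEquiv hs,
    Measure.prod_apply_symm (measurable_torusProdEquiv hs), lintegral_count]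
  have h1 : ∀ z : Fin d → ℤ,
      torusHaar d ((fun ω => (ω, z)) ⁻¹' (torusProdEquiv d ⁻¹' s))
        = volume (s ∩ (fun x => x + intVec (-z)) ⁻¹' unitCube d) := by
    intro z
    have hs' : MeasurableSet ((fun x => x + intVec z) ⁻¹' s) := hs.preimage (by fun_prop)
    have : (fun ω => (ω, z)) ⁻¹' (torusProdEquiv d ⁻¹' s)
        = torusLift ⁻¹' ((fun x => x + intVec z) ⁻¹' s) := rfl
    rw [this, measurePreserving_torusLift.measure_preimage hs'.nullMeasurableSet,
      Measure.restrict_apply hs']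
    rw [← measure_preimage_add_right volume (intVec (-z))]
    congr 1
    ext x
    simp [intVec_neg]
  simp_rw [h1]
  rw [← measure_iUnion]
  · congr 1
    ext x
    simp only [Set.mem_iUnion, Set.mem_inter_iff, Set.mem_preimage, exists_and_left,
      and_iff_left_iff_imp]
    intro _
    obtain ⟨⟨ω, z⟩, rfl⟩ := (torusProdEquiv d).surjective x
    exact ⟨z, by simpa [torusProdEquiv_apply, intVec_neg] using torusLift_mem ω⟩
  · intro z z' hzz
    refine Set.disjoint_left.mpr ?_
    rintro x ⟨_, hx⟩ ⟨_, hx'⟩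
    apply hzz
    have h2 : x + intVec (-z') = (x + intVec (-z)) + intVec (z - z') := by
      rw [sub_eq_add_neg, intVec_add, intVec_neg z]; abel
    rw [Set.mem_preimage, h2] at hx'
    exact sub_eq_zero.mp (eq_zero_of_mem_unitCube hx hx')
  · intro z
    exact hs.inter (measurableSet_unitCube.preimage (by fun_prop))

theorem lintegral_eq_torus (F : Rd d → ℝ≥0∞) (hF : AEMeasurable F) :
    ∫⁻ x, F x = ∫⁻ ω, ∑' z, F (torusLift ω + intVec z) ∂torusHaar d := by
  rw [← measurePreserving_torusProdEquiv.map_eq,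
    lintegral_map' (by rwa [measurePreserving_torusProdEquiv.map_eq])
      measurable_torusProdEquiv.aemeasurable, lintegral_prod]
  · simp_rw [lintegral_count]; rfl
  · exact hF.comp_quasiMeasurePreserving measurePreserving_torusProdEquiv.quasiMeasurePreserving

theorem quasiMeasurePreserving_toTorus :
    Measure.QuasiMeasurePreserving (toTorus (d := d)) volume (torusHaar d) := by
  refine ⟨continuous_toTorus.measurable, Measure.AbsolutelyContinuous.mk fun s hs h0 => ?_⟩
  rw [Measure.map_apply continuous_toTorus.measurable hs,
    ← measurePreserving_torusProdEquiv.measure_preimage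
      (hs.preimage continuous_toTorus.measurable).nullMeasurableSet]
  have : torusProdEquiv d ⁻¹' (toTorus ⁻¹' s) = s ×ˢ Set.univ := by
    ext ⟨ω, z⟩
    simp [torusProdEquiv_apply, toTorus_add, toTorus_intVec, toTorus_torusLift]
  rw [this, Measure.prod_prod, h0, zero_mul]

theorem ae_toTorus {p : Torus d → Prop} (hp : ∀ᵐ ω ∂torusHaar d, p ω) :
    ∀ᵐ x : Rd d, p (toTorus x) :=
  quasiMeasurePreserving_toTorus.ae hp

/-- Periodization involves a whole fibre of `ℝ^d → 𝕋^d` at once, so exceptional null sets have to be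
avoided at all lattice translates simultaneously. -/
theorem ae_torusLift {p : Rd d → Prop} (hp : ∀ᵐ x, p x) :
    ∀ᵐ ω ∂torusHaar d, ∀ z, p (torusLift ω + intVec z) := by
  have h1 : ∀ᵐ q ∂(torusHaar d).prod (Measure.count : Measure (Fin d → ℤ)),
      p (torusProdEquiv d q) :=
    measurePreserving_torusProdEquiv.quasiMeasurePreserving.ae hp
  filter_upwards [Measure.ae_ae_of_ae_prod h1] with ω hω z
  exact (Measure.ae_count_iff.mp hω) z

end GenFilter

end

noncomputable section

namespace GenFilter

variable {d : ℕ}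

/-! ### Index of a lattice -/

theorem mulVec_injective_of_det_ne_zero {M : Matrix (Fin d) (Fin d) ℤ} (hM : M.det ≠ 0) :
    Function.Injective M.mulVec :=
  Matrix.mulVec_injective_of_det_ne_zero hM

/-- The index formula for a sublattice. It serves twice: for `Aᵀ` it counts the kernel of `α`, and
for `A` it counts the cosets by which dilation refines the translation lattice. -/
theorem card_quotient_range (M : Matrix (Fin d) (Fin d) ℤ) (hM : M.det ≠ 0) :
    Nat.card ((Fin d → ℤ) ⧸ LinearMap.range M.mulVecLin) = M.det.natAbs := by
  have hinj : Function.Injective M.mulVecLin := mulVec_injective_of_det_ne_zero hM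
  rw [← Submodule.natAbs_det_equiv (LinearMap.range M.mulVecLin)
    (LinearEquiv.ofInjective M.mulVecLin hinj)]
  congr 1
  have : (LinearMap.range M.mulVecLin).subtype ∘ₗ
      ((LinearEquiv.ofInjective M.mulVecLin hinj : (Fin d → ℤ) ≃ₗ[ℤ] _) :
        (Fin d → ℤ) →ₗ[ℤ] LinearMap.range M.mulVecLin) = Matrix.toLin' M := by
    ext; simp
  erw [this, LinearMap.det_toLin']

/-! ### The endomorphism of the torus -/

variable {A : Matrix (Fin d) (Fin d) ℤ}

theorem IsExpansive.transpose_det_ne_zero (hA : IsExpansive A) : (realMat A)ᵀ.det ≠ 0 := by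
  rw [Matrix.det_transpose]; exact realMat_det_ne_zero hA

/-- Multiplication by `B = Aᵗ`. -/
def mulB (A : Matrix (Fin d) (Fin d) ℤ) (x : Rd d) : Rd d :=
  Matrix.toEuclideanLin (realMat A)ᵀ x

theorem invB_add (x y : Rd d) : invB A (x + y) = invB A x + invB A y := map_add _ _ _

theorem continuous_mulB : Continuous (mulB A) :=
  (Matrix.toEuclideanLin (realMat A)ᵀ).continuous_of_finiteDimensional

theorem continuous_invB : Continuous (invB A) :=
  (Matrix.toEuclideanLin ((realMat A)ᵀ)⁻¹).continuous_of_finiteDimensional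

theorem invB_mulB (hA : IsExpansive A) (x : Rd d) : invB A (mulB A x) = x := by
  simp only [invB, mulB]
  rw [Matrix.toLpLin_apply, Matrix.toLpLin_apply]
  simp [Matrix.mulVec_mulVec, Matrix.nonsing_inv_mul _
    (isUnit_iff_ne_zero.mpr hA.transpose_det_ne_zero)]

theorem mulB_invB (hA : IsExpansive A) (x : Rd d) : mulB A (invB A x) = x := by
  simp only [invB, mulB]
  rw [Matrix.toLpLin_apply, Matrix.toLpLin_apply]
  simp [Matrix.mulVec_mulVec, Matrix.mul_nonsing_inv _
    (isUnit_iff_ne_zero.mpr hA.transpose_det_ne_zero)]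

theorem mulB_intVec (z : Fin d → ℤ) : mulB A (intVec z) = intVec (Aᵀ *ᵥ z) := by
  ext i
  simp [mulB, intVec, Matrix.toLpLin_apply, Matrix.mulVec, dotProduct, realMat]

/-- The endomorphism `α` as a homomorphism. -/
def endoHom (A : Matrix (Fin d) (Fin d) ℤ) : Torus d →+ Torus d where
  toFun := torusEndo A
  map_zero' := by ext i; simp [torusEndo]
  map_add' x y := by ext i; simp [torusEndo, Finset.sum_add_distrib]

theorem endoHom_apply (ω : Torus d) : endoHom A ω = torusEndo A ω := rfl

theorem torusEndo_add (ω η : Torus d) : torusEndo A (ω + η) = torusEndo A ω + torusEndo A η :=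
  map_add (endoHom A) ω η

theorem torusEndo_toTorus (x : Rd d) : torusEndo A (toTorus x) = toTorus (mulB A x) := by
  ext i
  simp only [torusEndo, toTorus, mulB]
  rw [Matrix.toLpLin_apply]
  simp only [Matrix.mulVec, dotProduct, realMat, Matrix.transpose_apply, Matrix.map_apply]
  have : ((∑ j, (A j i : ℝ) * x j : ℝ) : UnitAddCircle)
      = ∑ j, (((A j i : ℝ) * x j : ℝ) : UnitAddCircle) :=
    map_sum (QuotientAddGroup.mk' (AddSubgroup.zmultiples (1 : ℝ))) _ _
  rw [this]
  refine Finset.sum_congr rfl fun j _ => ?_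
  rw [← AddCircle.coe_zsmul, zsmul_eq_mul]

theorem continuous_torusEndo : Continuous (torusEndo A) := by
  unfold torusEndo
  fun_prop

theorem torusEndo_surjective (hA : IsExpansive A) : Function.Surjective (torusEndo A) := by
  intro ω
  refine ⟨toTorus (invB A (torusLift ω)), ?_⟩
  rw [torusEndo_toTorus, mulB_invB hA, toTorus_torusLift]

theorem measurePreserving_torusEndo (hA : IsExpansive A) :
    MeasurePreserving (torusEndo A) (torusHaar d) (torusHaar d) :=
  AddMonoidHom.measurePreserving (f := endoHom A) continuous_torusEndo
    (torusEndo_surjective hA) rfl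

/-- The homomorphism `z ↦ B⁻¹ z` from `ℤ^d` to the torus. -/
def kerParam (A : Matrix (Fin d) (Fin d) ℤ) : (Fin d → ℤ) →+ Torus d where
  toFun z := toTorus (invB A (intVec z))
  map_zero' := by simp [intVec_zero, invB, toTorus_zero]
  map_add' x y := by rw [intVec_add, invB_add, toTorus_add]

theorem range_kerParam (hA : IsExpansive A) : (kerParam A).range = (endoHom A).ker := by
  ext κ
  rw [AddMonoidHom.mem_range, AddMonoidHom.mem_ker]
  constructor
  · rintro ⟨z, rfl⟩
    change torusEndo A (toTorus _) = 0
    rw [torusEndo_toTorus, mulB_invB hA, toTorus_intVec]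
  · intro h
    obtain ⟨x, rfl⟩ := toTorus_surjective κ
    rw [endoHom_apply, torusEndo_toTorus, toTorus_eq_zero_iff] at h
    obtain ⟨z, hz⟩ := h
    refine ⟨z, ?_⟩
    change toTorus (invB A (intVec z)) = _
    rw [← hz, invB_mulB hA]

theorem ker_kerParam (hA : IsExpansive A) :
    (kerParam A).ker = (LinearMap.range Aᵀ.mulVecLin).toAddSubgroup := by
  ext z
  rw [AddMonoidHom.mem_ker, Submodule.mem_toAddSubgroup, LinearMap.mem_range]
  change toTorus _ = 0 ↔ _
  rw [toTorus_eq_zero_iff]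
  constructor
  · rintro ⟨w, hw⟩
    refine ⟨w, ?_⟩
    apply intVec_injective
    rw [Matrix.mulVecLin_apply, ← mulB_intVec, ← hw, mulB_invB hA]
  · rintro ⟨w, rfl⟩
    exact ⟨w, by rw [Matrix.mulVecLin_apply, ← mulB_intVec, invB_mulB hA]⟩

/-- The map `z ↦ B⁻¹ z` sends `ℤ^d` onto the kernel of `α`, and its own kernel is `B ℤ^d`; the order
is therefore an index. -/
theorem card_ker (hA : IsExpansive A) : Nat.card (endoHom A).ker = A.det.natAbs := by
  rw [← range_kerParam hA,
    ← Nat.card_congr (QuotientAddGroup.quotientKerEquivRange (kerParam A)).toEquiv,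
    ker_kerParam hA, ← Matrix.det_transpose, ← card_quotient_range _
      (by rw [Matrix.det_transpose]; exact hA.det_ne_zero)]
  rfl

theorem finite_ker (hA : IsExpansive A) : Finite (endoHom A).ker :=
  Nat.finite_of_card_ne_zero (by rw [card_ker hA]; simpa using hA.det_ne_zero)

theorem detN_pos (hA : IsExpansive A) : 0 < detN A := by
  simpa [detN, Nat.pos_iff_ne_zero] using hA.det_ne_zero

/-- The fibre of `α` through `ζ` is a coset of the kernel. -/
def fiberEquiv (A : Matrix (Fin d) (Fin d) ℤ) (ζ : Torus d) :
    (endoHom A).ker ≃ {η : Torus d // torusEndo A η = torusEndo A ζ} where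
  toFun κ := ⟨ζ + κ, by
    have h : torusEndo A κ = 0 := κ.2
    rw [torusEndo_add, h, add_zero]⟩
  invFun η := ⟨η - ζ, by
    rw [AddMonoidHom.mem_ker, map_sub, endoHom_apply, endoHom_apply, η.2, sub_self]⟩
  left_inv κ := by simp
  right_inv η := by simp

/-- Since `α` is onto and measure preserving, an identity at almost every `ω` may be read at `ω = α
ζ`, where the sum over the fibre becomes a sum over a fixed finite group. -/
theorem fiberSum_eq [Fintype (endoHom A).ker] (F : Torus d → ℂ) (ζ : Torus d) :
    fiberSum A F (torusEndo A ζ) = ∑ κ : (endoHom A).ker, F (ζ + κ) := by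
  rw [fiberSum, ← finsum_eq_sum_of_fintype]
  exact (finsum_eq_of_bijective (fiberEquiv A ζ) (fiberEquiv A ζ).bijective fun κ => rfl).symm

theorem measurePreserving_add_torus (κ : Torus d) :
    MeasurePreserving (fun ζ => ζ + κ) (torusHaar d) (torusHaar d) :=
  measurePreserving_add_right _ κ

theorem ae_add_ker (hA : IsExpansive A) {p : Torus d → Prop} (hp : ∀ᵐ ω ∂torusHaar d, p ω) :
    ∀ᵐ ζ ∂torusHaar d, ∀ κ : (endoHom A).ker, p (ζ + κ) := by
  have := finite_ker hA
  rw [ae_all_iff]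
  exact fun κ => (measurePreserving_add_torus (κ : Torus d)).quasiMeasurePreserving.ae hp

theorem ae_torusEndo (hA : IsExpansive A) {p : Torus d → Prop} (hp : ∀ᵐ ω ∂torusHaar d, p ω) :
    ∀ᵐ ζ ∂torusHaar d, p (torusEndo A ζ) :=
  (measurePreserving_torusEndo hA).quasiMeasurePreserving.ae hp

theorem lintegral_sum_ker (hA : IsExpansive A) [Fintype (endoHom A).ker] {F : Torus d → ℝ≥0∞}
    (hF : AEMeasurable F (torusHaar d)) :
    ∫⁻ ζ, ∑ κ : (endoHom A).ker, F (ζ + κ) ∂torusHaar d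
      = ENNReal.ofReal (detN A) * ∫⁻ ω, F ω ∂torusHaar d := by
  have hm : ∀ κ : (endoHom A).ker, AEMeasurable (fun ζ => F (ζ + κ)) (torusHaar d) := fun κ =>
    hF.comp_quasiMeasurePreserving
      (measurePreserving_add_torus (κ : Torus d)).quasiMeasurePreserving
  rw [lintegral_finsetSum' _ fun κ _ => hm κ]
  simp_rw [lintegral_add_right_eq_self F]
  rw [Finset.sum_const, nsmul_eq_mul, Finset.card_univ, ← Nat.card_eq_fintype_card, card_ker hA,
    detN, ENNReal.ofReal_natCast]

theorem lintegral_torusEndo (hA : IsExpansive A) {F : Torus d → ℝ≥0∞}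
    (hF : AEMeasurable F (torusHaar d)) :
    ∫⁻ ζ, F (torusEndo A ζ) ∂torusHaar d = ∫⁻ ω, F ω ∂torusHaar d := by
  have hmp := measurePreserving_torusEndo hA
  conv_rhs => rw [← hmp.map_eq]
  rw [lintegral_map' (by rwa [hmp.map_eq]) hmp.measurable.aemeasurable]

end GenFilter

end

noncomputable section

namespace GenFilter

variable {d : ℕ}

/-! ### Periodization -/

/-- The periodization `ω ↦ ∑_z F(x + z)`, where `x` represents `ω`. -/
def periodize (F : Rd d → ℂ) (ω : Torus d) : ℂ := ∑' z, F (torusLift ω + intVec z)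

theorem integrable_comp_torusProdEquiv {F : Rd d → ℂ} (hF : Integrable F) :
    Integrable (fun p => F (torusProdEquiv d p))
      ((torusHaar d).prod (Measure.count : Measure (Fin d → ℤ))) :=
  measurePreserving_torusProdEquiv.integrable_comp_of_integrable hF

theorem integral_count_eq_tsum {ι : Type*} [Countable ι] [MeasurableSpace ι]
    [MeasurableSingletonClass ι] {f : ι → ℂ} (hf : Integrable f Measure.count) :
    ∫ i, f i ∂Measure.count = ∑' i, f i := by
  rw [integral_countable hf]
  simp [Measure.real]

theorem ae_integrable_fiber {F : Rd d → ℂ} (hF : Integrable F) :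
    ∀ᵐ ω ∂torusHaar d, Integrable (fun z => F (torusLift ω + intVec z)) Measure.count :=
  (integrable_comp_torusProdEquiv hF).prod_right_ae

theorem ae_summable_fiber {F : Rd d → ℂ} (hF : Integrable F) :
    ∀ᵐ ω ∂torusHaar d, Summable fun z => F (torusLift ω + intVec z) := by
  filter_upwards [ae_integrable_fiber hF] with ω hω
  exact Summable.of_norm (integrable_count_iff.mp hω)

theorem periodize_ae_eq {F : Rd d → ℂ} (hF : Integrable F) :
    (fun ω => ∫ z, F (torusProdEquiv d (ω, z)) ∂Measure.count) =ᵐ[torusHaar d] periodize F := by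
  filter_upwards [ae_integrable_fiber hF] with ω hω
  exact integral_count_eq_tsum hω

theorem integrable_periodize {F : Rd d → ℂ} (hF : Integrable F) :
    Integrable (periodize F) (torusHaar d) :=
  (integrable_comp_torusProdEquiv hF).integral_prod_left.congr (periodize_ae_eq hF)

theorem integral_periodize {F : Rd d → ℂ} (hF : Integrable F) :
    ∫ ω, periodize F ω ∂torusHaar d = ∫ x, F x := by
  rw [← integral_congr_ae (periodize_ae_eq hF), ← integral_prod _ (integrable_comp_torusProdEquiv hF),
    ← measurePreserving_torusProdEquiv.map_eq, integral_map measurable_torusProdEquiv.aemeasurable]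
  rw [measurePreserving_torusProdEquiv.map_eq]
  exact hF.aestronglyMeasurable

theorem toTorus_torusLift_add (ω : Torus d) (z : Fin d → ℤ) :
    toTorus (torusLift ω + intVec z) = ω := by
  rw [toTorus_add, toTorus_intVec, add_zero, toTorus_torusLift]

theorem periodize_mul_left (p : Torus d → ℂ) (F : Rd d → ℂ) (ω : Torus d) :
    periodize (fun x => p (toTorus x) * F x) ω = p ω * periodize F ω := by
  simp only [periodize, toTorus_torusLift_add]
  rw [tsum_mul_left]

theorem periodize_congr {F G : Rd d → ℂ} (h : F =ᵐ[volume] G) :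
    periodize F =ᵐ[torusHaar d] periodize G := by
  filter_upwards [ae_torusLift h] with ω hω
  exact tsum_congr hω

/-! ### The bracket product -/

/-- The bracket product `∑_z u(x + z) conj (v(x + z))` as a function on the torus. -/
def bracket (u v : Rd d → ℂ) : Torus d → ℂ := periodize fun x => u x * conj (v x)

/-- The sum `∑_z |u(x + z)|²` as a function on the torus. -/
def sqSum (u : Rd d → ℂ) (ω : Torus d) : ℝ≥0∞ := ∑' z, ‖u (torusLift ω + intVec z)‖ₑ ^ 2

theorem bracket_congr {u u' v v' : Rd d → ℂ} (hu : u =ᵐ[volume] u') (hv : v =ᵐ[volume] v') :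
    bracket u v =ᵐ[torusHaar d] bracket u' v' := by
  refine periodize_congr ?_
  filter_upwards [hu, hv] with x h1 h2
  rw [h1, h2]

theorem lintegral_sqSum {u : Rd d → ℂ} (hu : AEStronglyMeasurable u) :
    ∫⁻ ω, sqSum u ω ∂torusHaar d = ∫⁻ x, ‖u x‖ₑ ^ 2 :=
  (lintegral_eq_torus (fun x => ‖u x‖ₑ ^ 2) (hu.enorm.pow_const 2)).symm

theorem lintegral_enorm_sq_lt_top {α : Type*} [MeasurableSpace α] {μ : Measure α} {u : α → ℂ}
    (hu : MemLp u 2 μ) : ∫⁻ x, ‖u x‖ₑ ^ 2 ∂μ < ∞ := by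
  have := lintegral_rpow_enorm_lt_top_of_eLpNorm_lt_top (p := 2) (by simp) (by simp) hu.2
  simpa using this

theorem memLp_two_of_lintegral {α : Type*} [MeasurableSpace α] {μ : Measure α} {u : α → ℂ}
    (hu : AEStronglyMeasurable u μ) (h : ∫⁻ x, ‖u x‖ₑ ^ 2 ∂μ < ∞) : MemLp u 2 μ := by
  refine ⟨hu, ?_⟩
  rw [eLpNorm_lt_top_iff_lintegral_rpow_enorm_lt_top (by simp) (by simp)]
  simpa using h

theorem enorm_sq_Lp {α : Type*} [MeasurableSpace α] {μ : Measure α} (f : Lp ℂ 2 μ) :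
    ‖f‖ₑ ^ 2 = ∫⁻ x, ‖f x‖ₑ ^ 2 ∂μ := by
  rw [Lp.enorm_def, eLpNorm_eq_lintegral_rpow_enorm_toReal (by simp) (by simp)]
  rw [← ENNReal.rpow_natCast, ← ENNReal.rpow_mul]
  simp

/-- Cauchy–Schwarz with values in `[0, ∞]`. No summability is required: a series that is not
summable has sum `0` by convention. -/
theorem enorm_tsum_mul_sq_le {ι : Type*} (a b : ι → ℂ) :
    ‖∑' i, a i * b i‖ₑ ^ 2 ≤ (∑' i, ‖a i‖ₑ ^ 2) * ∑' i, ‖b i‖ₑ ^ 2 := by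
  let _ : MeasurableSpace ι := ⊤
  have h1 : ‖∑' i, a i * b i‖ₑ ≤ ∑' i, ‖a i‖ₑ * ‖b i‖ₑ := by
    refine (enorm_tsum_le_tsum_enorm).trans_eq ?_
    simp_rw [enorm_mul]
  have h2 := ENNReal.lintegral_mul_le_Lp_mul_Lq (Measure.count : Measure ι)
    (p := 2) (q := 2) Real.HolderConjugate.two_two
    (f := fun i => ‖a i‖ₑ) (g := fun i => ‖b i‖ₑ)
    (measurable_from_top.aemeasurable) (measurable_from_top.aemeasurable)
  simp only [Pi.mul_apply, lintegral_count] at h2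
  calc ‖∑' i, a i * b i‖ₑ ^ 2
      ≤ ((∑' i, ‖a i‖ₑ ^ (2 : ℝ)) ^ (1 / (2 : ℝ)) * (∑' i, ‖b i‖ₑ ^ (2 : ℝ)) ^ (1 / (2 : ℝ))) ^ 2 := by
        gcongr; exact h1.trans h2
    _ = _ := by
        rw [mul_pow, ← ENNReal.rpow_natCast, ← ENNReal.rpow_natCast, ← ENNReal.rpow_mul,
          ← ENNReal.rpow_mul]
        simp

theorem enorm_bracket_sq_le (u v : Rd d → ℂ) (ω : Torus d) :
    ‖bracket u v ω‖ₑ ^ 2 ≤ sqSum u ω * sqSum v ω := by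
  refine (enorm_tsum_mul_sq_le _ _).trans_eq ?_
  simp only [sqSum, RCLike.enorm_conj]

theorem integrable_mul_conj {u v : Rd d → ℂ} (hu : MemLp u 2) (hv : MemLp v 2) :
    Integrable fun x => u x * conj (v x) :=
  hu.integrable_mul hv.star

theorem parseval_torus {b : Torus d → ℂ} (hb : MemLp b 2 (torusHaar d)) :
    ∑' z, ‖∫ ω, conj (UnitAddTorus.mFourier z ω) * b ω ∂torusHaar d‖ₑ ^ 2
      = ∫⁻ ω, ‖b ω‖ₑ ^ 2 ∂torusHaar d := by
  have h := UnitAddTorus.hasSum_sq_mFourierCoeff (d := Fin d) (hb.toLp b)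
  have h1 : ∀ z, UnitAddTorus.mFourierCoeff (hb.toLp b) z
      = ∫ ω, conj (UnitAddTorus.mFourier z ω) * b ω ∂torusHaar d := by
    intro z
    refine integral_congr_ae ?_
    filter_upwards [hb.coeFn_toLp] with ω hω
    rw [hω, UnitAddTorus.mFourier_neg, smul_eq_mul]
  simp_rw [h1] at h
  have h2 : ∀ z : ℂ, ‖z‖ₑ ^ 2 = ENNReal.ofReal (‖z‖ ^ 2) := fun z => by
    rw [ENNReal.ofReal_pow (norm_nonneg _), ofReal_norm]
  simp_rw [h2]
  rw [← ENNReal.ofReal_tsum_of_nonneg (fun _ => by positivity) h.summable, h.tsum_eq,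
    ofReal_integral_eq_lintegral_ofReal]
  · refine lintegral_congr_ae ?_
    filter_upwards [hb.coeFn_toLp] with ω hω
    rw [hω]
  · exact (Lp.memLp (hb.toLp b)).integrable_norm_pow (by simp)
  · exact Eventually.of_forall fun _ => by positivity

/-- Parseval's identity for the bracket product. -/
theorem parseval_bracket {u v : Rd d → ℂ} (hu : MemLp u 2) (hv : MemLp v 2)
    (hb : MemLp (bracket u v) 2 (torusHaar d)) :
    ∑' z, ‖∫ x, conj (UnitAddTorus.mFourier z (toTorus x)) * (u x * conj (v x))‖ₑ ^ 2
      = ∫⁻ ω, ‖bracket u v ω‖ₑ ^ 2 ∂torusHaar d := by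
  rw [← parseval_torus hb]
  refine tsum_congr fun z => ?_
  rw [← integral_periodize]
  · congr 3
    ext ω
    exact periodize_mul_left (fun ω => conj (UnitAddTorus.mFourier z ω)) _ ω
  · refine (integrable_mul_conj hu hv).bdd_mul (c := 1) ?_ ?_
    · exact (Complex.continuous_conj.comp ((UnitAddTorus.mFourier z).continuous.comp
        continuous_toTorus)).aestronglyMeasurable
    · refine Eventually.of_forall fun x => ?_
      rw [RCLike.norm_conj]
      refine ((UnitAddTorus.mFourier z).norm_coe_le_norm _).trans ?_
      rw [UnitAddTorus.mFourier_norm]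

/-- The bracket product lies in `L²` when one factor has bounded square sums. -/
theorem memLp_bracket {u v : Rd d → ℂ} (hu : MemLp u 2) (hv : MemLp v 2) {C : ℝ≥0∞} (hC : C ≠ ∞)
    (h : ∀ᵐ ω ∂torusHaar d, sqSum u ω ≤ C) : MemLp (bracket u v) 2 (torusHaar d) := by
  refine memLp_two_of_lintegral
    (integrable_periodize (integrable_mul_conj hu hv)).aestronglyMeasurable ?_
  calc ∫⁻ ω, ‖bracket u v ω‖ₑ ^ 2 ∂torusHaar d
      ≤ ∫⁻ ω, C * sqSum v ω ∂torusHaar d := by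
        refine lintegral_mono_ae ?_
        filter_upwards [h] with ω hω
        exact (enorm_bracket_sq_le u v ω).trans (by gcongr)
    _ = C * ∫⁻ x, ‖v x‖ₑ ^ 2 := by
        rw [lintegral_const_mul' _ _ hC, lintegral_sqSum hv.1]
    _ < ∞ := ENNReal.mul_lt_top hC.lt_top (lintegral_enorm_sq_lt_top hv)

/-! ### Periodization and the endomorphism -/

/-- The translates of a representative are all the representatives. -/
def repEquiv (ω : Torus d) : (Fin d → ℤ) ≃ {x : Rd d // toTorus x = ω} :=
  Equiv.ofBijective (fun z => ⟨torusLift ω + intVec z, toTorus_torusLift_add ω z⟩) (by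
    constructor
    · intro z w h
      have := congrArg Subtype.val h
      simp only [add_right_inj] at this
      exact intVec_injective this
    · rintro ⟨x, rfl⟩
      obtain ⟨z, hz⟩ := toTorus_eq_iff.mp (toTorus_torusLift (toTorus x)).symm
      exact ⟨z, Subtype.ext hz.symm⟩)

theorem periodize_eq_tsum_rep (F : Rd d → ℂ) (ω : Torus d) :
    periodize F ω = ∑' x : {x : Rd d // toTorus x = ω}, F x :=
  (repEquiv ω).tsum_eq fun x : {x : Rd d // toTorus x = ω} => F x

variable {A : Matrix (Fin d) (Fin d) ℤ}

/-- The representatives of `α ζ` are the images under `B` of the representatives of the points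
`ζ + κ`, `α κ = 0`. -/
def repSigmaEquiv (hA : IsExpansive A) (ζ : Torus d) :
    (Σ κ : (endoHom A).ker, {y : Rd d // toTorus y = ζ + κ}) ≃
      {x : Rd d // toTorus x = torusEndo A ζ} where
  toFun p := ⟨mulB A p.2, by
    have h : torusEndo A p.1 = 0 := p.1.2
    rw [← torusEndo_toTorus, p.2.2, torusEndo_add, h, add_zero]⟩
  invFun x := ⟨⟨toTorus (invB A x) - ζ, by
      rw [AddMonoidHom.mem_ker, map_sub, endoHom_apply, endoHom_apply, torusEndo_toTorus,
        mulB_invB hA, x.2, sub_self]⟩, ⟨invB A x, by simp⟩⟩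
  left_inv := by
    rintro ⟨κ, y, hy⟩
    simp only
    have h1 : invB A (mulB A y) = y := invB_mulB hA y
    refine Sigma.ext ?_ ?_
    · ext1
      simp [h1, hy]
    · refine (Subtype.heq_iff_coe_eq ?_).mpr h1
      intro x
      simp [h1, hy]
  right_inv x := Subtype.ext (mulB_invB hA x)

/-- The representatives of `α ζ` are grouped according to the preimage `ζ + κ` from which they come;
summability justifies the regrouping. -/
theorem periodize_torusEndo (hA : IsExpansive A) [Fintype (endoHom A).ker] {F : Rd d → ℂ}
    {ζ : Torus d} (hF : Summable fun z => F (torusLift (torusEndo A ζ) + intVec z)) :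
    periodize F (torusEndo A ζ)
      = ∑ κ : (endoHom A).ker, periodize (fun x => F (mulB A x)) (ζ + κ) := by
  have h1 : Summable fun x : {x : Rd d // toTorus x = torusEndo A ζ} => F x :=
    (repEquiv _).summable_iff.mp hF
  have h2 : Summable ((fun x : {x : Rd d // toTorus x = torusEndo A ζ} => F x) ∘
    repSigmaEquiv hA ζ) := (repSigmaEquiv hA ζ).summable_iff.mpr h1
  rw [periodize_eq_tsum_rep,
    ← (repSigmaEquiv hA ζ).tsum_eq fun x : {x : Rd d // toTorus x = torusEndo A ζ} => F x]
  have h3 := h2.tsum_sigma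
  rw [Function.comp_def] at h3
  rw [h3, tsum_fintype]
  refine Finset.sum_congr rfl fun κ _ => ?_
  rw [periodize_eq_tsum_rep]
  rfl

end GenFilter

end

noncomputable section

namespace GenFilter

variable {d : ℕ}

/-! ### Translations and dilations on the Fourier side -/

theorem norm_mFourier (z : Fin d → ℤ) (ω : Torus d) : ‖UnitAddTorus.mFourier z ω‖ = 1 := by
  simp only [UnitAddTorus.mFourier, fourier_apply, ContinuousMap.coe_mk, norm_prod,
    Circle.norm_coe, Finset.prod_const_one]

theorem continuous_mFourier_toTorus (z : Fin d → ℤ) :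
    Continuous fun x : Rd d => UnitAddTorus.mFourier z (toTorus x) :=
  (UnitAddTorus.mFourier z).continuous.comp continuous_toTorus

theorem mFourier_toTorus (z : Fin d → ℤ) (x : Rd d) :
    UnitAddTorus.mFourier z (toTorus x)
      = Complex.exp (2 * Real.pi * Complex.I * (⟪intVec z, x⟫_ℝ : ℝ)) := by
  simp only [UnitAddTorus.mFourier, ContinuousMap.coe_mk, toTorus, fourier_coe_apply]
  rw [← Complex.exp_sum]
  congr 1
  simp only [intVec, PiLp.inner_apply, RCLike.inner_apply, conj_trivial, Complex.ofReal_sum,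
    Complex.ofReal_mul, Finset.mul_sum, Complex.ofReal_intCast]
  refine Finset.sum_congr rfl fun i _ => ?_
  simp; ring

theorem memLp_modulate (z : Fin d → ℤ) {f : Rd d → ℂ} (hf : MemLp f 2) :
    MemLp (fun x => UnitAddTorus.mFourier z (toTorus x) * f x) 2 := by
  refine hf.of_le ((continuous_mFourier_toTorus z).aestronglyMeasurable.mul hf.1) ?_
  refine Eventually.of_forall fun x => ?_
  rw [norm_mul, norm_mFourier, one_mul]

/-- Multiplication by the character `x ↦ exp (2πi ⟨x, z⟩)`. -/
def modulate (z : Fin d → ℤ) : L2 d →ₗᵢ[ℂ] L2 d where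
  toFun f := (memLp_modulate z (Lp.memLp f)).toLp _
  map_add' f g := by
    rw [← MemLp.toLp_add]
    apply MemLp.toLp_congr
    filter_upwards [Lp.coeFn_add f g] with x hx
    simp only [hx, Pi.add_apply, mul_add]
  map_smul' a f := by
    rw [RingHom.id_apply, ← MemLp.toLp_const_smul]
    apply MemLp.toLp_congr
    filter_upwards [Lp.coeFn_smul a f] with x hx
    simp only [hx, Pi.smul_apply, smul_eq_mul]
    ring
  norm_map' f := by
    change ‖(memLp_modulate z (Lp.memLp f)).toLp _‖ = ‖f‖
    rw [Lp.norm_toLp, Lp.norm_def]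
    congr 1
    refine eLpNorm_congr_norm_ae (Eventually.of_forall fun x => ?_)
    rw [norm_mul, norm_mFourier, one_mul]

theorem modulate_ae (z : Fin d → ℤ) (f : L2 d) :
    modulate z f =ᵐ[volume] fun x => UnitAddTorus.mFourier z (toTorus x) * f x :=
  MemLp.coeFn_toLp (memLp_modulate z (Lp.memLp f))

theorem fourier_comp_add (f : Rd d → ℂ) (a x : Rd d) :
    𝓕 (fun t => f (t + a)) x = Complex.exp (2 * Real.pi * Complex.I * (⟪a, x⟫_ℝ : ℝ)) * 𝓕 f x := by
  rw [Real.fourier_eq', Real.fourier_eq',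
    ← integral_add_right_eq_self _ (-a), ← integral_const_mul]
  congr 1
  ext t
  rw [neg_add_cancel_right, smul_eq_mul, smul_eq_mul, ← mul_assoc, ← Complex.exp_add,
    inner_add_left, inner_neg_left]
  congr 2
  push_cast
  ring

theorem fourier_comp_matrix (M : Matrix (Fin d) (Fin d) ℝ) (hM : M.det ≠ 0) (f : Rd d → ℂ)
    (x : Rd d) :
    𝓕 (fun t => f (Matrix.toEuclideanLin M t)) (Matrix.toEuclideanLin Mᵀ x)
      = ((|M.det|⁻¹ : ℝ) : ℂ) * 𝓕 f x := by
  have hdet : LinearMap.det (Matrix.toEuclideanLin M) ≠ 0 := by rwa [det_toEuclideanLin]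
  let e : Rd d ≃L[ℝ] Rd d := (LinearMap.equivOfDetNeZero _ hdet).toContinuousLinearEquiv
  have he : ∀ t, e t = Matrix.toEuclideanLin M t := fun t => rfl
  rw [Real.fourier_eq', Real.fourier_eq']
  have h1 : ∀ t, ⟪t, Matrix.toEuclideanLin Mᵀ x⟫_ℝ = ⟪Matrix.toEuclideanLin M t, x⟫_ℝ := by
    intro t
    have : Mᵀ = Mᴴ := by ext; simp
    rw [this, Matrix.toEuclideanLin_conjTranspose_eq_adjoint, LinearMap.adjoint_inner_right]
  simp_rw [h1]
  have h3 : MeasurableEmbedding (Matrix.toEuclideanLin M) :=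
    e.toHomeomorph.measurableEmbedding
  rw [← h3.integral_map (μ := (volume : Measure (Rd d)))
    (fun t => Complex.exp (((-2 * Real.pi * ⟪t, x⟫_ℝ : ℝ) : ℂ) * Complex.I) • f t),
    map_matrix_volume M hM, integral_smul_measure, ENNReal.toReal_ofReal (abs_nonneg _), abs_inv]
  rfl

/-- Identities for the `L²` Fourier transform are checked on Schwartz functions, where the integral
formula applies, and extended by density. -/
theorem isClosed_induction {p : L2 d → Prop} (hp : IsClosed {f | p f})
    (h : ∀ s : SchwartzMap (Rd d) ℂ, p (s.toLp 2)) (f : L2 d) : p f :=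
  DenseRange.induction_on (p := p)
    (SchwartzMap.denseRange_toLpCLM (p := 2) (μ := volume) (E := Rd d) (F := ℂ) (by simp)) f hp h

theorem fourier_translate (z : Fin d → ℤ) (f : L2 d) :
    (𝓕 (translate z f) : L2 d) = modulate z (𝓕 f) := by
  refine isClosed_induction (p := fun f => (𝓕 (translate z f) : L2 d) = modulate z (𝓕 f)) ?_ ?_ f
  · exact isClosed_eq ((Lp.fourierTransformₗᵢ (Rd d) ℂ).continuous.comp (translate z).continuous)
      ((modulate z).continuous.comp (Lp.fourierTransformₗᵢ (Rd d) ℂ).continuous)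
  · intro s
    let s' : SchwartzMap (Rd d) ℂ := SchwartzMap.compSubConstCLM ℂ (-intVec z) s
    have hs' : (s' : Rd d → ℂ) = fun t => s (t + intVec z) := by
      ext t; simp [s', SchwartzMap.compSubConstCLM_apply]
    have h1 : translate z (s.toLp 2) = s'.toLp 2 := by
      refine Lp.ext ?_
      filter_upwards [translate_ae z (s.toLp 2), s'.coeFn_toLp 2 volume,
        (measurePreserving_add_right volume (intVec z)).quasiMeasurePreserving.ae
          (s.coeFn_toLp 2 volume)] with t ht1 ht2 ht3
      rw [ht1, ht2, ht3, hs']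
    rw [h1, SchwartzMap.toLp_fourier_eq, SchwartzMap.toLp_fourier_eq]
    refine Lp.ext ?_
    filter_upwards [(𝓕 s').coeFn_toLp 2 volume, (𝓕 s).coeFn_toLp 2 volume,
      modulate_ae z ((𝓕 s).toLp 2)] with x h2 h3 h4
    rw [h2, h4, h3, SchwartzMap.fourier_coe, SchwartzMap.fourier_coe, hs', fourier_comp_add,
      mFourier_toTorus]

variable {A : Matrix (Fin d) (Fin d) ℤ}

/-- The change of variables gives the factor `√N · N⁻¹`, which the outer dilation by `B` multiplies
by `√N`. Placing that dilation on the left keeps inverse matrices out of the formula. -/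
theorem fourier_dilation (hA : IsExpansive A) (f : L2 d) :
    dilateIsom (realMat A)ᵀ hA.transpose_det_ne_zero (𝓕 (dilation hA f)) = (𝓕 f : L2 d) := by
  refine isClosed_induction (p := fun f =>
    dilateIsom (realMat A)ᵀ hA.transpose_det_ne_zero (𝓕 (dilation hA f)) = (𝓕 f : L2 d)) ?_ ?_ f
  · exact isClosed_eq ((dilateIsom _ _).continuous.comp
      ((Lp.fourierTransformₗᵢ (Rd d) ℂ).continuous.comp (dilation hA).continuous))
      (Lp.fourierTransformₗᵢ (Rd d) ℂ).continuous
  · intro s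
    have hdet : LinearMap.det (Matrix.toEuclideanLin (realMat A)) ≠ 0 := by
      rw [det_toEuclideanLin]; exact realMat_det_ne_zero hA
    let e : Rd d ≃L[ℝ] Rd d := (LinearMap.equivOfDetNeZero _ hdet).toContinuousLinearEquiv
    let s' : SchwartzMap (Rd d) ℂ :=
      ((√(detN A) : ℝ) : ℂ) • SchwartzMap.compCLMOfContinuousLinearEquiv ℂ e s
    have hs' : (s' : Rd d → ℂ) = ((√(detN A) : ℝ) : ℂ) •
        fun t => s (Matrix.toEuclideanLin (realMat A) t) := by
      ext t; rfl
    have h1 : dilation hA (s.toLp 2) = s'.toLp 2 := by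
      refine Lp.ext ?_
      filter_upwards [dilation_ae hA (s.toLp 2), s'.coeFn_toLp 2 volume,
        ae_comp_matrix _ (realMat_det_ne_zero hA) (s.coeFn_toLp 2 volume)] with t ht1 ht2 ht3
      rw [ht1, ht2, ht3, hs']
      rfl
    rw [h1, SchwartzMap.toLp_fourier_eq, SchwartzMap.toLp_fourier_eq]
    refine Lp.ext ?_
    filter_upwards [ae_comp_matrix _ hA.transpose_det_ne_zero ((𝓕 s').coeFn_toLp 2 volume),
      (𝓕 s).coeFn_toLp 2 volume,
      dilateIsom_ae (realMat A)ᵀ hA.transpose_det_ne_zero ((𝓕 s').toLp 2)] with x h2 h3 h4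
    have hN := detN_pos hA
    have h5 : 𝓕 (((√(detN A) : ℝ) : ℂ) • fun t => s (Matrix.toEuclideanLin (realMat A) t))
        (Matrix.toEuclideanLin (realMat A)ᵀ x) = ((√(detN A) : ℝ) : ℂ) *
        𝓕 (fun t => s (Matrix.toEuclideanLin (realMat A) t))
          (Matrix.toEuclideanLin (realMat A)ᵀ x) := by
      rw [Real.fourier_eq', Real.fourier_eq', ← integral_const_mul]
      congr 1
      ext t
      simp only [Pi.smul_apply, smul_eq_mul]
      ring
    rw [h4, h2, h3, SchwartzMap.fourier_coe, SchwartzMap.fourier_coe, hs', h5,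
      fourier_comp_matrix _ (realMat_det_ne_zero hA), Matrix.det_transpose, ← detN_eq_abs,
      ← mul_assoc, ← mul_assoc, ← Complex.ofReal_mul, ← Complex.ofReal_mul,
      Real.mul_self_sqrt hN.le, mul_inv_cancel₀ hN.ne', Complex.ofReal_one, one_mul]

/-- `𝓕 (δ⁻¹ f)(x) = √N 𝓕 f (B x)`. -/
theorem fourier_dilation_symm_ae (hA : IsExpansive A) (f : L2 d) :
    (𝓕 ((dilation hA).symm f) : L2 d) =ᵐ[volume]
      fun x => ((√(detN A) : ℝ) : ℂ) * (𝓕 f : L2 d) (mulB A x) := by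
  have h1 := fourier_dilation hA ((dilation hA).symm f)
  rw [LinearIsometryEquiv.apply_symm_apply] at h1
  rw [← h1]
  have h2 := dilateIsom_ae (realMat A)ᵀ hA.transpose_det_ne_zero (𝓕 f : L2 d)
  rw [Matrix.det_transpose, ← detN_eq_abs] at h2
  exact h2

theorem ae_mulB (hA : IsExpansive A) {p : Rd d → Prop} (hp : ∀ᵐ x, p x) :
    ∀ᵐ x, p (mulB A x) :=
  ae_comp_matrix _ hA.transpose_det_ne_zero hp

theorem ae_invB (hA : IsExpansive A) {p : Rd d → Prop} (hp : ∀ᵐ x, p x) :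
    ∀ᵐ x, p (invB A x) := by
  refine ae_comp_matrix _ ?_ hp
  rw [Matrix.det_nonsing_inv, Ring.inverse_eq_inv']
  exact inv_ne_zero hA.transpose_det_ne_zero

/-- The coefficients of the analysis operator of the translates, on the Fourier side. -/
theorem inner_translate (z : Fin d → ℤ) (φ f : L2 d) :
    ⟪translate z φ, f⟫_ℂ = ∫ x, conj (UnitAddTorus.mFourier z (toTorus x)) *
      ((𝓕 f : L2 d) x * conj ((𝓕 φ : L2 d) x)) := by
  rw [← Lp.inner_fourier_eq, fourier_translate, L2.inner_def]
  refine integral_congr_ae ?_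
  filter_upwards [modulate_ae z (𝓕 φ : L2 d)] with x hx
  rw [hx, RCLike.inner_apply, map_mul]
  ring

theorem tsum_inner_translate (φ f : L2 d)
    (hb : MemLp (bracket (𝓕 f : L2 d) (𝓕 φ : L2 d)) 2 (torusHaar d)) :
    ∑' z, ‖⟪translate z φ, f⟫_ℂ‖ₑ ^ 2
      = ∫⁻ ω, ‖bracket (𝓕 f : L2 d) (𝓕 φ : L2 d) ω‖ₑ ^ 2 ∂torusHaar d := by
  rw [← parseval_bracket (Lp.memLp _) (Lp.memLp _) hb]
  simp_rw [inner_translate]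

end GenFilter

end

noncomputable section

namespace GenFilter

variable {d : ℕ} {A : Matrix (Fin d) (Fin d) ℤ}

/-! ### The translation group -/

theorem translate_add (z w : Fin d → ℤ) (f : L2 d) :
    translate (z + w) f = translate z (translate w f) := by
  refine Lp.ext ?_
  filter_upwards [translate_ae (z + w) f, translate_ae z (translate w f),
    (measurePreserving_add_right volume (intVec z)).quasiMeasurePreserving.ae
      (translate_ae w f)] with t h1 h2 h3
  rw [h1, h2, h3, intVec_add, add_assoc]

theorem translate_zero (f : L2 d) : translate 0 f = f := by
  refine Lp.ext ?_
  filter_upwards [translate_ae 0 f] with t h1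
  rw [h1, intVec_zero, add_zero]

theorem inner_translate_left (z : Fin d → ℤ) (f g : L2 d) :
    ⟪translate z f, g⟫_ℂ = ⟪f, translate (-z) g⟫_ℂ := by
  rw [← (translate (-z)).inner_map_map, ← translate_add, neg_add_cancel, translate_zero]

theorem translate_dilation (hA : IsExpansive A) (z : Fin d → ℤ) (f : L2 d) :
    translate z (dilation hA f) = dilation hA (translate (A *ᵥ z) f) := by
  refine Lp.ext ?_
  filter_upwards [translate_ae z (dilation hA f), dilation_ae hA (translate (A *ᵥ z) f),
    (measurePreserving_add_right volume (intVec z)).quasiMeasurePreserving.ae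
      (dilation_ae hA f),
    ae_comp_matrix _ (realMat_det_ne_zero hA) (translate_ae (A *ᵥ z) f)] with t h1 h2 h3 h4
  have h5 : Matrix.toEuclideanLin (realMat A) (intVec z) = intVec (A *ᵥ z) := by
    ext i
    simp [intVec, Matrix.toLpLin_apply, Matrix.mulVec, dotProduct, realMat]
  rw [h1, h2, h3, h4, map_add, h5]

/-- The sum `∑_{z,i} |⟨v, τ_z e_i⟩|²`. -/
def shiftSum {ι : Type*} (e : ι → L2 d) (v : L2 d) : ℝ≥0∞ :=
  ∑' p : (Fin d → ℤ) × ι, ‖⟪translate p.1 (e p.2), v⟫_ℂ‖ₑ ^ 2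

theorem shiftSum_eq_sum {ι : Type*} [Fintype ι] (e : ι → L2 d) (v : L2 d) :
    shiftSum e v = ∑ i, ∑' z, ‖⟪translate z (e i), v⟫_ℂ‖ₑ ^ 2 := by
  rw [shiftSum, ENNReal.tsum_prod', ENNReal.tsum_comm, tsum_fintype]

/-- Two finite families whose translates act as Parseval frames on each other have the same
total size. -/
theorem sum_enorm_sq_eq {ι κ : Type*} [Fintype ι] [Fintype κ] {e : ι → L2 d} {f : κ → L2 d}
    (h1 : ∀ k, shiftSum e (f k) = ‖f k‖ₑ ^ 2) (h2 : ∀ i, shiftSum f (e i) = ‖e i‖ₑ ^ 2) :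
    ∑ i, ‖e i‖ₑ ^ 2 = ∑ k, ‖f k‖ₑ ^ 2 := by
  simp_rw [← h1, ← h2, shiftSum_eq_sum]
  rw [Finset.sum_comm]
  refine Finset.sum_congr rfl fun k _ => Finset.sum_congr rfl fun i _ => ?_
  -- Moving the translation to the other side of the inner product replaces `z` by `-z`; after this
  -- reindexing both double sums are the same.
  rw [← (Equiv.neg (Fin d → ℤ)).tsum_eq]
  refine tsum_congr fun z => ?_
  rw [Equiv.neg_apply, inner_translate_left, neg_neg, ← inner_conj_symm, RCLike.enorm_conj]

/-! ### Generators coming from a multiplicity function -/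

/-- The generators are pulled back from the constant function `1` on each summand `L²(S_i)`. Its
modulations are the exponentials cut down to `S_i`, which form a Parseval frame of `L²(S_i)`. -/
theorem exists_parseval_generators {V : Submodule ℂ (L2 d)} {c : ℕ} {m : Torus d → ℕ}
    (hm : IsMultiplicityFunction V c m) :
    ∃ e : Fin c → L2 d, (∀ i, e i ∈ V) ∧ (∀ v ∈ V, shiftSum e v = ‖v‖ₑ ^ 2) ∧
      ∀ i, ‖e i‖ₑ ^ 2 = torusHaar d (levelSet m i) := by
  obtain ⟨hmeas, -, J, hJ⟩ := hm
  have hS : ∀ i : Fin c, MeasurableSet (levelSet m i) := fun i => by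
    have : levelSet m i = m ⁻¹' Set.Ioi (i : ℕ) := rfl
    rw [this]
    exact hmeas measurableSet_Ioi
  let one : ∀ i : Fin c, Lp ℂ 2 ((torusHaar d).restrict (levelSet m i)) := fun i =>
    Lp.const 2 _ (1 : ℂ)
  let E : ∀ i : Fin c, PiLp 2 fun i : Fin c => Lp ℂ 2 ((torusHaar d).restrict (levelSet m i)) :=
    fun i => WithLp.toLp 2 (Pi.single i (one i))
  have henorm : ∀ w : V, ‖(w : L2 d)‖ₑ ^ 2 = ∑ i, ‖J w i‖ₑ ^ 2 := by
    intro w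
    have h1 : ‖(w : L2 d)‖ ^ 2 = ∑ i, ‖J w i‖ ^ 2 := by
      rw [← PiLp.norm_sq_eq_of_L2, J.norm_map]; rfl
    have h2 := congrArg ENNReal.ofReal h1
    rw [ENNReal.ofReal_sum_of_nonneg (fun _ _ => by positivity)] at h2
    simpa only [ENNReal.ofReal_pow (norm_nonneg _), ofReal_norm] using h2
  refine ⟨fun i => (J.symm (E i) : L2 d), fun i => (J.symm (E i)).2, ?_, ?_⟩
  · intro v hv
    rw [shiftSum_eq_sum, henorm ⟨v, hv⟩]
    refine Finset.sum_congr rfl fun i _ => ?_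
    set b : Lp ℂ 2 ((torusHaar d).restrict (levelSet m i)) := J ⟨v, hv⟩ i with hb
    -- Extension by zero turns coefficients on `S_i` into Fourier coefficients on the full torus,
    -- where Parseval's identity is available.
    have hbm : MemLp ((levelSet m i).indicator b) 2 (torusHaar d) :=
      (memLp_indicator_iff_restrict (hS i)).mpr (Lp.memLp b)
    have key : ∀ z, ⟪translate z (J.symm (E i) : L2 d), v⟫_ℂ
        = ∫ ω, conj (UnitAddTorus.mFourier z ω) * (levelSet m i).indicator b ω ∂torusHaar d := by
      intro z
      obtain ⟨hf, hJz⟩ := hJ z (J.symm (E i))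
      have h1 : ⟪translate z (J.symm (E i) : L2 d), v⟫_ℂ
          = ⟪J ⟨translate z (J.symm (E i) : L2 d), hf⟩, J ⟨v, hv⟩⟫_ℂ := by
        rw [J.inner_map_map]; rfl
      rw [h1, PiLp.inner_apply, Finset.sum_eq_single i]
      · rw [← hb, L2.inner_def]
        have h2 : ∀ ω, conj (UnitAddTorus.mFourier z ω) * (levelSet m i).indicator b ω
            = (levelSet m i).indicator (fun ω => conj (UnitAddTorus.mFourier z ω) * b ω) ω := by
          intro ω
          rw [Set.indicator_mul_right]
        simp_rw [h2]
        rw [integral_indicator (hS i)]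
        refine integral_congr_ae ?_
        have h3 := hJz i
        rw [LinearIsometryEquiv.apply_symm_apply] at h3
        have h4 : E i i = one i := by simp [E]
        rw [h4] at h3
        filter_upwards [h3, Lp.coeFn_const (p := 2)
          (μ := (torusHaar d).restrict (levelSet m i)) (1 : ℂ)] with ω h5 h6
        rw [h5, h6, Function.const_apply, mul_one, RCLike.inner_apply, mul_comm]
      · intro j _ hji
        rw [L2.inner_def]
        have h3 := hJz j
        rw [LinearIsometryEquiv.apply_symm_apply] at h3
        have h4 : E i j = 0 := by simp [E, Pi.single_eq_of_ne hji]
        rw [h4] at h3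
        rw [← integral_zero (Torus d) ℂ]
        refine integral_congr_ae ?_
        filter_upwards [h3, Lp.coeFn_zero ℂ 2 ((torusHaar d).restrict (levelSet m j))] with ω h5 h6
        rw [h5, h6, Pi.zero_apply, mul_zero, inner_zero_left]
      · simp
    simp_rw [key]
    rw [parseval_torus hbm, enorm_sq_Lp, ← lintegral_indicator (hS i)]
    refine lintegral_congr fun ω => ?_
    by_cases hω : ω ∈ levelSet m i <;> simp [hω]
  · intro i
    rw [henorm, LinearIsometryEquiv.apply_symm_apply, Finset.sum_eq_single i]
    · have h4 : E i i = one i := by simp [E]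
      rw [h4, enorm_sq_Lp, ← Measure.restrict_apply_univ (levelSet m i), ← lintegral_one]
      refine lintegral_congr_ae ?_
      filter_upwards [Lp.coeFn_const (p := 2)
          (μ := (torusHaar d).restrict (levelSet m i)) (1 : ℂ)] with ω h6
      rw [h6]; simp
    · intro j _ hji
      have h4 : E i j = 0 := by simp [E, Pi.single_eq_of_ne hji]
      rw [h4]; simp
    · simp

/-! ### The consistency equation, integrated -/

/-- Coset representatives of `A ℤ^d`. Since `τ_z δ = δ τ_{Az}`, they show how many generators `δ
(V)` needs for translations by the whole of `ℤ^d`. -/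
theorem exists_coset_equiv (hA : IsExpansive A) :
    ∃ (r : Fin A.det.natAbs → Fin d → ℤ),
      Function.Bijective fun p : (Fin d → ℤ) × Fin A.det.natAbs => A *ᵥ p.1 + r p.2 := by
  let Q := (Fin d → ℤ) ⧸ LinearMap.range A.mulVecLin
  have hcard : Nat.card Q = A.det.natAbs := card_quotient_range A hA.det_ne_zero
  have : Finite Q := Nat.finite_of_card_ne_zero (by rw [hcard]; simpa using hA.det_ne_zero)
  let q : Fin A.det.natAbs ≃ Q := (Finite.equivFinOfCardEq hcard).symm
  refine ⟨fun k => (q k).out, ?_, ?_⟩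
  · rintro ⟨z, k⟩ ⟨w, l⟩ h
    simp only at h
    have h1 : q k = q l := by
      have h2 : (Submodule.Quotient.mk (A *ᵥ z + (q k).out) : Q)
          = Submodule.Quotient.mk (A *ᵥ w + (q l).out) := by rw [h]
      have h3 : ∀ u, (Submodule.Quotient.mk (A *ᵥ u) : Q) = 0 := fun u =>
        (Submodule.Quotient.mk_eq_zero _).mpr ⟨u, rfl⟩
      rw [Submodule.Quotient.mk_add, Submodule.Quotient.mk_add, h3, h3, zero_add, zero_add] at h2
      have h4 : ∀ x : Q, (Submodule.Quotient.mk x.out : Q) = x := fun x => Quotient.out_eq' x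
      rwa [h4, h4] at h2
    obtain rfl := q.injective h1
    rw [add_left_inj] at h
    rw [mulVec_injective_of_det_ne_zero hA.det_ne_zero h]
  · intro y
    have h4 : (Submodule.Quotient.mk (Submodule.Quotient.mk y : Q).out : Q)
      = Submodule.Quotient.mk y := Quotient.out_eq' _
    obtain ⟨z, hz⟩ := (Submodule.Quotient.eq _).mp h4.symm
    refine ⟨(z, q.symm (Submodule.Quotient.mk y)), ?_⟩
    simp only [Equiv.apply_symm_apply]
    rw [Matrix.mulVecLin_apply] at hz
    rw [hz]
    abel

theorem enorm_sq_add_of_inner_eq_zero {v w : L2 d} (h : ⟪v, w⟫_ℂ = 0) :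
    ‖v + w‖ₑ ^ 2 = ‖v‖ₑ ^ 2 + ‖w‖ₑ ^ 2 := by
  have h1 := norm_add_sq_eq_norm_sq_add_norm_sq_of_inner_eq_zero v w h
  have h2 : ∀ u : L2 d, ‖u‖ₑ ^ 2 = ENNReal.ofReal (‖u‖ * ‖u‖) := fun u => by
    rw [ENNReal.ofReal_mul (norm_nonneg _), ofReal_norm, sq]
  rw [h2, h2, h2, h1, ENNReal.ofReal_add (by positivity) (by positivity)]

/-- Two systems of Parseval generators of `U 1` are compared by `sum_enorm_sq_eq`: generators of `U
0` together with those of its complement, and the dilates of coset translates of the generators of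
`U 0`. Their squared norms are measures of level sets. -/
theorem sum_levelSet_eq (hA : IsExpansive A) {U : ℤ → Submodule ℂ (L2 d)} (hU : IsGMRA hA U)
    {c c' : ℕ} {m m' : Torus d → ℕ} (hm : IsMultiplicityFunction (U 0) c m)
    (hm' : IsMultiplicityFunction (U 1 ⊓ (U 0)ᗮ) c' m') :
    ENNReal.ofReal (detN A) * ∑ j : Fin c, torusHaar d (levelSet m j)
      = ∑ i : Fin c, torusHaar d (levelSet m i) + ∑ k : Fin c', torusHaar d (levelSet m' k) := by
  obtain ⟨e, heV, he, hen⟩ := exists_parseval_generators hm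
  obtain ⟨e', heV', he', hen'⟩ := exists_parseval_generators hm'
  obtain ⟨r, hr⟩ := exists_coset_equiv hA
  have h01 : U 0 ≤ U 1 := by simpa using hU.le_succ 0
  have hU1 : U 1 = (U 0).map (dilation hA).toLinearEquiv.toLinearMap := by
    simpa using hU.succ_eq 0
  let E : Fin c ⊕ Fin c' → L2 d := Sum.elim e e'
  -- The translate of `F (k, i)` by `z` is `δ τ_y e_i` with `y = A z + r k`, and every lattice point
  -- `y` occurs exactly once.
  let F : Fin A.det.natAbs × Fin c → L2 d := fun p => dilation hA (translate (r p.1) (e p.2))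
  have hclosed := hU.isClosed 0
  have : CompleteSpace (U 0) := hclosed.completeSpace_coe
  have hE : ∀ v ∈ U 1, shiftSum E v = ‖v‖ₑ ^ 2 := by
    intro v hv
    obtain ⟨a, ha, b, hb, rfl⟩ := (U 0).exists_add_mem_mem_orthogonal v
    have hb1 : b ∈ U 1 ⊓ (U 0)ᗮ := ⟨by simpa using (U 1).sub_mem hv (h01 ha), hb⟩
    have hab : ⟪a, b⟫_ℂ = 0 := hb a ha
    rw [enorm_sq_add_of_inner_eq_zero hab, shiftSum_eq_sum, Fintype.sum_sum_type,
      ← he a ha, ← he' b hb1, shiftSum_eq_sum, shiftSum_eq_sum]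
    -- The intertwining property of `J'` contains the translation invariance of the complement,
    -- which is what makes the translates of `e'` orthogonal to `U 0`.
    obtain ⟨-, -, J', hJ'⟩ := hm'
    congr 1
    · refine Finset.sum_congr rfl fun i _ => tsum_congr fun z => ?_
      have : ⟪translate z (e i), b⟫_ℂ = 0 := hb _ (hU.translate_mem z _ (heV i))
      rw [inner_add_right]
      change ‖_ + ⟪translate z (e i), b⟫_ℂ‖ₑ ^ 2 = _
      rw [this, add_zero]
      rfl
    · refine Finset.sum_congr rfl fun i _ => tsum_congr fun z => ?_
      obtain ⟨hz, -⟩ := hJ' z ⟨e' i, heV' i⟩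
      have : ⟪translate z (e' i), a⟫_ℂ = 0 := by
        rw [← inner_conj_symm, hz.2 a ha, map_zero]
      rw [inner_add_right]
      change ‖⟪translate z (e' i), a⟫_ℂ + _‖ₑ ^ 2 = _
      rw [this, zero_add]
      rfl
  have hF : ∀ v ∈ U 1, shiftSum F v = ‖v‖ₑ ^ 2 := by
    intro v hv
    rw [hU1] at hv
    obtain ⟨w, hw, rfl⟩ := hv
    change shiftSum F (dilation hA w) = ‖dilation hA w‖ₑ ^ 2
    rw [show ‖dilation hA w‖ₑ = ‖w‖ₑ by
      rw [← ofReal_norm, LinearIsometryEquiv.norm_map, ofReal_norm], ← he w hw,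
      shiftSum_eq_sum, Fintype.sum_prod_type, Finset.sum_comm, shiftSum_eq_sum]
    refine Finset.sum_congr rfl fun i _ => ?_
    rw [← (Equiv.ofBijective _ hr).tsum_eq, ENNReal.tsum_prod', ENNReal.tsum_comm, tsum_fintype]
    refine Finset.sum_congr rfl fun k _ => tsum_congr fun z => ?_
    rw [Equiv.ofBijective_apply, translate_dilation, ← translate_add]
    erw [LinearIsometryEquiv.inner_map_map]
  have hEV : ∀ s, E s ∈ U 1 := by
    rintro (i | k)
    · exact h01 (heV i)
    · exact (heV' k).1
  have hFV : ∀ p, F p ∈ U 1 := by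
    intro p
    rw [hU1]
    exact ⟨_, hU.translate_mem _ _ (heV p.2), rfl⟩
  have h := sum_enorm_sq_eq (fun p => hE _ (hFV p)) (fun s => hF _ (hEV s))
  rw [Fintype.sum_sum_type, Fintype.sum_prod_type] at h
  have h1 : ∀ (k : Fin A.det.natAbs) (i : Fin c), ‖F (k, i)‖ₑ ^ 2 = torusHaar d (levelSet m i) := by
    intro k i
    rw [← hen, ← ofReal_norm, ← ofReal_norm]
    simp only [F]
    rw [LinearIsometryEquiv.norm_map, LinearIsometry.norm_map]
  simp only [E, Sum.elim_inl, Sum.elim_inr, hen, hen', h1, Finset.sum_const, Finset.card_univ,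
    Fintype.card_fin, nsmul_eq_mul] at h
  rw [h, detN, ENNReal.ofReal_natCast]

end GenFilter

end

noncomputable section

namespace GenFilter

variable {d : ℕ} {A : Matrix (Fin d) (Fin d) ℤ}

/-! ### Partial isometries with prescribed initial and final coordinates -/

section PartialIsometry

variable {ι κ : Type*} [Fintype ι] [Fintype κ]

theorem trace_conjTranspose_mul_self_eq (S : Matrix κ κ ℂ) :
    (Sᴴ * S).trace = ((∑ a, ∑ b, ‖S b a‖ ^ 2 : ℝ) : ℂ) := by
  simp only [Matrix.trace, Matrix.diag, Matrix.mul_apply, Matrix.conjTranspose_apply,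
    Complex.ofReal_sum]
  refine Finset.sum_congr rfl fun a _ => Finset.sum_congr rfl fun b _ => ?_
  rw [← starRingEnd_apply, Complex.conj_mul']
  push_cast
  rfl

variable [DecidableEq ι] [DecidableEq κ]

/-- If `K Kᴴ = N D` and `K E = K` for coordinate projections `D` and `E`, then `E - N⁻¹ Kᴴ K` is a
projection, whose trace is `tr E - tr D`. -/
theorem sum_sub_sum_eq_of_mul_conjTranspose {K : Matrix ι κ ℂ} {N : ℝ} (hN : 0 < N) {p : ι → ℝ}
    {q : κ → ℝ} (hp : ∀ a, p a = 0 ∨ p a = 1) (hq : ∀ b, q b = 0 ∨ q b = 1)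
    (hK : K * Kᴴ = Matrix.diagonal fun a => (N : ℂ) * p a)
    (hKq : ∀ a b, q b = 0 → K a b = 0) :
    ∑ b, q b - ∑ a, p a = ∑ a, ∑ b,
      ‖(Matrix.diagonal (fun b => (q b : ℂ)) - (N : ℂ)⁻¹ • (Kᴴ * K)) b a‖ ^ 2 := by
  have hN' : (N : ℂ) ≠ 0 := by exact_mod_cast hN.ne'
  -- A vanishing diagonal entry of `K Kᴴ` is the squared norm of a row, so that row is zero.
  have hK0 : ∀ a b, p a = 0 → K a b = 0 := by
    intro a b ha
    have h1 := congrFun (congrFun hK a) a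
    rw [Matrix.diagonal_apply_eq, ha, Matrix.mul_apply] at h1
    simp only [Matrix.conjTranspose_apply, ← starRingEnd_apply, Complex.mul_conj'] at h1
    have h2 : ∑ b, ‖K a b‖ ^ 2 = 0 := by
      have : ((∑ b, ‖K a b‖ ^ 2 : ℝ) : ℂ) = 0 := by
        push_cast; simpa using h1
      exact_mod_cast this
    have h3 := (Finset.sum_eq_zero_iff_of_nonneg fun _ _ => by positivity).mp h2 b
      (Finset.mem_univ b)
    simpa using h3
  set D : Matrix κ κ ℂ := Matrix.diagonal fun b => (q b : ℂ) with hD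
  set R : Matrix κ κ ℂ := (N : ℂ)⁻¹ • (Kᴴ * K) with hR
  have h1 : K * D = K := by
    ext a b
    rw [hD, Matrix.mul_diagonal]
    rcases hq b with h | h <;> simp [h, hKq a b]
  have h2 : (Matrix.diagonal fun a => (N : ℂ) * p a) * K = (N : ℂ) • K := by
    ext a b
    rw [Matrix.diagonal_mul]
    rcases hp a with h | h <;> simp [h, hK0 a b]
  have hDH : Dᴴ = D := by
    rw [hD, Matrix.diagonal_conjTranspose]
    congr 1; ext b; simp
  have h3 : D * Kᴴ = Kᴴ := by
    have := congrArg Matrix.conjTranspose h1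
    rwa [Matrix.conjTranspose_mul, hDH] at this
  have hRH : Rᴴ = R := by
    rw [hR, Matrix.conjTranspose_smul, Matrix.conjTranspose_mul, Matrix.conjTranspose_conjTranspose]
    congr 1
    simp
  have hRR : R * R = R := by
    rw [hR, Matrix.smul_mul, Matrix.mul_smul]
    have : Kᴴ * K * (Kᴴ * K) = (N : ℂ) • (Kᴴ * K) := by
      rw [Matrix.mul_assoc, ← Matrix.mul_assoc K, hK, h2, Matrix.mul_smul]
    rw [this, smul_smul, smul_smul]
    congr 1
    field_simp
  have hDD : D * D = D := by
    rw [hD, Matrix.diagonal_mul_diagonal]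
    congr 1; ext b
    rcases hq b with h | h <;> simp [h]
  have hDR : D * R = R := by rw [hR, Matrix.mul_smul, ← Matrix.mul_assoc, h3]
  have hRD : R * D = R := by rw [hR, Matrix.smul_mul, Matrix.mul_assoc, h1]
  have hS : (D - R)ᴴ * (D - R) = D - R := by
    rw [Matrix.conjTranspose_sub, hDH, hRH, Matrix.sub_mul, Matrix.mul_sub, Matrix.mul_sub, hDD,
      hRR, hDR, hRD]
    abel
  have h4 := trace_conjTranspose_mul_self_eq (D - R)
  rw [hS, Matrix.trace_sub, hR, Matrix.trace_smul, Matrix.trace_mul_comm, hK, hD,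
    Matrix.trace_diagonal, Matrix.trace_diagonal, ← Finset.mul_sum, smul_eq_mul,
    inv_mul_cancel_left₀ hN'] at h4
  refine Complex.ofReal_injective (Eq.trans ?_ h4)
  push_cast
  rfl

/-- Under the trace inequality the projection of the previous lemma has Hilbert–Schmidt norm zero.
Hence `Kᴴ K = N E`, so `K` is `√N` times an isometry on vectors supported where `q` is `1`. -/
theorem sum_norm_sq_eq_of_mul_conjTranspose {K : Matrix ι κ ℂ} {N : ℝ} (hN : 0 < N) {p : ι → ℝ}
    {q : κ → ℝ} (hp : ∀ a, p a = 0 ∨ p a = 1) (hq : ∀ b, q b = 0 ∨ q b = 1)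
    (hK : K * Kᴴ = Matrix.diagonal fun a => (N : ℂ) * p a)
    (hKq : ∀ a b, q b = 0 → K a b = 0) (hpq : ∑ b, q b ≤ ∑ a, p a) {v : κ → ℂ}
    (hv : ∀ b, q b = 0 → v b = 0) :
    ∑ a, ‖∑ b, conj (K a b) * v b‖ ^ 2 = N * ∑ b, ‖v b‖ ^ 2 := by
  have hN' : (N : ℂ) ≠ 0 := by exact_mod_cast hN.ne'
  have h1 := sum_sub_sum_eq_of_mul_conjTranspose hN hp hq hK hKq
  set S := Matrix.diagonal (fun b => (q b : ℂ)) - (N : ℂ)⁻¹ • (Kᴴ * K) with hS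
  have h2 : ∑ a, ∑ b, ‖S b a‖ ^ 2 = 0 := by
    refine le_antisymm (by linarith) (Finset.sum_nonneg fun _ _ => Finset.sum_nonneg fun _ _ => ?_)
    positivity
  have h3 : S = 0 := by
    ext b a
    have h4 := (Finset.sum_eq_zero_iff_of_nonneg fun _ _ =>
      Finset.sum_nonneg fun _ _ => by positivity).mp h2 a (Finset.mem_univ a)
    have h5 := (Finset.sum_eq_zero_iff_of_nonneg fun _ _ => by positivity).mp h4 b
      (Finset.mem_univ b)
    simpa using h5
  have h4 : Kᴴ * K = (N : ℂ) • Matrix.diagonal (fun b => (q b : ℂ)) := by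
    rw [sub_eq_zero.mp (hS.symm.trans h3), smul_smul, mul_inv_cancel₀ hN', one_smul]
  -- The sums in question carry `conj (K a b)`, so they are the conjugates of the coordinates of `K
  -- *ᵥ star v`.
  have h5 : star (K *ᵥ star v) ⬝ᵥ (K *ᵥ star v) = (N : ℂ) * ∑ b, ((‖v b‖ ^ 2 : ℝ) : ℂ) := by
    rw [Matrix.star_mulVec, ← Matrix.dotProduct_mulVec, Matrix.mulVec_mulVec, h4,
      Matrix.smul_mulVec, dotProduct_smul, smul_eq_mul]
    congr 1
    simp only [dotProduct, Matrix.mulVec_diagonal, Pi.star_apply, star_star]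
    refine Finset.sum_congr rfl fun b _ => ?_
    rcases hq b with h | h
    · simp [h, hv b h]
    · rw [h, ← starRingEnd_apply]
      push_cast
      rw [one_mul, Complex.mul_conj']
  have h6 : star (K *ᵥ star v) ⬝ᵥ (K *ᵥ star v)
      = ∑ a, ((‖∑ b, conj (K a b) * v b‖ ^ 2 : ℝ) : ℂ) := by
    simp only [dotProduct, Pi.star_apply]
    refine Finset.sum_congr rfl fun a _ => ?_
    have : star ((K *ᵥ star v) a) = ∑ b, conj (K a b) * v b := by
      simp [Matrix.mulVec, dotProduct]
    rw [← this, norm_star, ← starRingEnd_apply, Complex.conj_mul']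
    push_cast
    rfl
  rw [h5] at h6
  exact_mod_cast h6.symm

end PartialIsometry

/-! ### The filter matrix -/

section Filter

variable {c c' : ℕ} {m m' : Torus d → ℕ} {h : Fin c → Fin c → Torus d → ℂ}
  {g : Fin c' → Fin c → Torus d → ℂ}

/-- The matrix with rows indexed by the low-pass and high-pass filters and columns indexed by the
points of a fibre of `α` and the components of the filters. -/
def filterMatrix (A : Matrix (Fin d) (Fin d) ℤ) (h : Fin c → Fin c → Torus d → ℂ)
    (g : Fin c' → Fin c → Torus d → ℂ) (ζ : Torus d) :
    Matrix (Fin c ⊕ Fin c') ((endoHom A).ker × Fin c) ℂ :=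
  Matrix.of fun a b => Sum.elim (fun i => h i b.2 (ζ + b.1)) (fun k => g k b.2 (ζ + b.1)) a

theorem sum_ker_prod [Fintype (endoHom A).ker] (F : Fin c → Torus d → ℂ) (ζ : Torus d) :
    ∑ b : (endoHom A).ker × Fin c, F b.2 (ζ + b.1)
      = ∑ j, fiberSum A (F j) (torusEndo A ζ) := by
  rw [Fintype.sum_prod_type, Finset.sum_comm]
  simp_rw [fiberSum_eq]

variable [NeZero c]

theorem filterMatrix_mul_conjTranspose (hA : IsExpansive A) [Fintype (endoHom A).ker]
    (hlow : IsLowPass A m h) (hhigh : IsHighPass A m m' h g) :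
    ∀ᵐ ζ ∂torusHaar d, filterMatrix A h g ζ * (filterMatrix A h g ζ)ᴴ =
      Matrix.diagonal fun a => (detN A : ℂ) * ((Sum.elim
        (fun i : Fin c => (levelSet m i).indicator (fun _ => (1 : ℝ)) (torusEndo A ζ))
        (fun k : Fin c' => (levelSet m' k).indicator (fun _ => (1 : ℝ)) (torusEndo A ζ)) a : ℝ)
          : ℂ) := by
  have h1 := ae_torusEndo hA (ae_all_iff.mpr fun i => ae_all_iff.mpr fun i' => hlow.filter_eq i i')
  have h2 := ae_torusEndo hA
    (ae_all_iff.mpr fun k => ae_all_iff.mpr fun k' => hhigh.filter_eq k k')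
  have h3 := ae_torusEndo hA (ae_all_iff.mpr fun i => ae_all_iff.mpr fun k => hhigh.orthogonal i k)
  filter_upwards [h1, h2, h3] with ζ h1 h2 h3
  have hind : ∀ s : Set (Torus d), s.indicator (fun _ => (detN A : ℂ)) (torusEndo A ζ)
      = (detN A : ℂ) * ((s.indicator (fun _ => (1 : ℝ)) (torusEndo A ζ) : ℝ) : ℂ) := by
    intro s
    by_cases hs : torusEndo A ζ ∈ s <;> simp [hs]
  ext a b
  rw [Matrix.mul_apply]
  simp only [Matrix.conjTranspose_apply, filterMatrix, Matrix.of_apply, ← starRingEnd_apply]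
  rcases a with i | k <;> rcases b with i' | k'
  · simp only [Sum.elim_inl]
    rw [sum_ker_prod (fun j ω => h i j ω * conj (h i' j ω)) ζ, h1 i i', hind]
    by_cases hi : i = i'
    · subst hi; simp
    · simp [hi]
  · simp only [Sum.elim_inl, Sum.elim_inr]
    rw [sum_ker_prod (fun j ω => h i j ω * conj (g k' j ω)) ζ, h3 i k']
    simp
  · simp only [Sum.elim_inl, Sum.elim_inr]
    rw [sum_ker_prod (fun j ω => g k j ω * conj (h i' j ω)) ζ]
    -- The orthogonality relation is given only with the low-pass row first; this block is its
    -- conjugate.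
    have h4 := congrArg conj (h3 i' k)
    rw [← sum_ker_prod (fun j ω => h i' j ω * conj (g k j ω)) ζ] at h4
    rw [← sum_ker_prod (fun j ω => g k j ω * conj (h i' j ω)) ζ]
    simp only [map_sum, map_mul, Complex.conj_conj, map_zero] at h4
    simp_rw [mul_comm (g k _ _)]
    rw [h4]
    simp
  · simp only [Sum.elim_inr]
    rw [sum_ker_prod (fun j ω => g k j ω * conj (g k' j ω)) ζ, h2 k k', hind]
    by_cases hk : k = k'
    · subst hk; simp
    · simp [hk]

theorem filterMatrix_support (hA : IsExpansive A)
    (hlow : IsLowPass A m h) (hhigh : IsHighPass A m m' h g) :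
    ∀ᵐ ζ ∂torusHaar d, ∀ (a : Fin c ⊕ Fin c') (b : (endoHom A).ker × Fin c),
      ζ + (b.1 : Torus d) ∉ levelSet m b.2 → filterMatrix A h g ζ a b = 0 := by
  have h1 := ae_add_ker hA (ae_all_iff.mpr fun i => ae_all_iff.mpr fun j => hlow.support i j)
  have h2 := ae_add_ker hA (ae_all_iff.mpr fun k => ae_all_iff.mpr fun j => hhigh.support k j)
  filter_upwards [h1, h2] with ζ h1 h2
  rintro (i | k) ⟨κ, j⟩ hb
  · exact h1 κ i j hb
  · exact h2 κ k j hb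

theorem measurableSet_levelSet (hm : Measurable m) (i : ℕ) : MeasurableSet (levelSet m i) :=
  hm measurableSet_Ioi

theorem lintegral_sum_levelSet (hm : Measurable m) (n : ℕ) :
    ∫⁻ ω, ∑ i : Fin n, (levelSet m i).indicator 1 ω ∂torusHaar d
      = ∑ i : Fin n, torusHaar d (levelSet m i) := by
  rw [lintegral_finsetSum (f := fun (i : Fin n) ω => (levelSet m i).indicator 1 ω) _
    fun i _ => measurable_one.indicator (measurableSet_levelSet hm i)]
  simp_rw [lintegral_indicator_one (measurableSet_levelSet hm _)]

/-- The consistency equation holds pointwise. -/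
theorem ae_sum_levelSet_le (hA : IsExpansive A) [Fintype (endoHom A).ker]
    {U : ℤ → Submodule ℂ (L2 d)} (hU : IsGMRA hA U)
    (hm : IsMultiplicityFunction (U 0) c m)
    (hm' : IsMultiplicityFunction (U 1 ⊓ (U 0)ᗮ) c' m')
    (hlow : IsLowPass A m h) (hhigh : IsHighPass A m m' h g) :
    ∀ᵐ ζ ∂torusHaar d,
      ∑ b : (endoHom A).ker × Fin c, (levelSet m b.2).indicator (fun _ => (1 : ℝ)) (ζ + b.1)
        ≤ ∑ a : Fin c ⊕ Fin c', Sum.elim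
        (fun i : Fin c => (levelSet m i).indicator (fun _ => (1 : ℝ)) (torusEndo A ζ))
        (fun k : Fin c' => (levelSet m' k).indicator (fun _ => (1 : ℝ)) (torusEndo A ζ)) a := by
  classical
  have hS := measurableSet_levelSet hm.1
  have hS' := measurableSet_levelSet hm'.1
  let fD : Torus d → ℝ≥0∞ := fun ω => ∑ i : Fin c, (levelSet m i).indicator 1 ω +
    ∑ k : Fin c', (levelSet m' k).indicator 1 ω
  let fE : Torus d → ℝ≥0∞ := fun ω => ∑ j : Fin c, (levelSet m j).indicator 1 ω
  have hfE : Measurable fE := Finset.measurable_fun_sum _ fun i _ => measurable_one.indicator (hS i)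
  have hfE' : Measurable fun ω => ∑ k : Fin c', (levelSet m' k).indicator (1 : Torus d → ℝ≥0∞) ω :=
    Finset.measurable_fun_sum _ fun i _ => measurable_one.indicator (hS' i)
  have hfD : Measurable fD := hfE.add hfE'
  have hintE : ∫⁻ ζ, ∑ κ : (endoHom A).ker, fE (ζ + κ) ∂torusHaar d
      = ∑ i : Fin c, torusHaar d (levelSet m i) + ∑ k : Fin c', torusHaar d (levelSet m' k) := by
    rw [lintegral_sum_ker hA hfE.aemeasurable, ← sum_levelSet_eq hA hU hm hm']
    rw [lintegral_sum_levelSet hm.1]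
  have hintD : ∫⁻ ζ, fD (torusEndo A ζ) ∂torusHaar d
      = ∑ i : Fin c, torusHaar d (levelSet m i) + ∑ k : Fin c', torusHaar d (levelSet m' k) := by
    rw [lintegral_torusEndo hA hfD.aemeasurable, ← lintegral_sum_levelSet hm.1,
      ← lintegral_sum_levelSet hm'.1, ← lintegral_add_left hfE]
  have hofReal : ∀ (s : Set (Torus d)) ω, (s.indicator 1 ω : ℝ≥0∞)
      = ENNReal.ofReal (s.indicator (fun _ => (1 : ℝ)) ω) := by
    intro s ω
    by_cases hs : ω ∈ s <;> simp [hs]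
  have hnn : ∀ (s : Set (Torus d)) ω, 0 ≤ s.indicator (fun _ => (1 : ℝ)) ω := fun s ω =>
    Set.indicator_nonneg (fun _ _ => zero_le_one) ω
  have hD : ∀ ζ, fD (torusEndo A ζ) = ENNReal.ofReal (∑ a : Fin c ⊕ Fin c', Sum.elim
      (fun i : Fin c => (levelSet m i).indicator (fun _ => (1 : ℝ)) (torusEndo A ζ))
      (fun k : Fin c' => (levelSet m' k).indicator (fun _ => (1 : ℝ)) (torusEndo A ζ)) a) := by
    intro ζ
    simp only [Fintype.sum_sum_type, Sum.elim_inl, Sum.elim_inr]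
    rw [ENNReal.ofReal_add (Finset.sum_nonneg fun _ _ => hnn _ _)
      (Finset.sum_nonneg fun _ _ => hnn _ _), ENNReal.ofReal_sum_of_nonneg (fun _ _ => hnn _ _),
      ENNReal.ofReal_sum_of_nonneg (fun _ _ => hnn _ _)]
    simp only [fD, hofReal]
  have hE : ∀ ζ, ∑ κ : (endoHom A).ker, fE (ζ + κ) = ENNReal.ofReal
      (∑ b : (endoHom A).ker × Fin c,
        (levelSet m b.2).indicator (fun _ => (1 : ℝ)) (ζ + b.1)) := by
    intro ζ
    rw [ENNReal.ofReal_sum_of_nonneg (fun _ _ => hnn _ _), Fintype.sum_prod_type]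
    simp only [fE, hofReal]
  -- The filters give this inequality at almost every point, because the difference of the traces is
  -- a sum of squares. The opposite one, which is wanted, follows because both sides have the same
  -- finite integral.
  have hle : ∀ᵐ ζ ∂torusHaar d, fD (torusEndo A ζ) ≤ ∑ κ : (endoHom A).ker, fE (ζ + κ) := by
    filter_upwards [filterMatrix_mul_conjTranspose hA hlow hhigh,
      filterMatrix_support hA hlow hhigh] with ζ h1 h2
    rw [hD, hE]
    refine ENNReal.ofReal_le_ofReal ?_
    have h3 := sum_sub_sum_eq_of_mul_conjTranspose (detN_pos hA) (K := filterMatrix A h g ζ)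
      (q := fun b => (levelSet m b.2).indicator (fun _ => (1 : ℝ)) (ζ + b.1)) ?_ ?_ h1 ?_
    · rw [← sub_nonneg, h3]
      exact Finset.sum_nonneg fun _ _ => Finset.sum_nonneg fun _ _ => by positivity
    · rintro (i | k)
      · by_cases hs : torusEndo A ζ ∈ levelSet m i <;> simp [hs]
      · by_cases hs : torusEndo A ζ ∈ levelSet m' k <;> simp [hs]
    · intro b
      by_cases hs : ζ + b.1 ∈ levelSet m b.2 <;> simp [hs]
    · intro a b hb
      refine h2 a b fun hs => ?_
      simp [hs] at hb
  have hmeasE : Measurable fun ζ => ∑ κ : (endoHom A).ker, fE (ζ + κ) :=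
    Finset.measurable_fun_sum _ fun κ _ => hfE.comp (measurable_add_const _)
  have heq := ae_eq_of_ae_le_of_lintegral_le hle (by
    rw [hintD]
    exact (ENNReal.add_lt_top.mpr ⟨ENNReal.sum_lt_top.mpr fun _ _ => measure_lt_top _ _,
      ENNReal.sum_lt_top.mpr fun _ _ => measure_lt_top _ _⟩).ne) hmeasE.aemeasurable
    (by rw [hintE, hintD])
  filter_upwards [heq] with ζ hζ
  rw [hD, hE] at hζ
  refine (ENNReal.ofReal_le_ofReal_iff ?_).mp hζ.ge
  refine Finset.sum_nonneg ?_
  rintro (i | k) -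
  · exact hnn _ _
  · exact hnn _ _

/-- The filters preserve the norm of vectors supported in the level sets. -/
theorem ae_filter_isometry (hA : IsExpansive A) [Fintype (endoHom A).ker]
    {U : ℤ → Submodule ℂ (L2 d)} (hU : IsGMRA hA U)
    (hm : IsMultiplicityFunction (U 0) c m)
    (hm' : IsMultiplicityFunction (U 1 ⊓ (U 0)ᗮ) c' m')
    (hlow : IsLowPass A m h) (hhigh : IsHighPass A m m' h g) :
    ∀ᵐ ζ ∂torusHaar d, ∀ v : Fin c → Torus d → ℂ,
      (∀ (j : Fin c) (κ : (endoHom A).ker), ζ + (κ : Torus d) ∉ levelSet m j → v j (ζ + κ) = 0) →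
      ∑ i, ‖∑ κ : (endoHom A).ker, ∑ j, conj (h i j (ζ + κ)) * v j (ζ + κ)‖ ^ 2
        + ∑ k, ‖∑ κ : (endoHom A).ker, ∑ j, conj (g k j (ζ + κ)) * v j (ζ + κ)‖ ^ 2
        = detN A * ∑ κ : (endoHom A).ker, ∑ j, ‖v j (ζ + κ)‖ ^ 2 := by
  classical
  filter_upwards [filterMatrix_mul_conjTranspose hA hlow hhigh,
    filterMatrix_support hA hlow hhigh, ae_sum_levelSet_le hA hU hm hm' hlow hhigh]
    with ζ h1 h2 h3 v hv
  have h4 := sum_norm_sq_eq_of_mul_conjTranspose (detN_pos hA) (K := filterMatrix A h g ζ)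
      (q := fun b => (levelSet m b.2).indicator (fun _ => (1 : ℝ)) (ζ + b.1)) ?_ ?_ h1 ?_ h3
      (v := fun b => v b.2 (ζ + b.1)) ?_
  · rw [Fintype.sum_sum_type, Fintype.sum_prod_type] at h4
    simp only [Fintype.sum_prod_type] at h4
    exact h4
  · rintro (i | k)
    · by_cases hs : torusEndo A ζ ∈ levelSet m i <;> simp [hs]
    · by_cases hs : torusEndo A ζ ∈ levelSet m' k <;> simp [hs]
  · intro b
    by_cases hs : ζ + b.1 ∈ levelSet m b.2 <;> simp [hs]
  · intro a b hb
    refine h2 a b fun hs => ?_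
    simp [hs] at hb
  · intro b hb
    refine hv b.2 b.1 fun hs => ?_
    simp [hs] at hb

end Filter

end GenFilter

end

noncomputable section

namespace GenFilter

variable {d : ℕ} {A : Matrix (Fin d) (Fin d) ℤ}

/-! ### Powers of the inverse of an expansive matrix -/

/-- Gelfand's formula: any `ρ` strictly between the spectral radius and `1` bounds `‖a ^ n‖ ^ (1 /
n)` from some index on. The constant absorbs the finitely many earlier powers. -/
theorem exists_pow_norm_le {R : Type*} [NormedRing R] [NormedAlgebra ℂ R] [CompleteSpace R]
    [Nontrivial R] (a : R) (ha : ∀ μ ∈ spectrum ℂ a, ‖μ‖ < 1) :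
    ∃ C ρ : ℝ, 0 < ρ ∧ ρ < 1 ∧ ∀ n : ℕ, ‖a ^ n‖ ≤ C * ρ ^ n := by
  have h1 : spectralRadius ℂ a < 1 := by
    have := spectrum.spectralRadius_lt_of_forall_lt a (r := 1) fun z hz => by
      exact_mod_cast ha z hz
    simpa using this
  obtain ⟨ρ, hρ1, hρ2⟩ := ENNReal.lt_iff_exists_nnreal_btwn.mp h1
  have hρ2' : ρ < 1 := by exact_mod_cast hρ2
  have hρ0 : 0 < ρ := by
    have : (0 : ℝ≥0∞) < ρ := lt_of_le_of_lt bot_le hρ1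
    exact_mod_cast this
  have h2 := (spectrum.pow_nnnorm_pow_one_div_tendsto_nhds_spectralRadius a).eventually_lt_const hρ1
  obtain ⟨n₀, hn₀⟩ := eventually_atTop.mp h2
  have h3 : ∀ n, n₀ + 1 ≤ n → ‖a ^ n‖ ≤ (ρ : ℝ) ^ n := by
    intro n hn
    have h4 := hn₀ n (by omega)
    have h5 : (‖a ^ n‖₊ : ℝ≥0∞) ≤ (ρ : ℝ≥0∞) ^ n := by
      have h6 := ENNReal.rpow_le_rpow h4.le (Nat.cast_nonneg n)
      rw [← ENNReal.rpow_mul, one_div, inv_mul_cancel₀ (by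
        have : (0 : ℝ) < n := by exact_mod_cast (by omega : 0 < n)
        exact this.ne'), ENNReal.rpow_one, ENNReal.rpow_natCast] at h6
      exact h6
    have h7 : ‖a ^ n‖₊ ≤ ρ ^ n := by exact_mod_cast h5
    exact_mod_cast h7
  have hρR : (0 : ℝ) < ρ := by exact_mod_cast hρ0
  refine ⟨1 + ∑ k ∈ Finset.range (n₀ + 1), ‖a ^ k‖ / (ρ : ℝ) ^ k, ρ, hρR, by exact_mod_cast hρ2',
    fun n => ?_⟩
  have hnn : ∀ k ∈ Finset.range (n₀ + 1), 0 ≤ ‖a ^ k‖ / (ρ : ℝ) ^ k := fun k _ => by positivity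
  by_cases hn : n₀ + 1 ≤ n
  · refine (h3 n hn).trans (le_mul_of_one_le_left (by positivity) ?_)
    linarith [Finset.sum_nonneg hnn]
  · have h4 := Finset.single_le_sum hnn (Finset.mem_range.mpr (not_le.mp hn))
    have h5 : ‖a ^ n‖ = ‖a ^ n‖ / (ρ : ℝ) ^ n * (ρ : ℝ) ^ n := by field_simp
    rw [h5]
    gcongr
    linarith

theorem IsExpansive.exists_entry_le (hA : IsExpansive A) :
    ∃ C ρ : ℝ, 0 < ρ ∧ ρ < 1 ∧ ∀ (n : ℕ) (i j : Fin d), |(((realMat A)⁻¹) ^ n) i j| ≤ C * ρ ^ n := by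
  rcases d with _ | d
  -- In dimension zero the matrix ring is trivial, so `exists_pow_norm_le` does not apply.
  · exact ⟨1, 1 / 2, by norm_num, by norm_num, fun n i => i.elim0⟩
  let _ := Matrix.linftyOpNormedRing (n := Fin (d + 1)) (α := ℂ)
  let _ := Matrix.linftyOpNormedAlgebra (n := Fin (d + 1)) (R := ℂ) (α := ℂ)
  have hcomplete : CompleteSpace (Matrix (Fin (d + 1)) (Fin (d + 1)) ℂ) :=
    FiniteDimensional.complete ℂ _
  set Z : Matrix (Fin (d + 1)) (Fin (d + 1)) ℂ := A.map (Int.cast : ℤ → ℂ) with hZ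
  have hZu : IsUnit Z := by
    rw [Matrix.isUnit_iff_isUnit_det, hZ]
    have : (A.map (Int.cast : ℤ → ℂ)).det = ((A.det : ℤ) : ℂ) := by rw [Int.cast_det]
    rw [this, isUnit_iff_ne_zero]
    exact_mod_cast hA.det_ne_zero
  obtain ⟨u, hu⟩ := hZu
  have hspec : ∀ μ ∈ spectrum ℂ (↑u⁻¹ : Matrix (Fin (d + 1)) (Fin (d + 1)) ℂ), ‖μ‖ < 1 := by
    intro μ hμ
    -- The spectrum of the inverse consists of the inverses of the eigenvalues, which expansiveness
    -- places inside the open unit disc.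
    rw [← spectrum.map_inv, Set.mem_inv, hu] at hμ
    have := hA _ hμ
    rw [norm_inv] at this
    by_contra hc
    exact absurd this (not_lt.mpr (inv_le_one_of_one_le₀ (not_lt.mp hc)))
  obtain ⟨C, ρ, h0, h1, h2⟩ := exists_pow_norm_le _ hspec
  refine ⟨C, ρ, h0, h1, fun n i j => ?_⟩
  have h3 : ((realMat A)⁻¹).map (algebraMap ℝ ℂ) = (↑u⁻¹ : Matrix _ _ ℂ) := by
    have h4 : Z = (realMat A).map (algebraMap ℝ ℂ) := by
      ext i j; simp [hZ, realMat]
    have h5 : (realMat A).map (algebraMap ℝ ℂ) * ((realMat A)⁻¹).map (algebraMap ℝ ℂ) = 1 := by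
      rw [← Matrix.map_mul, Matrix.mul_nonsing_inv _
        (isUnit_iff_ne_zero.mpr (realMat_det_ne_zero hA))]
      exact Matrix.map_one _ (map_zero _) (map_one _)
    rw [← h4, ← hu] at h5
    exact (Units.eq_inv_of_mul_eq_one_left h5)
  have h4 : (((((realMat A)⁻¹) ^ n) i j : ℝ) : ℂ)
      = ((↑u⁻¹ : Matrix (Fin (d + 1)) (Fin (d + 1)) ℂ) ^ n) i j := by
    rw [← h3, ← Matrix.map_pow]
    rfl
  have h5 : ‖((↑u⁻¹ : Matrix (Fin (d + 1)) (Fin (d + 1)) ℂ) ^ n) i j‖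
      ≤ ‖(↑u⁻¹ : Matrix (Fin (d + 1)) (Fin (d + 1)) ℂ) ^ n‖ := by
    rw [Matrix.linfty_opNorm_def]
    have h6 := Finset.le_sup (f := fun i => ∑ j,
      ‖((↑u⁻¹ : Matrix (Fin (d + 1)) (Fin (d + 1)) ℂ) ^ n) i j‖₊) (Finset.mem_univ i)
    have h7 := Finset.single_le_sum (f := fun j =>
      ‖((↑u⁻¹ : Matrix (Fin (d + 1)) (Fin (d + 1)) ℂ) ^ n) i j‖₊) (fun _ _ => zero_le)
      (Finset.mem_univ j)
    exact_mod_cast h7.trans h6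
  rw [← h4, Complex.norm_real, Real.norm_eq_abs] at h5
  exact h5.trans (h2 n)

theorem norm_toEuclideanLin_le {W : Matrix (Fin d) (Fin d) ℝ} {K : ℝ} (hW : ∀ i j, |W i j| ≤ K)
    (x : Rd d) : ‖Matrix.toEuclideanLin W x‖ ≤ d * (d * K) * ‖x‖ := by
  have h1 : ∀ y : Rd d, ‖y‖ ≤ ∑ i, |y i| := by
    intro y
    have : y = ∑ i, EuclideanSpace.single i (y i) := by
      ext j; simp [Pi.single_apply]
    conv_lhs => rw [this]
    refine (norm_sum_le _ _).trans ?_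
    simp
  have h2 : ∀ j, |x j| ≤ ‖x‖ := fun j => PiLp.norm_apply_le x j
  calc ‖Matrix.toEuclideanLin W x‖ ≤ ∑ i, |(Matrix.toEuclideanLin W x) i| := h1 _
    _ ≤ ∑ _i : Fin d, ∑ _j : Fin d, K * ‖x‖ := by
        refine Finset.sum_le_sum fun i _ => ?_
        change |∑ j, W i j * x j| ≤ _
        refine (Finset.abs_sum_le_sum_abs _ _).trans (Finset.sum_le_sum fun j _ => ?_)
        rw [abs_mul]
        exact mul_le_mul (hW i j) (h2 j) (abs_nonneg _) ((abs_nonneg _).trans (hW i j))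
    _ = _ := by simp; ring

theorem iterate_toEuclideanLin (W : Matrix (Fin d) (Fin d) ℝ) (n : ℕ) (x : Rd d) :
    (Matrix.toEuclideanLin W)^[n] x = Matrix.toEuclideanLin (W ^ n) x := by
  induction n generalizing x with
  | zero => simp
  | succ n ih =>
    rw [Function.iterate_succ_apply, ih, pow_succ]
    simp [Matrix.toLpLin_apply]

/-- Contraction estimates for the iterates of `B⁻¹` and of `A⁻¹`. -/
theorem IsExpansive.exists_iterate_le (hA : IsExpansive A) :
    ∃ C ρ : ℝ, 1 ≤ C ∧ 0 < ρ ∧ ρ < 1 ∧ ∀ (n : ℕ) (x : Rd d), ‖(invB A)^[n] x‖ ≤ C * ρ ^ n * ‖x‖ ∧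
      ‖(Matrix.toEuclideanLin (realMat A)⁻¹)^[n] x‖ ≤ C * ρ ^ n * ‖x‖ := by
  obtain ⟨C, ρ, h0, h1, h2⟩ := hA.exists_entry_le
  refine ⟨max 1 (d * (d * C)), ρ, le_max_left _ _, h0, h1, fun n x => ⟨?_, ?_⟩⟩
  · have h3 : (invB A)^[n] x = Matrix.toEuclideanLin ((((realMat A)⁻¹) ^ n)ᵀ) x := by
      have : invB A = Matrix.toEuclideanLin ((realMat A)ᵀ)⁻¹ := rfl
      rw [this, iterate_toEuclideanLin, Matrix.transpose_pow, Matrix.transpose_nonsing_inv]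
    rw [h3]
    refine (norm_toEuclideanLin_le (K := C * ρ ^ n) (fun i j => h2 n j i) x).trans ?_
    refine mul_le_mul_of_nonneg_right ?_ (norm_nonneg _)
    rw [← mul_assoc, ← mul_assoc, mul_assoc (d : ℝ)]
    exact mul_le_mul_of_nonneg_right (le_max_right _ _) (by positivity)
  · rw [iterate_toEuclideanLin]
    refine (norm_toEuclideanLin_le (K := C * ρ ^ n) (fun i j => h2 n i j) x).trans ?_
    refine mul_le_mul_of_nonneg_right ?_ (norm_nonneg _)
    rw [← mul_assoc, ← mul_assoc, mul_assoc (d : ℝ)]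
    exact mul_le_mul_of_nonneg_right (le_max_right _ _) (by positivity)

/-! ### Infinite products in a normed ring -/

/-- The factors approach an idempotent `e` instead of `1`, so `P n * e` is shown to be Cauchy:
consecutive terms differ by `P n * (T (n + 1) - e) * e`, as `e * e = e`. The norms of `P n` are
bounded by an exponential, and `P (n + 1) - P n * e` tends to `0`. The estimate for `Q - e` later
gives continuity of the product at the origin. -/
theorem exists_tendsto_of_geometric {R : Type*} [NormedRing R] [CompleteSpace R] {e : R}
    (he : e * e = e) (hn : ‖e‖ ≤ 1) (h1 : ‖(1 : R)‖ ≤ 1) {T P : ℕ → R} (hP0 : P 0 = 1)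
    (hP : ∀ n, P (n + 1) = P n * T (n + 1)) {a ρ : ℝ} (ha : 0 ≤ a) (hρ0 : 0 ≤ ρ) (hρ1 : ρ < 1)
    (hT : ∀ n, ‖T (n + 1) - e‖ ≤ a * ρ ^ n) :
    ∃ Q, Tendsto P atTop (𝓝 Q) ∧ ‖Q - e‖ ≤ Real.exp (a / (1 - ρ)) * a / (1 - ρ) := by
  have hsum : ∀ n, ∑ k ∈ Finset.range n, a * ρ ^ k ≤ a / (1 - ρ) := by
    intro n
    have hs := (summable_geometric_of_lt_one hρ0 hρ1).mul_left a
    have := hs.sum_le_tsum (Finset.range n) fun k _ => by positivity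
    rwa [tsum_mul_left, tsum_geometric_of_lt_one hρ0 hρ1, ← div_eq_mul_inv] at this
  have hbound : ∀ n, ‖P n‖ ≤ Real.exp (∑ k ∈ Finset.range n, a * ρ ^ k) := by
    intro n
    induction n with
    | zero => simpa [hP0] using h1
    | succ n ih =>
      rw [hP, Finset.sum_range_succ, Real.exp_add]
      refine (norm_mul_le _ _).trans (mul_le_mul ih ?_ (norm_nonneg _) (Real.exp_pos _).le)
      calc ‖T (n + 1)‖ = ‖e + (T (n + 1) - e)‖ := by rw [add_sub_cancel]
        _ ≤ 1 + a * ρ ^ n := (norm_add_le _ _).trans (add_le_add hn (hT n))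
        _ ≤ _ := by rw [add_comm]; exact Real.add_one_le_exp _
  set M := Real.exp (a / (1 - ρ)) with hM
  have hM0 : 0 < M := Real.exp_pos _
  have hbound' : ∀ n, ‖P n‖ ≤ M := fun n => (hbound n).trans (Real.exp_le_exp.mpr (hsum n))
  have hdiff : ∀ n, ‖P (n + 1) - P n * e‖ ≤ M * a * ρ ^ n := by
    intro n
    rw [hP, ← mul_sub, mul_assoc]
    exact (norm_mul_le _ _).trans (mul_le_mul (hbound' n) (hT n) (norm_nonneg _) hM0.le)
  have hdist : ∀ n, dist (P n * e) (P (n + 1) * e) ≤ M * a * ρ ^ n := by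
    intro n
    rw [dist_comm, dist_eq_norm]
    have h3 : P (n + 1) * e - P n * e = (P (n + 1) - P n * e) * e := by
      rw [sub_mul, mul_assoc, he]
    rw [h3]
    calc _ ≤ ‖P (n + 1) - P n * e‖ * ‖e‖ := norm_mul_le _ _
      _ ≤ ‖P (n + 1) - P n * e‖ * 1 := by gcongr
      _ ≤ _ := by rw [mul_one]; exact hdiff n
  obtain ⟨Q, hQ⟩ := cauchySeq_tendsto_of_complete (cauchySeq_of_le_geometric ρ _ hρ1 hdist)
  refine ⟨Q, ?_, ?_⟩
  · rw [← tendsto_add_atTop_iff_nat 1]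
    have h4 : Tendsto (fun n => P (n + 1) - P n * e) atTop (𝓝 0) := by
      refine squeeze_zero_norm hdiff ?_
      simpa using (tendsto_pow_atTop_nhds_zero_of_lt_one hρ0 hρ1).const_mul (M * a)
    simpa using hQ.add h4
  · have h5 := dist_le_of_le_geometric_of_tendsto₀ ρ _ hρ1 hdist hQ
    rwa [hP0, one_mul, dist_comm, dist_eq_norm] at h5

/-! ### The infinite product of the low-pass filter -/

section Product

variable {c : ℕ} {h : Fin c → Fin c → Torus d → ℂ}

/-- The normalized filter matrix `N^{-1/2} H`. -/
def lowMatrix (A : Matrix (Fin d) (Fin d) ℤ) (h : Fin c → Fin c → Torus d → ℂ) (ω : Torus d) :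
    Matrix (Fin c) (Fin c) ℂ :=
  Matrix.of fun i j => ((√(detN A) : ℝ) : ℂ)⁻¹ * h i j ω

theorem partialProd_zero (x : Rd d) : partialProd A h 0 x = 1 := rfl

theorem partialProd_succ (n : ℕ) (x : Rd d) : partialProd A h (n + 1) x =
    partialProd A h n x * lowMatrix A h (toTorus ((invB A)^[n + 1] x)) := rfl

theorem partialProd_add (k n : ℕ) (x : Rd d) : partialProd A h (k + n) x =
    partialProd A h k x * partialProd A h n ((invB A)^[k] x) := by
  induction n with
  | zero => rw [add_zero, partialProd_zero, mul_one]
  | succ n ih =>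
    rw [← add_assoc, partialProd_succ, ih, partialProd_succ, mul_assoc,
      ← Function.iterate_add_apply, show n + 1 + k = k + n + 1 by omega]

theorem norm_toTorus_le (x : Rd d) : ‖toTorus x‖ ≤ ‖x‖ := by
  refine (pi_norm_le_iff_of_nonneg (norm_nonneg _)).mpr fun i => ?_
  exact (QuotientAddGroup.norm_mk_le_norm).trans (PiLp.norm_apply_le x i)

variable [NeZero c] {m : Torus d → ℕ}

theorem exists_lowMatrix_lipschitz (hA : IsExpansive A) (hlow : IsLowPass A m h)
    (hlip : IsLipschitzNearZero h) : ∃ r > 0, ∃ L ≥ (0 : ℝ), ∀ y : Rd d, ‖y‖ ≤ r → ∀ i j,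
      ‖lowMatrix A h (toTorus y) i j - Matrix.single (0 : Fin c) (0 : Fin c) (1 : ℂ) i j‖
        ≤ L * ‖y‖ := by
  choose K V hV hK using hlip
  have h1 : ⋂ i, ⋂ j, V i j ∈ 𝓝 (0 : Torus d) :=
    (Filter.iInter_mem.mpr fun i => Filter.iInter_mem.mpr fun j => hV i j)
  have h2 : toTorus ⁻¹' (⋂ i, ⋂ j, V i j) ∈ 𝓝 (0 : Rd d) :=
    continuous_toTorus.continuousAt.preimage_mem_nhds (by rwa [toTorus_zero])
  obtain ⟨r, hr, hball⟩ := Metric.nhds_basis_closedBall.mem_iff.mp h2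
  have hN : 0 < √(detN A) := Real.sqrt_pos.mpr (detN_pos hA)
  refine ⟨r, hr, (√(detN A))⁻¹ * ∑ i, ∑ j, (K i j : ℝ), by positivity, fun y hy i j => ?_⟩
  have hy' : ∀ i j, toTorus y ∈ V i j := by
    have := hball (mem_closedBall_zero_iff.mpr hy)
    simpa using this
  have h3 : Matrix.single (0 : Fin c) (0 : Fin c) (1 : ℂ) i j
      = ((√(detN A) : ℝ) : ℂ)⁻¹ * h i j 0 := by
    rw [hlow.low_pass, Matrix.single_apply]
    have hN' : ((√(detN A) : ℝ) : ℂ) ≠ 0 := by exact_mod_cast hN.ne'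
    by_cases hij : i = 0 ∧ j = 0
    · rw [if_pos ⟨hij.1.symm, hij.2.symm⟩, if_pos hij, inv_mul_cancel₀ hN']
    · rw [if_neg fun h => hij ⟨h.1.symm, h.2.symm⟩, if_neg hij, mul_zero]
  rw [h3, lowMatrix, Matrix.of_apply, ← mul_sub, norm_mul, norm_inv, Complex.norm_real,
    Real.norm_of_nonneg hN.le, mul_assoc]
  refine mul_le_mul_of_nonneg_left ?_ (by positivity)
  have h4 := (hK i j).dist_le_mul _ (hy' i j) 0 (mem_of_mem_nhds (hV i j))
  rw [dist_eq_norm, dist_zero_right] at h4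
  have h5 : (K i j : ℝ) ≤ ∑ i, ∑ j, (K i j : ℝ) :=
    (Finset.single_le_sum (f := fun j => (K i j : ℝ)) (fun _ _ => by positivity)
      (Finset.mem_univ j)).trans
    (Finset.single_le_sum (f := fun i => ∑ j, (K i j : ℝ)) (fun _ _ => by positivity)
      (Finset.mem_univ i))
  exact h4.trans (mul_le_mul h5 (norm_toTorus_le y) (norm_nonneg _) (by positivity))

theorem exists_tendsto_near_zero (hA : IsExpansive A) (hlow : IsLowPass A m h)
    (hlip : IsLipschitzNearZero h) : ∃ r > 0, ∃ L ≥ (0 : ℝ), ∀ y : Rd d, ‖y‖ ≤ r →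
      ∃ Q : Matrix (Fin c) (Fin c) ℂ, Tendsto (fun n => partialProd A h n y) atTop (𝓝 Q) ∧
        ∀ i j, ‖Q i j - Matrix.single (0 : Fin c) (0 : Fin c) (1 : ℂ) i j‖ ≤ L * ‖y‖ := by
  obtain ⟨r, hr, L, hL, hlow'⟩ := exists_lowMatrix_lipschitz hA hlow hlip
  obtain ⟨C, ρ, hC, hρ0, hρ1, hit⟩ := hA.exists_iterate_le
  -- The maximal row sum is a submultiplicative norm for which the identity and the coordinate
  -- idempotent both have norm at most one.
  let _ := Matrix.linftyOpNormedRing (n := Fin c) (α := ℂ)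
  let _ := Matrix.linftyOpNormedAlgebra (n := Fin c) (R := ℂ) (α := ℂ)
  have hcomplete : CompleteSpace (Matrix (Fin c) (Fin c) ℂ) := FiniteDimensional.complete ℂ _
  have hnorm : ∀ (W : Matrix (Fin c) (Fin c) ℂ) (K : ℝ), 0 ≤ K → (∀ i j, ‖W i j‖ ≤ K) →
      ‖W‖ ≤ c * K := by
    intro W K hK hW
    lift K to ℝ≥0 using hK
    have h6 : ‖W‖₊ ≤ c * K := by
      rw [Matrix.linfty_opNNNorm_def]
      refine Finset.sup_le fun i _ => ?_
      refine (Finset.sum_le_sum (g := fun _ => K) fun j _ => ?_).trans ?_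
      · exact_mod_cast hW i j
      · simp
    exact_mod_cast h6
  have hentry : ∀ (W : Matrix (Fin c) (Fin c) ℂ) (i j : Fin c), ‖W i j‖ ≤ ‖W‖ := by
    intro W i j
    rw [Matrix.linfty_opNorm_def]
    have h6 := Finset.le_sup (f := fun i => ∑ j, ‖W i j‖₊) (Finset.mem_univ i)
    have h7 := Finset.single_le_sum (f := fun j => ‖W i j‖₊) (fun _ _ => zero_le)
      (Finset.mem_univ j)
    exact_mod_cast h7.trans h6
  set e : Matrix (Fin c) (Fin c) ℂ := Matrix.single 0 0 1 with he
  have hee : e * e = e := by rw [he, Matrix.single_mul_single_same, one_mul]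
  have h1 : ‖(1 : Matrix (Fin c) (Fin c) ℂ)‖ ≤ 1 := by
    rw [← Matrix.diagonal_one, Matrix.linfty_opNorm_diagonal]
    exact (pi_norm_le_iff_of_nonneg zero_le_one).mpr fun i => by simp
  have he1 : ‖e‖ ≤ 1 := by
    have : e = Matrix.diagonal (Pi.single 0 1) := by rw [he, Matrix.diagonal_single]
    rw [this, Matrix.linfty_opNorm_diagonal]
    refine (pi_norm_le_iff_of_nonneg zero_le_one).mpr fun i => ?_
    by_cases hi : i = 0
    · subst hi; simp
    · simp [Pi.single_eq_of_ne hi]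
  set a₀ := c * (L * C) with ha₀
  have ha₀0 : 0 ≤ a₀ := by positivity
  -- Dividing by `C` keeps every iterate of `B⁻¹` within radius `r`, since `‖(invB A)^[n] y‖ ≤ C * ρ
  -- ^ n * ‖y‖`. Using `r` in the exponential makes the constant independent of `y`.
  refine ⟨r / C, by positivity, Real.exp (a₀ * r / (1 - ρ)) * a₀ / (1 - ρ),
    div_nonneg (by positivity) (by linarith), fun y hy => ?_⟩
  have hyr : ‖y‖ ≤ r := hy.trans (div_le_self hr.le hC)
  have hiter : ∀ n, ‖(invB A)^[n + 1] y‖ ≤ C * ρ ^ n * ‖y‖ := by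
    intro n
    refine (hit (n + 1) y).1.trans ?_
    gcongr ?_ * ?_ * ‖y‖
    exact pow_le_pow_of_le_one hρ0.le hρ1.le (Nat.le_succ n)
  have hsmall : ∀ n, ‖(invB A)^[n + 1] y‖ ≤ r := by
    intro n
    refine (hiter n).trans ?_
    calc C * ρ ^ n * ‖y‖ ≤ C * 1 * (r / C) := by
          gcongr
          exact pow_le_one₀ hρ0.le hρ1.le
      _ = r := by field_simp
  obtain ⟨Q, hQ, hQe⟩ := exists_tendsto_of_geometric hee he1 h1 (P := fun n => partialProd A h n y)
    (T := fun n => lowMatrix A h (toTorus ((invB A)^[n] y))) rfl (fun n => rfl)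
    (a := a₀ * ‖y‖) (ρ := ρ) (by positivity) hρ0.le hρ1 (fun n => by
      refine (hnorm _ (L * (C * ρ ^ n * ‖y‖)) (by positivity) fun i j => ?_).trans_eq ?_
      · exact (hlow' _ (hsmall n) i j).trans (mul_le_mul_of_nonneg_left (hiter n) hL)
      · rw [ha₀]; ring)
  refine ⟨Q, hQ, fun i j => ?_⟩
  have h2 := (hentry (Q - e) i j).trans hQe
  refine h2.trans ?_
  have h3 : 0 < 1 - ρ := by linarith
  rw [div_mul_eq_mul_div, mul_assoc _ a₀]
  exact div_le_div_of_nonneg_right (mul_le_mul_of_nonneg_right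
    (Real.exp_le_exp.mpr (by gcongr)) (by positivity)) h3.le

/-- Some iterate `B⁻ᵏ x` lies in the neighbourhood where convergence is known; the first `k` factors
are a fixed matrix on the left. -/
theorem exists_tendsto_partialProd (hA : IsExpansive A) (hlow : IsLowPass A m h)
    (hlip : IsLipschitzNearZero h) (x : Rd d) :
    ∃ Q : Matrix (Fin c) (Fin c) ℂ, Tendsto (fun n => partialProd A h n x) atTop (𝓝 Q) := by
  obtain ⟨r, hr, L, hL, hnear⟩ := exists_tendsto_near_zero hA hlow hlip
  obtain ⟨C, ρ, hC, hρ0, hρ1, hit⟩ := hA.exists_iterate_le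
  have h1 : Tendsto (fun n : ℕ => C * ρ ^ n * ‖x‖) atTop (𝓝 0) := by
    simpa using ((tendsto_pow_atTop_nhds_zero_of_lt_one hρ0.le hρ1).const_mul C).mul_const ‖x‖
  obtain ⟨k, hk⟩ := (h1.eventually_lt_const hr).exists
  obtain ⟨Q, hQ, -⟩ := hnear ((invB A)^[k] x) ((hit k x).1.trans hk.le)
  refine ⟨partialProd A h k x * Q, ?_⟩
  rw [← tendsto_add_atTop_iff_nat k]
  have h2 := (hQ.const_mul (partialProd A h k x))
  refine h2.congr fun n => ?_
  rw [add_comm n k, partialProd_add]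

/-- The infinite product `∏_{q ≥ 1} N^{-1/2} H(B^{-q} x)`. -/
def infProd (A : Matrix (Fin d) (Fin d) ℤ) (h : Fin c → Fin c → Torus d → ℂ) (x : Rd d) :
    Matrix (Fin c) (Fin c) ℂ := limUnder atTop fun n => partialProd A h n x

theorem tendsto_infProd (hA : IsExpansive A) (hlow : IsLowPass A m h)
    (hlip : IsLipschitzNearZero h) (x : Rd d) :
    Tendsto (fun n => partialProd A h n x) atTop (𝓝 (infProd A h x)) :=
  tendsto_nhds_limUnder (exists_tendsto_partialProd hA hlow hlip x)

theorem infProd_eq (hA : IsExpansive A) (hlow : IsLowPass A m h)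
    (hlip : IsLipschitzNearZero h) (x : Rd d) :
    infProd A h x = lowMatrix A h (toTorus (invB A x)) * infProd A h (invB A x) := by
  have h1 := (tendsto_add_atTop_iff_nat 1).mpr (tendsto_infProd hA hlow hlip x)
  have h2 := (tendsto_infProd hA hlow hlip (invB A x)).const_mul
    (lowMatrix A h (toTorus (invB A x)))
  refine tendsto_nhds_unique h1 (h2.congr fun n => ?_)
  rw [add_comm n 1, partialProd_add, partialProd_succ, partialProd_zero, one_mul]
  rfl

theorem infProd_near_zero (hA : IsExpansive A) (hlow : IsLowPass A m h)
    (hlip : IsLipschitzNearZero h) : ∃ r > 0, ∃ L ≥ (0 : ℝ), ∀ y : Rd d, ‖y‖ ≤ r → ∀ i j,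
      ‖infProd A h y i j - Matrix.single (0 : Fin c) (0 : Fin c) (1 : ℂ) i j‖ ≤ L * ‖y‖ := by
  obtain ⟨r, hr, L, hL, hnear⟩ := exists_tendsto_near_zero hA hlow hlip
  refine ⟨r, hr, L, hL, fun y hy i j => ?_⟩
  obtain ⟨Q, hQ, hQ'⟩ := hnear y hy
  rw [tendsto_nhds_unique (tendsto_infProd hA hlow hlip y) hQ]
  exact hQ' i j

theorem tendsto_sum_infProd (hA : IsExpansive A) (hlow : IsLowPass A m h)
    (hlip : IsLipschitzNearZero h) {ε : ℝ} (hε : 0 < ε) : ∃ r > 0, ∀ y : Rd d, ‖y‖ ≤ r →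
      |∑ i, ‖infProd A h y i 0‖ ^ 2 - 1| ≤ ε := by
  obtain ⟨r, hr, L, hL, hnear⟩ := infProd_near_zero hA hlow hlip
  have h1 : Tendsto (fun y : Rd d => ∑ i, ‖infProd A h y i 0‖ ^ 2) (𝓝 0)
      (𝓝 (∑ i, ‖Matrix.single (0 : Fin c) (0 : Fin c) (1 : ℂ) i 0‖ ^ 2)) := by
    refine tendsto_finsetSum _ fun i _ => (Tendsto.norm ?_).pow 2
    rw [tendsto_iff_norm_sub_tendsto_zero]
    refine squeeze_zero' (Eventually.of_forall fun _ => norm_nonneg _) (g := fun y => L * ‖y‖) ?_ ?_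
    · filter_upwards [Metric.closedBall_mem_nhds (0 : Rd d) hr] with y hy
      exact hnear y (mem_closedBall_zero_iff.mp hy) i 0
    · have : Tendsto (fun y : Rd d => L * ‖y‖) (𝓝 0) (𝓝 (L * ‖(0 : Rd d)‖)) :=
        (continuous_const.mul continuous_norm).tendsto 0
      simpa using this
  have h2 : ∑ i, ‖Matrix.single (0 : Fin c) (0 : Fin c) (1 : ℂ) i 0‖ ^ 2 = 1 := by
    rw [Finset.sum_eq_single 0]
    · simp
    · intro i _ hi
      simp [hi.symm]
    · simp
  rw [h2] at h1
  have h3 := h1.eventually (Metric.closedBall_mem_nhds 1 hε)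
  obtain ⟨r', hr', hball⟩ := Metric.nhds_basis_closedBall.mem_iff.mp h3
  refine ⟨r', hr', fun y hy => ?_⟩
  have := hball (mem_closedBall_zero_iff.mpr hy)
  simpa [Real.dist_eq] using this

end Product

end GenFilter

end

noncomputable section

namespace GenFilter

variable {d : ℕ} {A : Matrix (Fin d) (Fin d) ℤ}

/-! ### Square integrability of the infinite product -/

theorem sum_norm_sq_row_eq {ι κ : Type*} [Fintype ι] [Fintype κ] [DecidableEq ι]
    {K : Matrix ι κ ℂ} {q : ι → ℝ} (hK : K * Kᴴ = Matrix.diagonal fun a => (q a : ℂ))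
    (v : ι → ℂ) : ∑ b, ‖∑ a, v a * K a b‖ ^ 2 = ∑ a, q a * ‖v a‖ ^ 2 := by
  have h1 : (v ᵥ* K) ⬝ᵥ star (v ᵥ* K) = ∑ a, ((q a * ‖v a‖ ^ 2 : ℝ) : ℂ) := by
    rw [Matrix.star_vecMul, ← Matrix.dotProduct_mulVec, Matrix.mulVec_mulVec, hK]
    simp only [dotProduct, Matrix.mulVec_diagonal, Pi.star_apply]
    refine Finset.sum_congr rfl fun a _ => ?_
    rw [mul_left_comm, ← starRingEnd_apply, Complex.mul_conj']
    push_cast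
    rfl
  have h2 : (v ᵥ* K) ⬝ᵥ star (v ᵥ* K) = ∑ b, ((‖∑ a, v a * K a b‖ ^ 2 : ℝ) : ℂ) := by
    simp only [dotProduct, Pi.star_apply, Matrix.vecMul]
    refine Finset.sum_congr rfl fun b _ => ?_
    rw [← starRingEnd_apply, Complex.mul_conj']
    push_cast
    rfl
  rw [h2] at h1
  exact_mod_cast h1

section Square

variable {c c' : ℕ} {m m' : Torus d → ℕ} {h : Fin c → Fin c → Torus d → ℂ}
  {g : Fin c' → Fin c → Torus d → ℂ}

/-- The product `N^{-n/2} H(α^{n-1} ω) ⋯ H(ω)`. -/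
def torusProd (A : Matrix (Fin d) (Fin d) ℤ) (h : Fin c → Fin c → Torus d → ℂ) :
    ℕ → Torus d → Matrix (Fin c) (Fin c) ℂ
  | 0, _ => 1
  | n + 1, ω => torusProd A h n (torusEndo A ω) * lowMatrix A h ω

theorem torusProd_succ (n : ℕ) (ω : Torus d) : torusProd A h (n + 1) ω =
    torusProd A h n (torusEndo A ω) * lowMatrix A h ω := rfl

/-- The high-pass filters are essentially bounded. -/
theorem ae_norm_highPass_le (hA : IsExpansive A) (hhigh : IsHighPass A m m' h g) :
    ∀ᵐ ζ ∂torusHaar d, ∀ k j, ‖g k j ζ‖ ≤ √(detN A) := by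
  have := finite_ker hA
  have := Fintype.ofFinite (endoHom A).ker
  filter_upwards [ae_torusEndo hA (ae_all_iff.mpr fun k => hhigh.filter_eq k k)] with ζ hζ k j
  have h2 := hζ k
  have hN := detN_pos hA
  rw [if_pos rfl] at h2
  simp_rw [fiberSum_eq, Complex.mul_conj'] at h2
  have hind : (levelSet m' k).indicator (fun _ => (detN A : ℂ)) (torusEndo A ζ)
      = (((levelSet m' k).indicator (fun _ => detN A) (torusEndo A ζ) : ℝ) : ℂ) := by
    by_cases hs : torusEndo A ζ ∈ levelSet m' k <;> simp [hs]
  rw [hind] at h2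
  have h3 : ∑ j, ∑ κ : (endoHom A).ker, ‖g k j (ζ + κ)‖ ^ 2
      = (levelSet m' k).indicator (fun _ => detN A) (torusEndo A ζ) := by exact_mod_cast h2
  have h4 := Finset.single_le_sum (f := fun j => ∑ κ : (endoHom A).ker, ‖g k j (ζ + κ)‖ ^ 2)
    (fun _ _ => by positivity) (Finset.mem_univ j)
  have h5 := Finset.single_le_sum (f := fun κ : (endoHom A).ker => ‖g k j (ζ + κ)‖ ^ 2)
    (fun _ _ => by positivity) (Finset.mem_univ 0)
  refine Real.le_sqrt_of_sq_le ?_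
  simp only [ZeroMemClass.coe_zero, add_zero] at h5
  refine h5.trans (h4.trans (h3.trans_le ?_))
  exact Set.indicator_le_self' (fun _ _ => hN.le) _

theorem iterate_invB_mulB (hA : IsExpansive A) (n : ℕ) (x : Rd d) :
    (invB A)^[n] ((mulB A)^[n] x) = x :=
  Function.LeftInverse.iterate (invB_mulB hA) n x

theorem partialProd_iterate (hA : IsExpansive A) (n : ℕ) (y : Rd d) :
    partialProd A h n ((mulB A)^[n] y) = torusProd A h n (toTorus y) := by
  induction n generalizing y with
  | zero => rfl
  | succ n ih =>
    rw [partialProd_succ, iterate_invB_mulB hA, Function.iterate_succ_apply, ih, torusProd_succ,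
      torusEndo_toTorus]

variable [NeZero c]

/-- The rows of the filter matrix are orthogonal with squared norms `0` or `N`. Hence multiplying a
row vector by the low-pass block, scaled by `N^{-1/2}`, does not increase its norm over a full
fibre. -/
theorem sum_row_lowMatrix_le (hA : IsExpansive A) [Fintype (endoHom A).ker]
    (hlow : IsLowPass A m h) (hhigh : IsHighPass A m m' h g) :
    ∀ᵐ ζ ∂torusHaar d, ∀ v : Fin c → ℂ,
      ∑ κ : (endoHom A).ker, ∑ j, ‖∑ k, v k * lowMatrix A h (ζ + κ) k j‖ ^ 2
        ≤ ∑ k, ‖v k‖ ^ 2 := by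
  have hN := detN_pos hA
  filter_upwards [filterMatrix_mul_conjTranspose hA hlow hhigh] with ζ h1 v
  have h2 := sum_norm_sq_row_eq (K := filterMatrix A h g ζ) (q := fun a => detN A * (Sum.elim
        (fun i : Fin c => (levelSet m i).indicator (fun _ => (1 : ℝ)) (torusEndo A ζ))
        (fun k : Fin c' => (levelSet m' k).indicator (fun _ => (1 : ℝ)) (torusEndo A ζ)) a : ℝ))
    -- Zero coefficients on the high-pass rows leave only the low-pass block.
    (by rw [h1]; push_cast; rfl) (Sum.elim v 0)
  simp only [Fintype.sum_sum_type, Sum.elim_inl, Sum.elim_inr, Pi.zero_apply, zero_mul,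
    norm_zero, Finset.sum_const_zero, add_zero, ne_eq, OfNat.ofNat_ne_zero, not_false_eq_true,
    zero_pow, mul_zero, Fintype.sum_prod_type] at h2
  have h3 : ∀ (κ : (endoHom A).ker) j, ‖∑ k, v k * lowMatrix A h (ζ + κ) k j‖ ^ 2
      = (detN A)⁻¹ * ‖∑ k, v k * filterMatrix A h g ζ (Sum.inl k) (κ, j)‖ ^ 2 := by
    intro κ j
    have : ∑ k, v k * lowMatrix A h (ζ + κ) k j = ((√(detN A) : ℝ) : ℂ)⁻¹ *
        ∑ k, v k * filterMatrix A h g ζ (Sum.inl k) (κ, j) := by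
      rw [Finset.mul_sum]
      refine Finset.sum_congr rfl fun k _ => ?_
      rw [mul_left_comm]
      rfl
    rw [this, norm_mul, mul_pow, norm_inv, Complex.norm_real,
      Real.norm_of_nonneg (Real.sqrt_nonneg _), inv_pow, Real.sq_sqrt hN.le]
  simp_rw [h3, ← Finset.mul_sum]
  rw [h2, Finset.mul_sum]
  refine Finset.sum_le_sum fun k _ => ?_
  rw [← mul_assoc, ← mul_assoc, inv_mul_cancel₀ hN.ne', one_mul]
  refine mul_le_of_le_one_left (by positivity) ?_
  exact Set.indicator_le_self' (fun _ _ => zero_le_one) _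

theorem aestronglyMeasurable_lowMatrix (hlow : IsLowPass A m h) (i j : Fin c) :
    AEStronglyMeasurable (fun ω => lowMatrix A h ω i j) (torusHaar d) :=
  (hlow.measurable i j).const_mul _

theorem aestronglyMeasurable_torusProd (hA : IsExpansive A) (hlow : IsLowPass A m h) (n : ℕ)
    (i j : Fin c) : AEStronglyMeasurable (fun ω => torusProd A h n ω i j) (torusHaar d) := by
  induction n generalizing i j with
  | zero => exact aestronglyMeasurable_const
  | succ n ih =>
    simp only [torusProd_succ, Matrix.mul_apply]
    refine Finset.aestronglyMeasurable_fun_sum _ fun k _ => ?_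
    exact ((ih i k).comp_measurePreserving (measurePreserving_torusEndo hA)).mul
      (aestronglyMeasurable_lowMatrix hlow k j)

/-- Each step spends one factor `N` to replace an integral by an integral of fibre sums. On a fibre
the earlier factors depend only on `α ζ`, so the row contraction removes the last factor. -/
theorem lintegral_torusProd_le (hA : IsExpansive A) (hlow : IsLowPass A m h)
    (hhigh : IsHighPass A m m' h g) (n : ℕ) (i : Fin c) :
    ENNReal.ofReal (detN A) ^ n * ∫⁻ ω, ∑ j, ‖torusProd A h n ω i j‖ₑ ^ 2 ∂torusHaar d ≤ 1 := by
  have := finite_ker hA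
  have := Fintype.ofFinite (endoHom A).ker
  have hmeas : ∀ n, AEMeasurable (fun ω => ∑ j, ‖torusProd A h n ω i j‖ₑ ^ 2) (torusHaar d) :=
    fun n => Finset.aemeasurable_fun_sum _ fun j _ =>
      (aestronglyMeasurable_torusProd hA hlow n i j).enorm.pow_const 2
  induction n with
  | zero =>
    have : ∀ ω : Torus d, ∑ j, ‖torusProd A h 0 ω i j‖ₑ ^ 2 = 1 := by
      intro ω
      rw [Finset.sum_eq_single i]
      · simp [torusProd]
      · intro j _ hj
        simp [torusProd, Matrix.one_apply_ne hj.symm]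
      · simp
    simp [this]
  | succ n ih =>
    refine le_trans ?_ ih
    rw [pow_succ, mul_assoc]
    refine mul_le_mul_right ?_ _
    rw [← lintegral_sum_ker hA (hmeas (n + 1)), ← lintegral_torusEndo hA (hmeas n)]
    refine lintegral_mono_ae ?_
    filter_upwards [sum_row_lowMatrix_le hA hlow hhigh] with ζ hζ
    have h1 := ENNReal.ofReal_le_ofReal (hζ fun k => torusProd A h n (torusEndo A ζ) i k)
    rw [ENNReal.ofReal_sum_of_nonneg (fun _ _ => by positivity),
      ENNReal.ofReal_sum_of_nonneg (fun _ _ => by positivity)] at h1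
    simp_rw [ENNReal.ofReal_sum_of_nonneg (fun (j : Fin c) (_ : j ∈ Finset.univ) =>
      sq_nonneg ‖_‖), ENNReal.ofReal_pow (norm_nonneg _), ofReal_norm] at h1
    refine le_trans (le_of_eq ?_) h1
    refine Finset.sum_congr rfl fun κ _ => Finset.sum_congr rfl fun j _ => ?_
    have h2 : torusEndo A κ = 0 := κ.2
    rw [torusProd_succ, torusEndo_add, h2, add_zero, Matrix.mul_apply]

theorem lintegral_mulB (hA : IsExpansive A) {F : Rd d → ℝ≥0∞} (hF : AEMeasurable F) :
    ∫⁻ x, F x = ENNReal.ofReal (detN A) * ∫⁻ x, F (mulB A x) := by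
  have h1 := map_matrix_volume _ hA.transpose_det_ne_zero
  have hN := detN_pos hA
  have h2 : AEMeasurable F (Measure.map (mulB A) volume) := by
    have : Measure.map (mulB A) volume = _ := h1
    rw [this]
    exact hF.smul_measure _
  rw [← lintegral_map' h2 continuous_mulB.aemeasurable]
  have : Measure.map (mulB A) volume = _ := h1
  rw [this, lintegral_smul_measure, Matrix.det_transpose, abs_inv, ← detN_eq_abs, smul_eq_mul,
    ← mul_assoc, ← ENNReal.ofReal_mul hN.le, mul_inv_cancel₀ hN.ne', ENNReal.ofReal_one, one_mul]

theorem quasiMeasurePreserving_mulB (hA : IsExpansive A) :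
    Measure.QuasiMeasurePreserving (mulB A) volume volume :=
  MeasureTheory.Measure.LinearMap.quasiMeasurePreserving volume _
    (by rw [det_toEuclideanLin]; exact hA.transpose_det_ne_zero)

theorem quasiMeasurePreserving_invB (hA : IsExpansive A) :
    Measure.QuasiMeasurePreserving (invB A) volume volume :=
  MeasureTheory.Measure.LinearMap.quasiMeasurePreserving volume _ (by
    rw [det_toEuclideanLin, Matrix.det_nonsing_inv, Ring.inverse_eq_inv']
    exact inv_ne_zero hA.transpose_det_ne_zero)

theorem lintegral_iterate_mulB (hA : IsExpansive A) (n : ℕ) {F : Rd d → ℝ≥0∞}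
    (hF : AEMeasurable F) :
    ∫⁻ x, F x = ENNReal.ofReal (detN A) ^ n * ∫⁻ x, F ((mulB A)^[n] x) := by
  induction n generalizing F with
  | zero => simp
  | succ n ih =>
    rw [lintegral_mulB hA hF, ih (F := fun x => F (mulB A x))
        (hF.comp_quasiMeasurePreserving (quasiMeasurePreserving_mulB hA)),
      pow_succ', mul_assoc]
    simp_rw [← Function.iterate_succ_apply' (mulB A)]

theorem aestronglyMeasurable_comp_toTorus {F : Torus d → ℂ}
    (hF : AEStronglyMeasurable F (torusHaar d)) :
    AEStronglyMeasurable (fun x : Rd d => F (toTorus x)) :=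
  hF.comp_quasiMeasurePreserving quasiMeasurePreserving_toTorus

theorem aestronglyMeasurable_partialProd (hA : IsExpansive A) (hlow : IsLowPass A m h) (n : ℕ)
    (i j : Fin c) : AEStronglyMeasurable (fun x => partialProd A h n x i j) := by
  induction n generalizing i j with
  | zero => exact aestronglyMeasurable_const
  | succ n ih =>
    simp only [partialProd_succ, Matrix.mul_apply]
    refine Finset.aestronglyMeasurable_fun_sum _ fun k _ => (ih i k).mul ?_
    exact (aestronglyMeasurable_comp_toTorus
      (aestronglyMeasurable_lowMatrix hlow k j)).comp_quasiMeasurePreserving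
      ((quasiMeasurePreserving_invB hA).iterate (n + 1))

theorem tendsto_infProd_apply (hA : IsExpansive A) (hlow : IsLowPass A m h)
    (hlip : IsLipschitzNearZero h) (x : Rd d) (i j : Fin c) :
    Tendsto (fun n => partialProd A h n x i j) atTop (𝓝 (infProd A h x i j)) :=
  tendsto_pi_nhds.mp (tendsto_pi_nhds.mp (tendsto_infProd hA hlow hlip x) i) j

theorem aestronglyMeasurable_infProd (hA : IsExpansive A) (hlow : IsLowPass A m h)
    (hlip : IsLipschitzNearZero h) (i j : Fin c) :
    AEStronglyMeasurable (fun x => infProd A h x i j) :=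
  aestronglyMeasurable_of_tendsto_ae atTop
    (fun n => aestronglyMeasurable_partialProd hA hlow n i j)
    (Eventually.of_forall fun x => tendsto_infProd_apply hA hlow hlip x i j)

theorem iterate_invB_tendsto_zero (hA : IsExpansive A) (x : Rd d) :
    Tendsto (fun n => (invB A)^[n] x) atTop (𝓝 0) := by
  obtain ⟨C, ρ, hC, hρ0, hρ1, hit⟩ := hA.exists_iterate_le
  refine squeeze_zero_norm (fun n => (hit n x).1) ?_
  simpa using ((tendsto_pow_atTop_nhds_zero_of_lt_one hρ0.le hρ1).const_mul C).mul_const ‖x‖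

/-- This is what centring the cube at the origin achieves: a function supported close to the origin
meets only one lattice translate of the cube. -/
theorem ball_subset_unitCube : Metric.ball (0 : Rd d) (1 / 2) ⊆ unitCube d := by
  intro x hx i
  have h1 := (PiLp.norm_apply_le x i).trans_lt (mem_ball_zero_iff.mp hx)
  rw [Real.norm_eq_abs, abs_lt] at h1
  exact ⟨by linarith [h1.1], by linarith [h1.2]⟩

/-- Fatou's lemma along the partial products cut off to `Bⁿ` of the unit cube. The substitution `x =
Bⁿ y` turns each cut-off integral into the torus integral bounded in `lintegral_torusProd_le`. -/
theorem lintegral_infProd_le (hA : IsExpansive A) (hlow : IsLowPass A m h)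
    (hlip : IsLipschitzNearZero h) (hhigh : IsHighPass A m m' h g) (i : Fin c) :
    ∫⁻ x, ‖infProd A h x i 0‖ₑ ^ 2 ≤ 1 := by
  -- The whole row is kept although only its first entry matters in the limit: the recursive bound
  -- controls full rows only.
  let F : ℕ → Rd d → ℝ≥0∞ := fun n x => (unitCube d).indicator
    (fun _ => ∑ j, ‖partialProd A h n x i j‖ₑ ^ 2) ((invB A)^[n] x)
  have hF : ∀ n, AEMeasurable (F n) := by
    intro n
    have h1 : AEMeasurable (fun x => ∑ j, ‖partialProd A h n x i j‖ₑ ^ 2) :=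
      Finset.aemeasurable_fun_sum _ fun j _ =>
        (aestronglyMeasurable_partialProd hA hlow n i j).enorm.pow_const 2
    have h2 : MeasurableSet ((invB A)^[n] ⁻¹' unitCube d) :=
      measurableSet_unitCube.preimage (continuous_invB.iterate n).measurable
    exact h1.indicator h2
  have hle : ∀ n, ∫⁻ x, F n x ≤ 1 := by
    intro n
    rw [lintegral_iterate_mulB hA n (hF n)]
    refine le_trans (le_of_eq ?_) (lintegral_torusProd_le hA hlow hhigh n i)
    congr 1
    have h1 : ∀ y, F n ((mulB A)^[n] y) = (unitCube d).indicator
        (fun y => ∑ j, ‖torusProd A h n (toTorus y) i j‖ₑ ^ 2) y := by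
      intro y
      simp only [F, iterate_invB_mulB hA, partialProd_iterate hA]
      rfl
    simp_rw [h1]
    rw [lintegral_indicator measurableSet_unitCube, ← measurePreserving_torusLift.map_eq,
      lintegral_map' ?_ measurable_torusLift.aemeasurable]
    · simp_rw [toTorus_torusLift]
    · rw [measurePreserving_torusLift.map_eq]
      refine AEMeasurable.restrict ?_
      exact Finset.aemeasurable_fun_sum _ fun j _ => (aestronglyMeasurable_comp_toTorus
        (aestronglyMeasurable_torusProd hA hlow n i j)).enorm.pow_const 2
  have hlim : ∀ x, ‖infProd A h x i 0‖ₑ ^ 2 ≤ liminf (fun n => F n x) atTop := by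
    intro x
    have h1 : Tendsto (fun n => ‖partialProd A h n x i 0‖ₑ ^ 2) atTop
        (𝓝 (‖infProd A h x i 0‖ₑ ^ 2)) :=
      ((ENNReal.continuous_pow 2).comp continuous_enorm).continuousAt.tendsto.comp
        (tendsto_infProd_apply hA hlow hlip x i 0)
    rw [← h1.liminf_eq]
    refine liminf_le_liminf ?_
    filter_upwards [(iterate_invB_tendsto_zero hA x).eventually
      (Metric.ball_mem_nhds 0 (by norm_num : (0 : ℝ) < 1 / 2))] with n hn
    simp only [F, Set.indicator_of_mem (ball_subset_unitCube hn)]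
    exact Finset.single_le_sum (f := fun j => ‖partialProd A h n x i j‖ₑ ^ 2)
      (fun _ _ => zero_le) (Finset.mem_univ 0)
  calc ∫⁻ x, ‖infProd A h x i 0‖ₑ ^ 2 ≤ ∫⁻ x, liminf (fun n => F n x) atTop := lintegral_mono hlim
    _ ≤ liminf (fun n => ∫⁻ x, F n x) atTop := lintegral_liminf_le' hF
    _ ≤ 1 := by
        refine (liminf_le_liminf (Eventually.of_forall hle)).trans ?_
        simp

theorem memLp_infProd (hA : IsExpansive A) (hlow : IsLowPass A m h)
    (hlip : IsLipschitzNearZero h) (hhigh : IsHighPass A m m' h g) (i : Fin c) :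
    MemLp (fun x => infProd A h x i 0) 2 :=
  memLp_two_of_lintegral (aestronglyMeasurable_infProd hA hlow hlip i 0)
    ((lintegral_infProd_le hA hlow hlip hhigh i).trans_lt ENNReal.one_lt_top)

/-- The entries of the infinite product vanish off the level sets. -/
theorem infProd_support (hA : IsExpansive A) (hlow : IsLowPass A m h)
    (hlip : IsLipschitzNearZero h) :
    ∀ᵐ x : Rd d, ∀ i : Fin c, toTorus x ∉ levelSet m i → infProd A h x i 0 = 0 := by
  have := finite_ker hA
  have := Fintype.ofFinite (endoHom A).ker
  -- If `α ζ` is outside `S_i`, the filter equation makes the squared norm of row `i` over the fibre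
  -- zero; at `ζ = B⁻¹ x` this kills the first factor of the product.
  have h1 : ∀ᵐ ζ ∂torusHaar d, ∀ i : Fin c, torusEndo A ζ ∉ levelSet m i → ∀ j, h i j ζ = 0 := by
    filter_upwards [ae_torusEndo hA (ae_all_iff.mpr fun i => hlow.filter_eq i i)] with ζ hζ i hi
    have h2 := hζ i
    simp only [if_pos, Set.indicator_of_notMem hi] at h2
    simp_rw [fiberSum_eq, Complex.mul_conj'] at h2
    have h3 : ∑ j, ∑ κ : (endoHom A).ker, ‖h i j (ζ + κ)‖ ^ 2 = 0 := by exact_mod_cast h2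
    intro j
    have h4 := (Finset.sum_eq_zero_iff_of_nonneg fun _ _ => by positivity).mp h3 j
      (Finset.mem_univ j)
    have h5 := (Finset.sum_eq_zero_iff_of_nonneg fun _ _ => by positivity).mp h4 0
      (Finset.mem_univ _)
    simpa using h5
  filter_upwards [ae_invB hA (ae_toTorus h1)] with x hx i hi
  rw [torusEndo_toTorus, mulB_invB hA] at hx
  rw [infProd_eq hA hlow hlip, Matrix.mul_apply]
  refine Finset.sum_eq_zero fun j _ => ?_
  rw [lowMatrix, Matrix.of_apply, hx i hi j, mul_zero, zero_mul]

end Square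

end GenFilter

end

noncomputable section

namespace GenFilter

variable {d : ℕ} {A : Matrix (Fin d) (Fin d) ℤ}

/-! ### Scaling functions and wavelets -/

/-- The square sums of the Fourier transform over the translates of a point are bounded. -/
def HasBoundedSqSum (f : L2 d) : Prop :=
  ∃ C : ℝ≥0∞, C ≠ ∞ ∧ ∀ᵐ ω ∂torusHaar d, sqSum (𝓕 f : L2 d) ω ≤ C

/-- Bounded square sums of `f` alone put every bracket in `L²`; nothing has to be known about the
translates of the `e i`, whose Bessel property is proved only later. -/
theorem shiftSum_eq_lintegral {ι : Type*} [Fintype ι] {f : L2 d} (hf : HasBoundedSqSum f)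
    (e : ι → L2 d) : shiftSum e f
      = ∑ i, ∫⁻ ω, ‖bracket (𝓕 f : L2 d) (𝓕 (e i) : L2 d) ω‖ₑ ^ 2 ∂torusHaar d := by
  obtain ⟨C, hC, hfC⟩ := hf
  rw [shiftSum_eq_sum]
  exact Finset.sum_congr rfl fun i _ =>
    tsum_inner_translate _ _ (memLp_bracket (Lp.memLp _) (Lp.memLp _) hC hfC)

theorem periodize_sum_mul {ι : Type*} [Fintype ι] {p : Rd d → ℂ} {q : ι → Rd d → ℂ}
    (hq : ∀ j, Integrable (q j)) (r : ι → Torus d → ℂ) (a : ℂ)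
    (hp : p =ᵐ[volume] fun y => a * ∑ j, r j (toTorus y) * q j y) :
    ∀ᵐ ω ∂torusHaar d, periodize p ω = a * ∑ j, r j ω * periodize (q j) ω := by
  filter_upwards [periodize_congr hp, ae_all_iff.mpr fun j => ae_summable_fiber (hq j)]
    with ω h3 h4
  rw [h3, periodize, tsum_mul_left]
  simp only [toTorus_torusLift_add]
  rw [Summable.tsum_finsetSum fun j _ => (h4 j).mul_left _]
  simp_rw [tsum_mul_left]
  rfl

theorem mul_conj_mulB_ae (hA : IsExpansive A) {ι : Type*} [Fintype ι] {u u' v : Rd d → ℂ}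
    {w : ι → Rd d → ℂ} (r : ι → Torus d → ℂ)
    (hu : u' =ᵐ[volume] fun x => ((√(detN A) : ℝ) : ℂ) * u (mulB A x))
    (hv : v =ᵐ[volume] fun x => ((√(detN A) : ℝ) : ℂ)⁻¹ *
      ∑ j, r j (toTorus (invB A x)) * w j (invB A x)) :
    (fun y => u (mulB A y) * conj (v (mulB A y))) =ᵐ[volume]
      fun y => (detN A : ℂ)⁻¹ * ∑ j, conj (r j (toTorus y)) * (u' y * conj (w j y)) := by
  have hN := detN_pos hA
  have hs : ((√(detN A) : ℝ) : ℂ) ≠ 0 := by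
    exact_mod_cast (Real.sqrt_pos.mpr hN).ne'
  have hss : (detN A : ℂ)⁻¹ = ((√(detN A) : ℝ) : ℂ)⁻¹ * ((√(detN A) : ℝ) : ℂ)⁻¹ := by
    rw [← mul_inv, ← Complex.ofReal_mul, Real.mul_self_sqrt hN.le]
  have key : ∀ s a b e : ℂ, s ≠ 0 → a * (s⁻¹ * (b * e)) = s⁻¹ * s⁻¹ * (b * (s * a * e)) := by
    intro s a b e hs
    field_simp
  filter_upwards [hu, ae_mulB hA hv] with y h2 h3
  rw [h3, h2, invB_mulB hA, map_mul, map_sum, map_inv₀, Complex.conj_ofReal, hss,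
    Finset.mul_sum, Finset.mul_sum, Finset.mul_sum]
  refine Finset.sum_congr rfl fun j _ => ?_
  rw [map_mul]
  exact key _ _ _ _ hs

/-- The bracket is computed by grouping representatives of `α ζ` by fibre point; on each group the
periodic coefficients `r j` factor out of the sum. -/
theorem bracket_torusEndo_of_refinement (hA : IsExpansive A) [Fintype (endoHom A).ker]
    {ι : Type*} [Fintype ι] {u u' v : Rd d → ℂ} {w : ι → Rd d → ℂ}
    (huv : Integrable fun x => u x * conj (v x))
    (huw : ∀ j, Integrable fun x => u' x * conj (w j x)) (r : ι → Torus d → ℂ)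
    (hu : u' =ᵐ[volume] fun x => ((√(detN A) : ℝ) : ℂ) * u (mulB A x))
    (hv : v =ᵐ[volume] fun x => ((√(detN A) : ℝ) : ℂ)⁻¹ *
      ∑ j, r j (toTorus (invB A x)) * w j (invB A x)) :
    ∀ᵐ ζ ∂torusHaar d, bracket u v (torusEndo A ζ)
      = (detN A : ℂ)⁻¹ * ∑ κ : (endoHom A).ker, ∑ j, conj (r j (ζ + κ)) *
        bracket u' (w j) (ζ + κ) := by
  have h2 := periodize_sum_mul huw (fun j ω => conj (r j ω)) _ (mul_conj_mulB_ae hA r hu hv)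
  have h3 := ae_torusEndo hA (ae_summable_fiber huv)
  have h4 := ae_add_ker hA h2
  refine h3.mp (h4.mono fun ζ h5 h6 => ?_)
  have h7 := periodize_torusEndo hA (F := fun x => u x * conj (v x)) h6
  refine h7.trans ?_
  rw [Finset.mul_sum]
  exact Finset.sum_congr rfl fun κ _ => h5 κ

section Wavelet

variable {c c' : ℕ} [NeZero c] {m m' : Torus d → ℕ} {h : Fin c → Fin c → Torus d → ℂ}
  {g : Fin c' → Fin c → Torus d → ℂ}

/-- The function with Fourier transform `P_{i,1}`. -/
def scalingFn (hA : IsExpansive A) (hlow : IsLowPass A m h) (hlip : IsLipschitzNearZero h)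
    (hhigh : IsHighPass A m m' h g) (i : Fin c) : L2 d :=
  𝓕⁻ ((memLp_infProd hA hlow hlip hhigh i).toLp)

theorem fourier_scalingFn (hA : IsExpansive A) (hlow : IsLowPass A m h)
    (hlip : IsLipschitzNearZero h) (hhigh : IsHighPass A m m' h g) (i : Fin c) :
    (𝓕 (scalingFn hA hlow hlip hhigh i) : L2 d) =ᵐ[volume] fun x => infProd A h x i 0 := by
  rw [scalingFn, FourierTransform.fourier_fourierInv_eq]
  exact MemLp.coeFn_toLp _

theorem memLp_waveletHat (hA : IsExpansive A) (hlow : IsLowPass A m h)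
    (hlip : IsLipschitzNearZero h) (hhigh : IsHighPass A m m' h g) (k : Fin c') :
    MemLp (fun x => ((√(detN A) : ℝ) : ℂ)⁻¹ *
      ∑ j, g k j (toTorus (invB A x)) * infProd A h (invB A x) j 0) 2 := by
  have h1 : MemLp (fun y : Rd d => ∑ j, g k j (toTorus y) * infProd A h y j 0) 2 := by
    refine memLp_finsetSum _ fun j _ => ?_
    refine (memLp_infProd hA hlow hlip hhigh j).of_le_mul (c := √(detN A)) ?_ ?_
    · exact (aestronglyMeasurable_comp_toTorus (hhigh.measurable k j)).mul
        (memLp_infProd hA hlow hlip hhigh j).1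
    · filter_upwards [ae_toTorus (ae_norm_highPass_le hA hhigh)] with y hy
      rw [norm_mul]
      exact mul_le_mul_of_nonneg_right (hy k j) (norm_nonneg _)
  have hM : (((realMat A)ᵀ)⁻¹).det ≠ 0 := by
    rw [Matrix.det_nonsing_inv, Ring.inverse_eq_inv']
    exact inv_ne_zero hA.transpose_det_ne_zero
  have h2 := memLp_comp_matrix _ hM h1
  have h3 : ((√(detN A) : ℝ) : ℂ)⁻¹ = ((√|(((realMat A)ᵀ)⁻¹).det| : ℝ) : ℂ) := by
    rw [Matrix.det_nonsing_inv, Ring.inverse_eq_inv', Matrix.det_transpose, abs_inv,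
      ← detN_eq_abs, Real.sqrt_inv, Complex.ofReal_inv]
  rw [h3]
  exact h2

/-- The wavelet attached to a row of the high-pass filter. -/
def waveletFn (hA : IsExpansive A) (hlow : IsLowPass A m h) (hlip : IsLipschitzNearZero h)
    (hhigh : IsHighPass A m m' h g) (k : Fin c') : L2 d :=
  𝓕⁻ ((memLp_waveletHat hA hlow hlip hhigh k).toLp)

theorem fourier_waveletFn (hA : IsExpansive A) (hlow : IsLowPass A m h)
    (hlip : IsLipschitzNearZero h) (hhigh : IsHighPass A m m' h g) (k : Fin c') :
    (𝓕 (waveletFn hA hlow hlip hhigh k) : L2 d) =ᵐ[volume] fun x => ((√(detN A) : ℝ) : ℂ)⁻¹ *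
      ∑ j, g k j (toTorus (invB A x)) * infProd A h (invB A x) j 0 := by
  rw [waveletFn, FourierTransform.fourier_fourierInv_eq]
  exact MemLp.coeFn_toLp _

theorem fourier_scalingFn_refinement (hA : IsExpansive A) (hlow : IsLowPass A m h)
    (hlip : IsLipschitzNearZero h) (hhigh : IsHighPass A m m' h g) (i : Fin c) :
    (𝓕 (scalingFn hA hlow hlip hhigh i) : L2 d) =ᵐ[volume] fun x => ((√(detN A) : ℝ) : ℂ)⁻¹ *
      ∑ j, h i j (toTorus (invB A x)) * infProd A h (invB A x) j 0 := by
  filter_upwards [fourier_scalingFn hA hlow hlip hhigh i] with x hx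
  rw [hx, infProd_eq hA hlow hlip, Matrix.mul_apply, Finset.mul_sum]
  refine Finset.sum_congr rfl fun j _ => ?_
  rw [lowMatrix, Matrix.of_apply, mul_assoc]

/-- The bracket product with a refined function, on the image of a point under `α`. -/
theorem bracket_torusEndo (hA : IsExpansive A) [Fintype (endoHom A).ker]
    (hlow : IsLowPass A m h) (hlip : IsLipschitzNearZero h) (hhigh : IsHighPass A m m' h g)
    (f θ : L2 d) (r : Fin c → Torus d → ℂ)
    (hθ : (𝓕 θ : L2 d) =ᵐ[volume] fun x => ((√(detN A) : ℝ) : ℂ)⁻¹ *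
      ∑ j, r j (toTorus (invB A x)) * infProd A h (invB A x) j 0) :
    ∀ᵐ ζ ∂torusHaar d, bracket (𝓕 f : L2 d) (𝓕 θ : L2 d) (torusEndo A ζ)
      = (detN A : ℂ)⁻¹ * ∑ κ : (endoHom A).ker, ∑ j, conj (r j (ζ + κ)) *
        bracket (𝓕 ((dilation hA).symm f) : L2 d) (fun x => infProd A h x j 0) (ζ + κ) :=
  bracket_torusEndo_of_refinement hA (integrable_mul_conj (Lp.memLp _) (Lp.memLp _))
    (fun _ => integrable_mul_conj (Lp.memLp _) (memLp_infProd hA hlow hlip hhigh _)) r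
    (fourier_dilation_symm_ae hA f) hθ

/-- One step of the pyramid algorithm. -/
theorem shiftSum_step (hA : IsExpansive A) {U : ℤ → Submodule ℂ (L2 d)} (hU : IsGMRA hA U)
    (hm : IsMultiplicityFunction (U 0) c m)
    (hm' : IsMultiplicityFunction (U 1 ⊓ (U 0)ᗮ) c' m')
    (hlow : IsLowPass A m h) (hlip : IsLipschitzNearZero h) (hhigh : IsHighPass A m m' h g)
    {f : L2 d} (hf : HasBoundedSqSum f) (hf' : HasBoundedSqSum ((dilation hA).symm f)) :
    shiftSum (scalingFn hA hlow hlip hhigh) ((dilation hA).symm f)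
      = shiftSum (scalingFn hA hlow hlip hhigh) f + shiftSum (waveletFn hA hlow hlip hhigh) f := by
  have := finite_ker hA
  have := Fintype.ofFinite (endoHom A).ker
  have hN := detN_pos hA
  rw [shiftSum_eq_lintegral hf, shiftSum_eq_lintegral hf, shiftSum_eq_lintegral hf']
  set b : Fin c → Torus d → ℂ := fun j =>
    bracket (𝓕 ((dilation hA).symm f) : L2 d) (fun x => infProd A h x j 0) with hb
  have hbm : ∀ j, AEMeasurable (fun ω => ‖b j ω‖ₑ ^ 2) (torusHaar d) := fun j =>
    (integrable_periodize (integrable_mul_conj (Lp.memLp _)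
      (memLp_infProd hA hlow hlip hhigh j))).aestronglyMeasurable.enorm.pow_const 2
  have hm2 : ∀ θ : L2 d, AEMeasurable
      (fun ω => ‖bracket (𝓕 f : L2 d) (𝓕 θ : L2 d) ω‖ₑ ^ 2) (torusHaar d) := fun θ =>
    (integrable_periodize (integrable_mul_conj (Lp.memLp _)
      (Lp.memLp _))).aestronglyMeasurable.enorm.pow_const 2
  -- The filter matrix is isometric, up to scale, only on vectors supported in the level sets; the
  -- brackets qualify because `P_{j,1}` vanishes off `S_j`.
  have hbsupp : ∀ᵐ ω ∂torusHaar d, ∀ j : Fin c, ω ∉ levelSet m j → b j ω = 0 := by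
    filter_upwards [ae_torusLift (infProd_support hA hlow hlip)] with ω hω j hj
    have : ∀ z, (𝓕 ((dilation hA).symm f) : L2 d) (torusLift ω + intVec z) *
        conj (infProd A h (torusLift ω + intVec z) j 0) = 0 := by
      intro z
      rw [hω z j (by rwa [toTorus_torusLift_add]), map_zero, mul_zero]
    simp only [hb, bracket, periodize, this, tsum_zero]
  have hlhs : ∑ i, ∫⁻ ω, ‖bracket (𝓕 ((dilation hA).symm f) : L2 d)
      (𝓕 (scalingFn hA hlow hlip hhigh i) : L2 d) ω‖ₑ ^ 2 ∂torusHaar d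
      = ∫⁻ ω, ∑ j, ‖b j ω‖ₑ ^ 2 ∂torusHaar d := by
    rw [lintegral_finsetSum' _ fun j _ => hbm j]
    refine Finset.sum_congr rfl fun i _ => lintegral_congr_ae ?_
    filter_upwards [bracket_congr (ae_eq_refl _) (fourier_scalingFn hA hlow hlip hhigh i)]
      with ω hω
    rw [hω]
  have hmeas : AEMeasurable (fun ω =>
      ∑ i, ‖bracket (𝓕 f : L2 d) (𝓕 (scalingFn hA hlow hlip hhigh i) : L2 d) ω‖ₑ ^ 2 +
      ∑ k, ‖bracket (𝓕 f : L2 d) (𝓕 (waveletFn hA hlow hlip hhigh k) : L2 d) ω‖ₑ ^ 2)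
      (torusHaar d) := (Finset.aemeasurable_fun_sum _ fun i _ => hm2 _).add
      (Finset.aemeasurable_fun_sum _ fun i _ => hm2 _)
  rw [hlhs, ← lintegral_finsetSum' _ fun i _ => hm2 _, ← lintegral_finsetSum' _ fun i _ => hm2 _,
    ← lintegral_add_left' (Finset.aemeasurable_fun_sum _ fun i _ => hm2 _),
    ← lintegral_torusEndo hA hmeas]
  have hNe : ENNReal.ofReal (detN A) ≠ 0 := by simpa using hN
  -- After multiplication by `N` the left side is an integral of fibre sums, and the right side has
  -- been pulled back along `α`. The integrands then agree pointwise, the factors on the right being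
  -- `N · N⁻² · N = 1`.
  rw [← ENNReal.mul_right_inj hNe ENNReal.ofReal_ne_top,
    ← lintegral_sum_ker hA (Finset.aemeasurable_fun_sum _ fun j _ => hbm j),
    ← lintegral_const_mul' _ _ ENNReal.ofReal_ne_top]
  refine lintegral_congr_ae ?_
  filter_upwards [ae_filter_isometry hA hU hm hm' hlow hhigh, ae_add_ker hA hbsupp,
    ae_all_iff.mpr fun i => bracket_torusEndo hA hlow hlip hhigh f _ (h i)
      (fourier_scalingFn_refinement hA hlow hlip hhigh i),
    ae_all_iff.mpr fun k => bracket_torusEndo hA hlow hlip hhigh f _ (g k)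
      (fourier_waveletFn hA hlow hlip hhigh k)] with ζ h1 h2 h3 h4
  have h5 := h1 b fun j κ hj => h2 κ j hj
  simp_rw [h3, h4]
  have h6 : ∀ z : ℂ, ‖(detN A : ℂ)⁻¹ * z‖ₑ ^ 2
      = ENNReal.ofReal ((detN A)⁻¹ ^ 2 * ‖z‖ ^ 2) := by
    intro z
    rw [← ofReal_norm, ← ENNReal.ofReal_pow (norm_nonneg _), norm_mul, norm_inv,
      Complex.norm_real, Real.norm_of_nonneg hN.le, mul_pow]
  have h7 : ∀ z : ℂ, ‖z‖ₑ ^ 2 = ENNReal.ofReal (‖z‖ ^ 2) := by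
    intro z
    rw [← ofReal_norm, ← ENNReal.ofReal_pow (norm_nonneg _)]
  simp_rw [h6, h7]
  rw [Finset.sum_congr rfl fun (κ : (endoHom A).ker) _ =>
    (ENNReal.ofReal_sum_of_nonneg (s := Finset.univ) (f := fun j => ‖b j (ζ + κ)‖ ^ 2)
      fun _ _ => sq_nonneg _).symm,
    ← ENNReal.ofReal_sum_of_nonneg (fun _ _ => Finset.sum_nonneg fun _ _ => by positivity),
    ← ENNReal.ofReal_sum_of_nonneg (fun _ _ => by positivity),
    ← ENNReal.ofReal_sum_of_nonneg (fun _ _ => by positivity),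
    ← ENNReal.ofReal_add (Finset.sum_nonneg fun _ _ => by positivity)
      (Finset.sum_nonneg fun _ _ => by positivity), ← ENNReal.ofReal_mul hN.le,
    ← Finset.mul_sum, ← Finset.mul_sum, ← mul_add, h5]
  congr 1
  field_simp

end Wavelet

end GenFilter

end

noncomputable section

namespace GenFilter

variable {d : ℕ} {A : Matrix (Fin d) (Fin d) ℤ}

/-! ### Bounded functions of bounded support -/

/-- The function `f` is bounded and vanishes off a ball. -/
def IsBoundedBddSupport (f : L2 d) : Prop :=
  ∃ R C : ℝ, ∀ᵐ x, ‖f x‖ ≤ C ∧ (R < ‖x‖ → f x = 0)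

theorem dense_isBoundedBddSupport : Dense {f : L2 d | IsBoundedBddSupport f} := by
  rw [Metric.dense_iff]
  intro f ε hε
  obtain ⟨u, hu, hfu, huc, hu2⟩ := (Lp.memLp f).exists_hasCompactSupport_eLpNorm_sub_le (by simp)
    (ε := ENNReal.ofReal (ε / 2)) (by simpa using hε)
  refine ⟨hu2.toLp, ?_, ?_⟩
  · rw [Metric.mem_ball, dist_comm, dist_eq_norm]
    have h1 : ‖f - hu2.toLp‖ ≤ ε / 2 := by
      rw [Lp.norm_def]
      refine ENNReal.toReal_le_of_le_ofReal (by positivity) (le_trans (le_of_eq ?_) hfu)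
      refine eLpNorm_congr_ae ?_
      filter_upwards [Lp.coeFn_sub f hu2.toLp, hu2.coeFn_toLp] with x h2 h3
      rw [h2, Pi.sub_apply, h3, Pi.sub_apply]
    linarith
  · obtain ⟨R, hR⟩ := hu.isCompact.isBounded.exists_norm_le
    obtain ⟨C, hC⟩ := huc.bounded_above_of_compact_support hu
    refine ⟨R, C, ?_⟩
    filter_upwards [hu2.coeFn_toLp] with x hx
    rw [hx]
    exact ⟨hC x, fun h => image_eq_zero_of_notMem_tsupport fun h' => absurd (hR x h') h.not_ge⟩

theorem dense_fourier_isBoundedBddSupport :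
    Dense {f : L2 d | IsBoundedBddSupport (𝓕 f : L2 d)} :=
  dense_isBoundedBddSupport.preimage
    (Lp.fourierTransformₗᵢ (Rd d) ℂ).toHomeomorph.isOpenMap

theorem sqSum_le_of_isBoundedBddSupport {u : L2 d} (hu : IsBoundedBddSupport u) :
    ∃ C : ℝ≥0∞, C ≠ ∞ ∧ ∀ᵐ ω ∂torusHaar d, sqSum u ω ≤ C := by
  obtain ⟨R, C, hRC⟩ := hu
  -- One unit beyond `⌈R⌉` compensates for the half-width of the cube: outside this box a translate
  -- of the cube misses the ball of radius `R`.
  set M : ℤ := ⌈R⌉ + 1 with hM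
  set K : Finset (Fin d → ℤ) := Fintype.piFinset fun _ => Finset.Icc (-M) M with hK
  refine ⟨∑ z ∈ K, ENNReal.ofReal C ^ 2, by simp [ENNReal.mul_eq_top], ?_⟩
  filter_upwards [ae_torusLift hRC] with ω hω
  rw [sqSum, tsum_eq_sum (s := K)]
  · refine Finset.sum_le_sum fun z _ => ?_
    rw [← ofReal_norm]
    gcongr
    exact (hω z).1
  · intro z hz
    have : ∃ i, z i ∉ Finset.Icc (-M) M := by
      by_contra! h
      exact hz (Fintype.mem_piFinset.mpr h)
    obtain ⟨i, hi⟩ := this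
    rw [(hω z).2 ?_]
    · simp
    · have h1 := torusLift_mem ω i
      have h2 := PiLp.norm_apply_le (torusLift ω + intVec z) i
      refine lt_of_lt_of_le ?_ h2
      have h3 : (torusLift ω + intVec z) i = torusLift ω i + z i := rfl
      have h4 := Int.le_ceil R
      rw [h3, Real.norm_eq_abs, lt_abs]
      rw [Finset.mem_Icc, not_and_or, not_le, not_le] at hi
      rcases hi with hi | hi
      · right
        have h5 : (z i : ℝ) + 1 ≤ -(⌈R⌉ + 1) := by exact_mod_cast hi
        linarith [h1.2]
      · left
        have h5 : (⌈R⌉ : ℝ) + 1 + 1 ≤ z i := by exact_mod_cast hi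
        linarith [h1.1]

theorem hasBoundedSqSum_of_isBoundedBddSupport {f : L2 d}
    (hf : IsBoundedBddSupport (𝓕 f : L2 d)) : HasBoundedSqSum f :=
  sqSum_le_of_isBoundedBddSupport hf

theorem fourier_iterate_dilation_symm_ae (hA : IsExpansive A) (f : L2 d) (n : ℕ) :
    (𝓕 ((dilation hA).symm^[n] f) : L2 d) =ᵐ[volume]
      fun x => ((√(detN A) : ℝ) : ℂ) ^ n * (𝓕 f : L2 d) ((mulB A)^[n] x) := by
  induction n with
  | zero => simp
  | succ n ih =>
    rw [Function.iterate_succ_apply']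
    filter_upwards [fourier_dilation_symm_ae hA ((dilation hA).symm^[n] f), ae_mulB hA ih]
      with x h1 h2
    rw [h1, h2, ← Function.iterate_succ_apply, pow_succ']
    ring

theorem ae_iterate_mulB (hA : IsExpansive A) {p : Rd d → Prop} (hp : ∀ᵐ x, p x) (n : ℕ) :
    ∀ᵐ x, p ((mulB A)^[n] x) := by
  induction n with
  | zero => exact hp
  | succ n ih =>
    filter_upwards [ae_mulB hA ih] with x hx
    rwa [Function.iterate_succ_apply]

/-- Up to a constant factor the transform of `δ⁻ⁿ f` is that of `f` composed with `Bⁿ`, so its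
support shrinks geometrically to the origin. -/
theorem fourier_iterate_dilation_symm_bddSupport (hA : IsExpansive A) {f : L2 d}
    (hf : IsBoundedBddSupport (𝓕 f : L2 d)) :
    (∀ n, IsBoundedBddSupport (𝓕 ((dilation hA).symm^[n] f) : L2 d)) ∧
    ∀ r > 0, ∀ᶠ n in atTop, ∀ᵐ x, r < ‖x‖ → (𝓕 ((dilation hA).symm^[n] f) : L2 d) x = 0 := by
  obtain ⟨R, C, hRC⟩ := hf
  obtain ⟨K, ρ, hK, h0, h1, hle⟩ := hA.exists_iterate_le
  have key : ∀ n, ∀ᵐ x, K * ρ ^ n * |R| < ‖x‖ → (𝓕 ((dilation hA).symm^[n] f) : L2 d) x = 0 := by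
    intro n
    filter_upwards [fourier_iterate_dilation_symm_ae hA f n, ae_iterate_mulB hA hRC n]
      with x h2 h3 h4
    rw [h2, h3.2, mul_zero]
    by_contra! h5
    have h6 := (hle n ((mulB A)^[n] x)).1
    rw [iterate_invB_mulB hA] at h6
    have h7 : K * ρ ^ n * ‖(mulB A)^[n] x‖ ≤ K * ρ ^ n * |R| := by
      have := h5.trans (le_abs_self R)
      gcongr
    linarith
  refine ⟨fun n => ⟨K * ρ ^ n * |R|, √(detN A) ^ n * C, ?_⟩, fun r hr => ?_⟩
  · filter_upwards [key n, fourier_iterate_dilation_symm_ae hA f n, ae_iterate_mulB hA hRC n]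
      with x h2 h3 h4
    refine ⟨?_, h2⟩
    rw [h3, norm_mul, norm_pow, Complex.norm_real, Real.norm_of_nonneg (Real.sqrt_nonneg _)]
    have := h4.1
    gcongr
  · have h2 : Tendsto (fun n => K * ρ ^ n * |R|) atTop (𝓝 (K * 0 * |R|)) :=
      ((tendsto_pow_atTop_nhds_zero_of_lt_one h0.le h1).const_mul K).mul_const _
    rw [mul_zero, zero_mul] at h2
    filter_upwards [h2.eventually (gt_mem_nhds hr)] with n hn
    filter_upwards [key n] with x hx h3
    exact hx (hn.trans h3)

theorem bracket_eq_of_support {u v : Rd d → ℂ} {r : ℝ} (hr : r < 1 / 2)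
    (hu : ∀ᵐ x, r < ‖x‖ → u x = 0) :
    ∀ᵐ ω ∂torusHaar d, bracket u v ω = u (torusLift ω) * conj (v (torusLift ω)) := by
  filter_upwards [ae_torusLift hu] with ω hω
  rw [bracket, periodize, tsum_eq_single 0, intVec_zero, add_zero]
  intro z hz
  rw [hω z, zero_mul]
  by_contra! h
  refine hz (eq_zero_of_mem_unitCube (torusLift_mem ω) (ball_subset_unitCube ?_))
  rw [mem_ball_zero_iff]
  linarith

/-! ### The limit of the scaling energy at fine scales -/

section Wavelet

variable {c c' : ℕ} [NeZero c] {m m' : Torus d → ℕ} {h : Fin c → Fin c → Torus d → ℂ}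
  {g : Fin c' → Fin c → Torus d → ℂ}

/-- When the transform of `f` lives in a ball of radius below `1/2`, each periodization has at most
one nonzero term, so the brackets can be squared and integrated directly on `ℝ^d`. -/
theorem shiftSum_scalingFn_of_support (hA : IsExpansive A) (hlow : IsLowPass A m h)
    (hlip : IsLipschitzNearZero h) (hhigh : IsHighPass A m m' h g) {f : L2 d}
    (hf : IsBoundedBddSupport (𝓕 f : L2 d)) {r : ℝ} (hr : r < 1 / 2)
    (hfr : ∀ᵐ x, r < ‖x‖ → (𝓕 f : L2 d) x = 0) :
    shiftSum (scalingFn hA hlow hlip hhigh) f = ∫⁻ x, ‖(𝓕 f : L2 d) x‖ₑ ^ 2 *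
      ENNReal.ofReal (∑ i, ‖infProd A h x i 0‖ ^ 2) := by
  rw [shiftSum_eq_lintegral (hasBoundedSqSum_of_isBoundedBddSupport hf)]
  have h0 : ∀ i : Fin c, AEMeasurable fun x : Rd d => ‖(𝓕 f : L2 d) x * conj (infProd A h x i 0)‖ₑ ^ 2 :=
    fun i => ((integrable_mul_conj (Lp.memLp (𝓕 f : L2 d))
      (memLp_infProd hA hlow hlip hhigh i)).1.enorm.pow_const 2)
  have h1 : ∀ i : Fin c, ∫⁻ ω, ‖bracket (𝓕 f : L2 d)
      (𝓕 (scalingFn hA hlow hlip hhigh i) : L2 d) ω‖ₑ ^ 2 ∂torusHaar d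
      = ∫⁻ x, ‖(𝓕 f : L2 d) x * conj (infProd A h x i 0)‖ₑ ^ 2 := by
    intro i
    have h2 : ∀ᵐ ω ∂torusHaar d, ‖bracket (𝓕 f : L2 d)
        (𝓕 (scalingFn hA hlow hlip hhigh i) : L2 d) ω‖ₑ ^ 2
        = ‖(𝓕 f : L2 d) (torusLift ω) * conj (infProd A h (torusLift ω) i 0)‖ₑ ^ 2 := by
      filter_upwards [bracket_congr (ae_eq_refl _) (fourier_scalingFn hA hlow hlip hhigh i),
        bracket_eq_of_support (v := fun x => infProd A h x i 0) hr hfr] with ω h3 h4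
      rw [h3, h4]
    rw [lintegral_congr_ae h2]
    have h5 := measurePreserving_torusLift (d := d)
    have h6 := lintegral_map' (f := fun x => ‖(𝓕 f : L2 d) x * conj (infProd A h x i 0)‖ₑ ^ 2)
      (by rw [h5.map_eq]; exact (h0 i).restrict) h5.measurable.aemeasurable
    rw [← h6, h5.map_eq, ← lintegral_indicator measurableSet_unitCube]
    refine lintegral_congr_ae ?_
    filter_upwards [hfr] with x hx
    by_cases h7 : x ∈ unitCube d
    · rw [Set.indicator_of_mem h7]
    · rw [Set.indicator_of_notMem h7, hx, zero_mul]
      · simp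
      · by_contra! h8
        exact h7 (ball_subset_unitCube (mem_ball_zero_iff.mpr (h8.trans_lt hr)))
  simp_rw [h1]
  rw [← lintegral_finsetSum' _ fun i _ => h0 i]
  refine lintegral_congr fun x => ?_
  simp_rw [enorm_mul, mul_pow]
  rw [← Finset.mul_sum, ENNReal.ofReal_sum_of_nonneg fun _ _ => sq_nonneg _]
  refine congrArg _ (Finset.sum_congr rfl fun i _ => ?_)
  rw [← ofReal_norm, RCLike.norm_conj, ENNReal.ofReal_pow (norm_nonneg _)]

theorem tendsto_shiftSum_scalingFn (hA : IsExpansive A) (hlow : IsLowPass A m h)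
    (hlip : IsLipschitzNearZero h) (hhigh : IsHighPass A m m' h g) {f : L2 d}
    (hf : IsBoundedBddSupport (𝓕 f : L2 d)) :
    Tendsto (fun n => shiftSum (scalingFn hA hlow hlip hhigh) ((dilation hA).symm^[n] f)) atTop
      (𝓝 (‖f‖ₑ ^ 2)) := by
  have hfin : ‖f‖ₑ ^ 2 ≠ ∞ := by simp
  have hnorm : ∀ n, ∫⁻ x, ‖(𝓕 ((dilation hA).symm^[n] f) : L2 d) x‖ₑ ^ 2 = ‖f‖ₑ ^ 2 := by
    intro n
    rw [← enorm_sq_Lp]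
    congr 1
    have h1 : ‖(𝓕 ((dilation hA).symm^[n] f) : L2 d)‖ = ‖f‖ := by
      rw [Lp.norm_fourier_eq]
      induction n with
      | zero => rfl
      | succ n ih => rw [Function.iterate_succ_apply', LinearIsometryEquiv.norm_map, ih]
    rw [← ofReal_norm, h1, ofReal_norm]
  have key : ∀ ε : ℝ, 0 < ε → ε < 1 → ∀ᶠ n in atTop,
      ENNReal.ofReal (1 - ε) * ‖f‖ₑ ^ 2
        ≤ shiftSum (scalingFn hA hlow hlip hhigh) ((dilation hA).symm^[n] f) ∧
      shiftSum (scalingFn hA hlow hlip hhigh) ((dilation hA).symm^[n] f)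
        ≤ ENNReal.ofReal (1 + ε) * ‖f‖ₑ ^ 2 := by
    intro ε hε hε1
    obtain ⟨r, hr, hrε⟩ := tendsto_sum_infProd hA hlow hlip hε
    obtain ⟨hb, hs⟩ := fourier_iterate_dilation_symm_bddSupport hA hf
    -- Radius `r` makes the weight `∑ |P_{i,1}|²` within `ε` of `1`; radius `1 / 4` rules out
    -- overlapping translates.
    filter_upwards [hs (min r (1 / 4)) (by positivity)] with n hn
    rw [shiftSum_scalingFn_of_support hA hlow hlip hhigh (hb n)
      (lt_of_le_of_lt (min_le_right _ _) (by norm_num)) hn, ← hnorm n,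
      ← lintegral_const_mul' _ _ ENNReal.ofReal_ne_top,
      ← lintegral_const_mul' _ _ ENNReal.ofReal_ne_top]
    constructor
    all_goals
      refine lintegral_mono_ae ?_
      filter_upwards [hn] with x hx
      rw [mul_comm]
      rcases le_or_gt ‖x‖ (min r (1 / 4)) with h1 | h1
      · have h2 := abs_le.mp (hrε x (h1.trans (min_le_left _ _)))
        gcongr
        linarith
      · rw [hx h1]
        simp
  have hlim : ∀ s : ℝ, Tendsto (fun ε : ℝ => ENNReal.ofReal (1 + s * ε) * ‖f‖ₑ ^ 2)
      (𝓝[>] 0) (𝓝 (‖f‖ₑ ^ 2)) := by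
    intro s
    have h1 : Tendsto (fun ε : ℝ => ENNReal.ofReal (1 + s * ε)) (𝓝[>] 0)
        (𝓝 (ENNReal.ofReal (1 + s * 0))) := by
      refine (ENNReal.continuous_ofReal.comp ?_).continuousAt.mono_left nhdsWithin_le_nhds
      fun_prop
    have h2 := ENNReal.Tendsto.mul_const h1 (Or.inr hfin)
    simpa using h2
  have hsmall : ∀ᶠ ε : ℝ in 𝓝[>] 0, 0 < ε ∧ ε < 1 :=
    Ioo_mem_nhdsGT one_pos
  refine tendsto_order.mpr ⟨fun a ha => ?_, fun a ha => ?_⟩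
  · obtain ⟨ε, h1, h2, h3⟩ := (((hlim (-1)).eventually (lt_mem_nhds ha)).and hsmall).exists
    filter_upwards [key ε h2 h3] with n hn
    refine h1.trans_le ?_
    rw [neg_one_mul, ← sub_eq_add_neg]
    exact hn.1
  · obtain ⟨ε, h1, h2, h3⟩ := (((hlim 1).eventually (gt_mem_nhds ha)).and hsmall).exists
    filter_upwards [key ε h2 h3] with n hn
    rw [one_mul] at h1
    exact hn.2.trans_lt h1

end Wavelet

end GenFilter

end

noncomputable section

namespace GenFilter

variable {d : ℕ} {A : Matrix (Fin d) (Fin d) ℤ}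

/-! ### Concentrated functions have small shift sums -/

theorem iterate_dilation_ae (hA : IsExpansive A) (f : L2 d) (n : ℕ) :
    (dilation hA)^[n] f =ᵐ[volume] fun t => ((√(detN A) : ℝ) : ℂ) ^ n *
      f ((Matrix.toEuclideanLin (realMat A))^[n] t) := by
  induction n with
  | zero => simp
  | succ n ih =>
    rw [Function.iterate_succ_apply']
    filter_upwards [dilation_ae hA ((dilation hA)^[n] f),
      ae_comp_matrix _ (realMat_det_ne_zero hA) ih] with x h1 h2
    rw [h1, h2, ← Function.iterate_succ_apply, pow_succ']
    ring

theorem ae_iterate_comp (hA : IsExpansive A) {p : Rd d → Prop} (hp : ∀ᵐ x, p x) (n : ℕ) :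
    ∀ᵐ x, p ((Matrix.toEuclideanLin (realMat A))^[n] x) := by
  induction n with
  | zero => exact hp
  | succ n ih =>
    filter_upwards [ae_comp_matrix _ (realMat_det_ne_zero hA) ih] with x hx
    rwa [Function.iterate_succ_apply]

theorem iterate_dilation_support (hA : IsExpansive A) {f : L2 d} (hf : IsBoundedBddSupport f) :
    ∃ r : ℕ → ℝ, Tendsto r atTop (𝓝 0) ∧ (∀ n, 0 ≤ r n) ∧
      ∀ n, ∀ᵐ x, r n < ‖x‖ → (dilation hA)^[n] f x = 0 := by
  obtain ⟨R, C, hRC⟩ := hf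
  obtain ⟨K, ρ, hK, h0, h1, hle⟩ := hA.exists_iterate_le
  have hinv : Function.LeftInverse (Matrix.toEuclideanLin (realMat A)⁻¹)
      (Matrix.toEuclideanLin (realMat A)) := by
    intro t
    rw [Matrix.toLpLin_apply, Matrix.toLpLin_apply]
    simp [Matrix.mulVec_mulVec,
      Matrix.nonsing_inv_mul _ (isUnit_iff_ne_zero.mpr (realMat_det_ne_zero hA))]
  refine ⟨fun n => K * ρ ^ n * |R|, ?_, fun n => by positivity, fun n => ?_⟩
  · have h2 : Tendsto (fun n => K * ρ ^ n * |R|) atTop (𝓝 (K * 0 * |R|)) :=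
      ((tendsto_pow_atTop_nhds_zero_of_lt_one h0.le h1).const_mul K).mul_const _
    rwa [mul_zero, zero_mul] at h2
  · filter_upwards [iterate_dilation_ae hA f n, ae_iterate_comp hA hRC n] with x h2 h3 h4
    rw [h2, h3.2, mul_zero]
    by_contra! h5
    have h6 := (hle n ((Matrix.toEuclideanLin (realMat A))^[n] x)).2
    rw [hinv.iterate n x] at h6
    have h7 : K * ρ ^ n * ‖(Matrix.toEuclideanLin (realMat A))^[n] x‖ ≤ K * ρ ^ n * |R| := by
      have := h5.trans (le_abs_self R)
      gcongr
    linarith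

theorem enorm_inner_sq_le_of_support {φ v : L2 d} {s : Set (Rd d)} (hs : MeasurableSet s)
    (hv : ∀ᵐ x, x ∉ s → v x = 0) :
    ‖⟪φ, v⟫_ℂ‖ₑ ^ 2 ≤ (∫⁻ x in s, ‖φ x‖ₑ ^ 2) * ‖v‖ₑ ^ 2 := by
  have hw : MemLp (s.indicator φ) 2 := (Lp.memLp φ).indicator hs
  have h1 : ⟪φ, v⟫_ℂ = ⟪hw.toLp, v⟫_ℂ := by
    rw [L2.inner_def, L2.inner_def]
    refine integral_congr_ae ?_
    filter_upwards [hw.coeFn_toLp, hv] with x h2 h3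
    rw [h2]
    by_cases h4 : x ∈ s
    · rw [Set.indicator_of_mem h4]
    · rw [h3 h4, inner_zero_right, inner_zero_right]
  have h2 : ‖hw.toLp‖ₑ ^ 2 = ∫⁻ x in s, ‖φ x‖ₑ ^ 2 := by
    rw [enorm_sq_Lp, ← lintegral_indicator hs]
    refine lintegral_congr_ae ?_
    filter_upwards [hw.coeFn_toLp] with x h2
    rw [h2]
    by_cases h4 : x ∈ s
    · rw [Set.indicator_of_mem h4, Set.indicator_of_mem h4]
    · rw [Set.indicator_of_notMem h4, Set.indicator_of_notMem h4]
      simp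
  rw [h1, ← h2, ← mul_pow]
  gcongr
  rw [← ofReal_norm, ← ofReal_norm, ← ofReal_norm, ← ENNReal.ofReal_mul (norm_nonneg _)]
  exact ENNReal.ofReal_le_ofReal (norm_inner_le_norm _ _)

theorem aemeasurable_translate_sq (φ : L2 d) (z : Fin d → ℤ) :
    AEMeasurable fun t : Rd d => ‖φ (t + intVec z)‖ₑ ^ 2 :=
  ((Lp.aestronglyMeasurable φ).comp_quasiMeasurePreserving
    (measurePreserving_add_right volume (intVec z)).quasiMeasurePreserving).enorm.pow_const 2

/-- Cauchy–Schwarz on `s` for each translate; summation over `z` produces the periodization of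
`|φ|²`, which is integrable on a unit cube. -/
theorem tsum_inner_sq_le_of_support {φ v : L2 d} {s : Set (Rd d)} (hs : MeasurableSet s)
    (hv : ∀ᵐ x, x ∉ s → v x = 0) :
    ∑' z, ‖⟪translate z φ, v⟫_ℂ‖ₑ ^ 2
      ≤ (∫⁻ t in s, ∑' z, ‖φ (t + intVec z)‖ₑ ^ 2) * ‖v‖ₑ ^ 2 := by
  rw [lintegral_tsum fun z => (aemeasurable_translate_sq φ z).restrict, ← ENNReal.tsum_mul_right]
  refine ENNReal.tsum_le_tsum fun z => (enorm_inner_sq_le_of_support hs hv).trans_eq ?_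
  congr 1
  refine lintegral_congr_ae (ae_restrict_of_ae ?_)
  filter_upwards [translate_ae z φ] with t ht
  rw [ht]

theorem lintegral_unitCube_tsum (φ : L2 d) :
    ∫⁻ t in unitCube d, ∑' z, ‖φ (t + intVec z)‖ₑ ^ 2 = ‖φ‖ₑ ^ 2 := by
  rw [enorm_sq_Lp, lintegral_eq_torus _ ((Lp.aestronglyMeasurable φ).enorm.pow_const 2)]
  have h5 := measurePreserving_torusLift (d := d)
  rw [← h5.map_eq, lintegral_map' _ h5.measurable.aemeasurable]
  rw [h5.map_eq]
  exact (AEMeasurable.tsum fun z => aemeasurable_translate_sq φ z).restrict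

/-- The supports of `δⁿ f` lie in shrinking balls, and absolute continuity of the integral of the
periodized `|e_i|²` gives the limit. Positive dimension is what makes the volumes tend to zero. The
`e i` are arbitrary, so the result also applies to generators other than the scaling functions. -/
theorem tendsto_shiftSum_iterate_dilation [Nonempty (Fin d)] (hA : IsExpansive A) {ι : Type*}
    [Fintype ι] (e : ι → L2 d) {f : L2 d} (hf : IsBoundedBddSupport f) :
    Tendsto (fun n => shiftSum e ((dilation hA)^[n] f)) atTop (𝓝 0) := by
  obtain ⟨r, hr, hr0, hrf⟩ := iterate_dilation_support hA hf
  have hnorm : ∀ n, ‖(dilation hA)^[n] f‖ₑ = ‖f‖ₑ := by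
    intro n
    induction n with
    | zero => rfl
    | succ n ih =>
      rw [Function.iterate_succ_apply', ← ofReal_norm, LinearIsometryEquiv.norm_map, ofReal_norm, ih]
  have hvol : Tendsto (fun n => (volume.restrict (unitCube d)) (Metric.closedBall (0 : Rd d) (r n)))
      atTop (𝓝 0) := by
    have h1 : Tendsto (fun n => ENNReal.ofReal (r n ^ Module.finrank ℝ (Rd d)) *
        volume (Metric.closedBall (0 : Rd d) 1)) atTop (𝓝 0) := by
      have h2 := ENNReal.Tendsto.mul_const (ENNReal.tendsto_ofReal
        (hr.pow (Module.finrank ℝ (Rd d)))) (Or.inr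
          (measure_closedBall_lt_top (μ := volume) (x := (0 : Rd d)) (r := 1)).ne)
      rwa [zero_pow (by simpa using Fin.pos_iff_nonempty.mpr ‹_› |>.ne'), ENNReal.ofReal_zero,
        zero_mul] at h2
    refine tendsto_of_tendsto_of_tendsto_of_le_of_le tendsto_const_nhds h1 (fun _ => zero_le) ?_
    intro n
    exact (Measure.restrict_apply_le _ _).trans_eq (Measure.addHaar_closedBall' _ _ (hr0 n))
  have key : ∀ i, Tendsto (fun n => (∫⁻ t in Metric.closedBall (0 : Rd d) (r n),
      ∑' z, ‖e i (t + intVec z)‖ₑ ^ 2) * ‖f‖ₑ ^ 2) atTop (𝓝 0) := by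
    intro i
    have h1 : ∫⁻ t in unitCube d, ∑' z, ‖e i (t + intVec z)‖ₑ ^ 2 ≠ ∞ := by
      rw [lintegral_unitCube_tsum]
      simp
    have h2 := ENNReal.Tendsto.mul_const (b := ‖f‖ₑ ^ 2) (tendsto_setLIntegral_zero h1 hvol)
      (Or.inr (by simp))
    rw [zero_mul] at h2
    refine h2.congr' ?_
    filter_upwards [hr.eventually (gt_mem_nhds (show (0 : ℝ) < 1 / 2 by norm_num))] with n hn
    rw [Measure.restrict_restrict Metric.isClosed_closedBall.measurableSet, Set.inter_eq_left.mpr]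
    exact (Metric.closedBall_subset_ball hn).trans ball_subset_unitCube
  have hsum := tendsto_finsetSum Finset.univ fun i _ => key i
  rw [Finset.sum_const_zero] at hsum
  refine tendsto_of_tendsto_of_tendsto_of_le_of_le tendsto_const_nhds hsum (fun _ => zero_le) ?_
  intro n
  change shiftSum e _ ≤ _
  rw [shiftSum_eq_sum]
  refine Finset.sum_le_sum fun i _ => ?_
  rw [← hnorm n]
  refine tsum_inner_sq_le_of_support Metric.isClosed_closedBall.measurableSet ?_
  filter_upwards [hrf n] with x hx h1
  exact hx (by simpa using h1)

/-- In dimension zero the dilation is the identity, so all `U j` coincide; then trivial intersection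
and dense union together would force `L²` of a point to vanish. -/
theorem IsGMRA.nonempty {hA : IsExpansive A} {U : ℤ → Submodule ℂ (L2 d)} (hU : IsGMRA hA U) :
    Nonempty (Fin d) := by
  by_contra hd
  rw [not_nonempty_iff] at hd
  have hdil : ∀ f : L2 d, dilation hA f = f := by
    intro f
    refine Lp.ext ?_
    filter_upwards [dilation_ae hA f] with t ht
    have h1 : detN A = 1 := by simp [detN]
    rw [ht, Subsingleton.elim (Matrix.toEuclideanLin (realMat A) t) t, h1]
    simp
  have hsucc : ∀ j, U (j + 1) = U j := by
    intro j
    rw [hU.succ_eq]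
    ext f
    exact ⟨fun ⟨g, hg, he⟩ => by rwa [← he, show (dilation hA).toLinearEquiv.toLinearMap g = g from
      hdil g], fun hf => ⟨f, hf, hdil f⟩⟩
  have hconst : ∀ j, U j = U 0 := by
    intro j
    induction j with
    | zero => rfl
    | succ j ih => rw [hsucc, ih]
    | pred j ih => rw [← ih, ← hsucc (-j - 1), sub_add_cancel]
  have hbot : U 0 = ⊥ := by
    rw [← hU.inter_eq]
    simp [hconst]
  have hdense := hU.dense_union
  simp only [hconst, hbot, Submodule.bot_coe, Set.iUnion_const] at hdense
  have hball : volume (Metric.ball (0 : Rd d) 1) ≠ ∞ := measure_ball_lt_top.ne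
  set f : L2 d := indicatorConstLp 2 (Metric.isOpen_ball.measurableSet) hball (1 : ℂ)
  have hf : f ∈ closure ({0} : Set (L2 d)) := hdense f
  rw [closure_singleton, Set.mem_singleton_iff] at hf
  have h1 : ‖f‖ = 0 := by rw [hf, norm_zero]
  rw [norm_indicatorConstLp (by simp) (by simp)] at h1
  have h2 : 0 < volume (Metric.ball (0 : Rd d) 1) := Metric.measure_ball_pos _ _ one_pos
  have h3 : 0 < volume.real (Metric.ball (0 : Rd d) 1) := ENNReal.toReal_pos h2.ne' hball
  have h4 : 0 < volume.real (Metric.ball (0 : Rd d) 1) ^ (1 / (2 : ℝ≥0∞).toReal) :=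
    Real.rpow_pos_of_pos h3 _
  rw [norm_one, one_mul] at h1
  exact h4.ne' h1

end GenFilter

end

noncomputable section

namespace GenFilter

/-! ### Bessel families -/

/-- The constant `2` accommodates the difference of two functions that are each Lipschitz with
constant one, such as a contracted norm minus the norm. -/
theorem tendsto_zero_of_dense {H : Type*} [NormedAddCommGroup H] {a : ℕ → H → ℝ} (ha : ∀ n f g, |a n f - a n g| ≤ 2 * ‖f - g‖)
    {D : Set H} (hD : Dense D) (h : ∀ f ∈ D, Tendsto (fun n => a n f) atTop (𝓝 0)) (f : H) :
    Tendsto (fun n => a n f) atTop (𝓝 0) := by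
  rw [Metric.tendsto_atTop]
  intro ε hε
  obtain ⟨g, hg, hfg⟩ := Metric.dense_iff.mp hD f (ε / 4) (by positivity)
  obtain ⟨M, hM⟩ := Metric.tendsto_atTop.mp (h g hfg) (ε / 2) (by positivity)
  refine ⟨M, fun n hn => ?_⟩
  have h1 := hM n hn
  have h2 := ha n f g
  rw [Metric.mem_ball, dist_comm, dist_eq_norm] at hg
  rw [Real.dist_eq, sub_zero] at h1 ⊢
  have h3 : |a n f| ≤ |a n f - a n g| + |a n g| := by
    simpa using abs_add_le (a n f - a n g) (a n g)
  linarith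

section Bessel

variable {H : Type*} [NormedAddCommGroup H] [InnerProductSpace ℂ H] {κ : Type*} {e : κ → H}

/-- The family `e` is a Bessel family with bound `1`. -/
def IsBessel (e : κ → H) : Prop := ∀ f, ∑' p, ‖⟪e p, f⟫_ℂ‖ₑ ^ 2 ≤ ‖f‖ₑ ^ 2

/-- Finite partial sums are continuous, so their bound passes to the closure before the supremum is
taken. -/
theorem isBessel_of_dense {D : Set H} (hD : Dense D)
    (he : ∀ f ∈ D, ∑' p, ‖⟪e p, f⟫_ℂ‖ₑ ^ 2 ≤ ‖f‖ₑ ^ 2) : IsBessel e := by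
  intro f
  rw [ENNReal.tsum_eq_iSup_sum]
  refine iSup_le fun s => ?_
  have hc : IsClosed {f : H | ∑ p ∈ s, ‖⟪e p, f⟫_ℂ‖ₑ ^ 2 ≤ ‖f‖ₑ ^ 2} := by
    refine isClosed_le (continuous_finsetSum _ fun p _ => ?_) ?_
    · exact ENNReal.continuous_pow 2 |>.comp (by fun_prop)
    · exact ENNReal.continuous_pow 2 |>.comp continuous_enorm
  exact hc.closure_subset_iff.mpr
    (fun f hf => (ENNReal.sum_le_tsum s).trans (he f hf)) (hD f)

theorem ofReal_norm_sq {E : Type*} [SeminormedAddCommGroup E] (x : E) :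
    ENNReal.ofReal (‖x‖ ^ 2) = ‖x‖ₑ ^ 2 := by
  rw [ENNReal.ofReal_pow (norm_nonneg _), ofReal_norm]

theorem IsBessel.summable (he : IsBessel e) (f : H) : Summable fun p => ‖⟪e p, f⟫_ℂ‖ ^ 2 := by
  have h1 : ∑' p, ‖⟪e p, f⟫_ℂ‖ₑ ^ 2 ≠ ∞ := ((he f).trans_lt (by simp)).ne
  refine (ENNReal.summable_toReal h1).congr fun p => ?_
  rw [← ofReal_norm_sq, ENNReal.toReal_ofReal (sq_nonneg _)]

theorem IsBessel.ofReal_tsum (he : IsBessel e) (f : H) :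
    ENNReal.ofReal (∑' p, ‖⟪e p, f⟫_ℂ‖ ^ 2) = ∑' p, ‖⟪e p, f⟫_ℂ‖ₑ ^ 2 := by
  rw [ENNReal.ofReal_tsum_of_nonneg (fun p => sq_nonneg _) (he.summable f)]
  exact tsum_congr fun p => ofReal_norm_sq _

theorem IsBessel.tsum_le (he : IsBessel e) (f : H) :
    ∑' p, ‖⟪e p, f⟫_ℂ‖ ^ 2 ≤ ‖f‖ ^ 2 := by
  rw [← ENNReal.ofReal_le_ofReal_iff (sq_nonneg _), he.ofReal_tsum, ofReal_norm_sq]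
  exact he f

theorem IsBessel.memℓp (he : IsBessel e) (f : H) :
    Memℓp (fun p => ⟪e p, f⟫_ℂ) 2 :=
  memℓp_gen ((he.summable f).congr fun p => by simp)

/-- The analysis operator of a Bessel family. -/
def analysis (he : IsBessel e) : H →L[ℂ] lp (fun _ : κ => ℂ) 2 :=
  LinearMap.mkContinuous
    { toFun := fun f => ⟨fun p => ⟪e p, f⟫_ℂ, he.memℓp f⟩
      map_add' := fun f g => by ext p; exact inner_add_right _ _ _
      map_smul' := fun a f => by ext p; exact inner_smul_right _ _ _ } 1 (by
    intro f
    rw [one_mul]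
    refine lp.norm_le_of_tsum_le (by simp) (norm_nonneg _) ?_
    simpa using he.tsum_le f)

theorem analysis_apply (he : IsBessel e) (f : H) (p : κ) : analysis he f p = ⟪e p, f⟫_ℂ := rfl

theorem norm_analysis_sq (he : IsBessel e) (f : H) :
    ‖analysis he f‖ ^ 2 = ∑' p, ‖⟪e p, f⟫_ℂ‖ ^ 2 := by
  have := lp.norm_rpow_eq_tsum (by simp) (analysis he f)
  simpa [analysis_apply] using this

theorem hasSum_analysis (he : IsBessel e) (f : H) :
    HasSum (fun p => ‖⟪e p, f⟫_ℂ‖ ^ 2) (‖analysis he f‖ ^ 2) := by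
  rw [norm_analysis_sq]
  exact (he.summable f).hasSum

theorem enorm_analysis_sq (he : IsBessel e) (f : H) :
    ‖analysis he f‖ₑ ^ 2 = ∑' p, ‖⟪e p, f⟫_ℂ‖ₑ ^ 2 := by
  rw [← he.ofReal_tsum, ← norm_analysis_sq, ofReal_norm_sq]

theorem norm_analysis_le (he : IsBessel e) (f : H) : ‖analysis he f‖ ≤ ‖f‖ := by
  rw [← sq_le_sq₀ (norm_nonneg _) (norm_nonneg _), norm_analysis_sq]
  exact he.tsum_le f

theorem analysis_eq_zero_iff (he : IsBessel e) (f : H) :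
    analysis he f = 0 ↔ f ∈ (Submodule.span ℂ (Set.range e)).topologicalClosureᗮ := by
  rw [Submodule.orthogonal_closure, Submodule.mem_orthogonal]
  constructor
  · intro h u hu
    induction hu using Submodule.span_induction with
    | mem u hu =>
      obtain ⟨p, rfl⟩ := hu
      rw [← analysis_apply he, h]
      rfl
    | zero => exact inner_zero_left _
    | add u v _ _ h1 h2 => rw [inner_add_left, h1, h2, add_zero]
    | smul a u _ h1 => rw [inner_smul_left, h1, mul_zero]
  · intro h
    ext p
    exact h _ (Submodule.subset_span ⟨p, rfl⟩)

end Bessel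

end GenFilter

end

noncomputable section

namespace GenFilter

/-! ### Polar decomposition and Parseval generators -/

/-- Here `R` is the square root of `T* T`, and `U` extends `R v ↦ T v` isometrically to the closure
of the range of `R` and by zero to its complement. The inner product of `v` with `f` in that closure
sees only the projection of `v`, whose norm is `‖U v‖`. The functional calculus gives the
commutation property. -/
theorem exists_polar {H K : Type*} [NormedAddCommGroup H] [InnerProductSpace ℂ H]
    [CompleteSpace H] [NormedAddCommGroup K] [InnerProductSpace ℂ K] [CompleteSpace K]
    (T : H →L[ℂ] K) : ∃ (R : H →L[ℂ] H) (U : H →L[ℂ] K),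
      (∀ v w, ⟪R v, w⟫_ℂ = ⟪v, R w⟫_ℂ) ∧ (∀ v, ‖R v‖ = ‖T v‖) ∧ (∀ v, U (R v) = T v) ∧
      (∀ v, (∀ w, ⟪R w, v⟫_ℂ = 0) → U v = 0) ∧
      (∀ f ∈ R.range.topologicalClosure, ∀ v, ‖⟪v, f⟫_ℂ‖ ≤ ‖f‖ * ‖U v‖) ∧
      ∀ τ : H →L[ℂ] H, Commute (T.adjoint ∘L T) τ → Commute R τ := by
  set S : H →L[ℂ] H := T.adjoint ∘L T with hS
  have hS0 : 0 ≤ S :=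
    (ContinuousLinearMap.nonneg_iff_isPositive _).mpr T.isPositive_adjoint_comp_self
  set R : H →L[ℂ] H := CFC.sqrt S with hR
  have hsa : ∀ v w, ⟪R v, w⟫_ℂ = ⟪v, R w⟫_ℂ :=
    ((ContinuousLinearMap.nonneg_iff_isPositive _).mp (CFC.sqrt_nonneg S)).isSymmetric
  have hRR : ∀ v, R (R v) = S v := fun v =>
    congrArg (fun X : H →L[ℂ] H => X v) (CFC.sqrt_mul_sqrt_self S hS0)
  have hnorm : ∀ v, ‖R v‖ = ‖T v‖ := by
    intro v
    rw [← sq_eq_sq₀ (norm_nonneg _) (norm_nonneg _), @norm_sq_eq_re_inner ℂ,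
      @norm_sq_eq_re_inner ℂ, hsa, hRR, hS, ContinuousLinearMap.comp_apply,
      ContinuousLinearMap.adjoint_inner_right]
  set Q := R.range.topologicalClosure with hQ
  have hmem : ∀ v, R v ∈ Q := fun v => R.range.le_topologicalClosure ⟨v, rfl⟩
  set e : H →ₗ[ℂ] Q := R.toLinearMap.codRestrict Q hmem with he
  have hdense : DenseRange e := by
    intro x
    have hx : (x : H) ∈ closure (R.range : Set H) := x.2
    rw [closure_subtype]
    refine closure_mono ?_ hx
    rintro _ ⟨v, rfl⟩
    exact ⟨e v, ⟨v, rfl⟩, rfl⟩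
  have hbd : ∀ v, ‖T v‖ ≤ 1 * ‖e v‖ := fun v => by
    rw [one_mul, ← hnorm]
    exact le_rfl
  set U₀ : Q →L[ℂ] K := T.toLinearMap.extendOfNorm e with hU₀
  have hU₀e : ∀ v, U₀ (e v) = T v := LinearMap.extendOfNorm_eq hdense ⟨1, hbd⟩
  have hU₀n : ∀ x, ‖U₀ x‖ = ‖x‖ := by
    intro x
    refine hdense.induction_on (p := fun x => ‖U₀ x‖ = ‖x‖) x
      (isClosed_eq (by fun_prop) (by fun_prop)) fun v => ?_
    rw [hU₀e, ← hnorm]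
    rfl
  have hQc : IsClosed (Q : Set H) := Submodule.isClosed_topologicalClosure _
  have : CompleteSpace Q := hQc.completeSpace_coe
  refine ⟨R, U₀ ∘L Q.orthogonalProjectionOnto, hsa, hnorm, fun v => ?_, fun v hv => ?_,
    fun f hf v => ?_, fun τ hτ => hτ.cfcₙ_nnreal _⟩
  · rw [ContinuousLinearMap.comp_apply, ← hU₀e]
    exact congrArg U₀ (Submodule.orthogonalProjectionOnto_mem_subspace_eq_self (e v))
  · have h1 : v ∈ Qᗮ := by
      rw [hQ, Submodule.orthogonal_closure, Submodule.mem_orthogonal]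
      rintro _ ⟨w, rfl⟩
      exact hv w
    rw [ContinuousLinearMap.comp_apply,
      Submodule.orthogonalProjectionOnto_apply_of_mem_orthogonal h1, map_zero]
  · rw [ContinuousLinearMap.comp_apply, hU₀n]
    have h1 : ⟪v, f⟫_ℂ = ⟪Q.orthogonalProjectionOnto v, (⟨f, hf⟩ : Q)⟫_ℂ :=
      (Submodule.inner_orthogonalProjectionOnto_eq_of_mem_right (⟨f, hf⟩ : Q) v).symm
    rw [h1, mul_comm]
    exact norm_inner_le_norm _ _

theorem enorm_sq_lp {κ : Type*} (x : lp (fun _ : κ => ℂ) 2) :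
    ‖x‖ₑ ^ 2 = ∑' p, ‖x p‖ₑ ^ 2 := by
  have h1 : ‖x‖ ^ 2 = ∑' p, ‖x p‖ ^ 2 := by
    have := lp.norm_rpow_eq_tsum (by simp) x
    simpa using this
  have h2 : Summable fun p => ‖x p‖ ^ 2 :=
    ((memℓp_gen_iff (by simp)).mp (lp.memℓp x)).congr fun p => by simp
  rw [← ofReal_norm_sq, h1, ENNReal.ofReal_tsum_of_nonneg (fun p => sq_nonneg _) h2]
  exact tsum_congr fun p => ofReal_norm_sq _

variable {d c : ℕ}

/-- Translation permutes the family of translates of the `φ_i`, so it amounts to a reindexing of the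
sum defining the frame operator. -/
theorem commute_analysis_translate {φ : Fin c → L2 d}
    (he : IsBessel fun p : (Fin d → ℤ) × Fin c => translate p.1 (φ p.2)) (z : Fin d → ℤ) :
    Commute ((analysis he).adjoint ∘L analysis he) (translate z).toContinuousLinearMap := by
  refine ContinuousLinearMap.ext fun v => ?_
  refine ext_inner_left ℂ fun w => ?_
  change ⟪w, (analysis he).adjoint (analysis he (translate z v))⟫_ℂ
    = ⟪w, translate z ((analysis he).adjoint (analysis he v))⟫_ℂ
  have h1 : ∀ x : L2 d, ⟪w, translate z x⟫_ℂ = ⟪translate (-z) w, x⟫_ℂ := by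
    intro x
    rw [inner_translate_left, neg_neg]
  rw [ContinuousLinearMap.adjoint_inner_right, h1, ContinuousLinearMap.adjoint_inner_right,
    lp.inner_eq_tsum, lp.inner_eq_tsum,
    ← ((Equiv.addRight z).prodCongr (Equiv.refl (Fin c))).tsum_eq]
  refine tsum_congr fun p => ?_
  simp only [analysis_apply]
  have h2 : ∀ x : L2 d, ⟪translate (p.1 + z) (φ p.2), x⟫_ℂ
      = ⟪translate p.1 (φ p.2), translate (-z) x⟫_ℂ := by
    intro x
    rw [add_comm, translate_add, inner_translate_left]
  change ⟪⟪translate (p.1 + z) (φ p.2), w⟫_ℂ, ⟪translate (p.1 + z) (φ p.2), translate z v⟫_ℂ⟫_ℂ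
    = _
  rw [h2, h2, ← translate_add, neg_add_cancel, translate_zero]

/-- A finitely generated shift-invariant space has finitely many Parseval generators. -/
theorem exists_generators_coreSpace {φ : Fin c → L2 d}
    (he : IsBessel fun p : (Fin d → ℤ) × Fin c => translate p.1 (φ p.2)) :
    ∃ e : Fin c → L2 d, ∀ f ∈ coreSpace φ, ∀ v, ‖⟪v, f⟫_ℂ‖ₑ ^ 2 ≤ ‖f‖ₑ ^ 2 * shiftSum e v := by
  obtain ⟨R, U, hsa, hnorm, hUR, hU0, hle, hcomm⟩ := exists_polar (analysis he)
  -- Both closed subspaces have the kernel of the analysis operator as orthogonal complement.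
  have hQ : R.range.topologicalClosure = coreSpace φ := by
    have h1 : R.rangeᗮ = (coreSpace φ)ᗮ := by
      ext v
      rw [coreSpace, ← analysis_eq_zero_iff he, ← norm_eq_zero, ← hnorm, norm_eq_zero,
        Submodule.mem_orthogonal]
      constructor
      · intro h
        refine ext_inner_left ℂ fun w => ?_
        rw [← hsa, inner_zero_right]
        exact h _ ⟨w, rfl⟩
      · rintro h _ ⟨w, rfl⟩
        refine (hsa w v).trans ?_
        rw [h, inner_zero_right]
    have h2 : IsClosed (coreSpace φ : Set (L2 d)) := Submodule.isClosed_topologicalClosure _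
    have : CompleteSpace (coreSpace φ) := h2.completeSpace_coe
    rw [← Submodule.orthogonal_orthogonal_eq_closure, h1, Submodule.orthogonal_orthogonal]
  classical
  set s : (Fin d → ℤ) × Fin c → lp (fun _ : (Fin d → ℤ) × Fin c => ℂ) 2 :=
    fun p => lp.single 2 p 1 with hs
  have hsx : ∀ p x, ⟪s p, x⟫_ℂ = x p := by
    intro p x
    simp [hs, lp.inner_single_left]
  have hRt : ∀ z v, R (translate z v) = translate z (R v) := fun z v =>
    congrArg (fun X : L2 d →L[ℂ] L2 d => X v) (hcomm _ (commute_analysis_translate he z))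
  -- Equivariance of `U` is clear on the range of `R`, where `U ∘ R` is the analysis operator. So
  -- the defect `w` is orthogonal to this range; `U` kills `w` and its translates, whence `⟪w, w⟫ =
  -- 0`.
  have key : ∀ z i, translate z (U.adjoint (s (0, i))) = U.adjoint (s (z, i)) := by
    intro z i
    set w := translate z (U.adjoint (s (0, i))) - U.adjoint (s (z, i)) with hw
    have hwv : ∀ v, ⟪w, v⟫_ℂ = U (translate (-z) v) (0, i) - U v (z, i) := by
      intro v
      rw [hw, inner_sub_left, inner_translate_left, ContinuousLinearMap.adjoint_inner_left,
        ContinuousLinearMap.adjoint_inner_left, hsx, hsx]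
    have h1 : ∀ x, ⟪w, R x⟫_ℂ = 0 := by
      intro x
      rw [hwv, ← hRt, hUR, hUR, analysis_apply, analysis_apply, translate_zero,
        inner_translate_left, sub_self]
    have h2 : ∀ x, ⟪R x, w⟫_ℂ = 0 := fun x => inner_eq_zero_symm.mp (h1 x)
    have h3 : ⟪w, w⟫_ℂ = 0 := by
      rw [hwv, hU0 w h2, hU0 (translate (-z) w)]
      · simp
      · intro x
        rw [← inner_translate_left, ← hRt]
        exact h2 _
    exact sub_eq_zero.mp (inner_self_eq_zero.mp h3)
  refine ⟨fun i => U.adjoint (s (0, i)), fun f hf v => ?_⟩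
  have h1 : shiftSum (fun i => U.adjoint (s (0, i))) v = ‖U v‖ₑ ^ 2 := by
    rw [shiftSum, enorm_sq_lp]
    refine tsum_congr fun p => ?_
    rw [key, ContinuousLinearMap.adjoint_inner_left, hsx]
  rw [h1, ← mul_pow]
  gcongr
  rw [← ofReal_norm, ← ofReal_norm, ← ofReal_norm, ← ENNReal.ofReal_mul (norm_nonneg _)]
  exact ENNReal.ofReal_le_ofReal (hle f (hQ ▸ hf) v)

end GenFilter

end

noncomputable section

namespace GenFilter

variable {d : ℕ} {A : Matrix (Fin d) (Fin d) ℤ}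

/-! ### From the pyramid identity to the frame property and the multiresolution analysis -/

theorem zpow_dilation_add_apply (hA : IsExpansive A) (i j : ℤ) (f : L2 d) :
    ((dilation hA) ^ (i + j)) f = ((dilation hA) ^ i) (((dilation hA) ^ j) f) := by
  rw [_root_.zpow_add]
  rfl

theorem zpow_dilation_neg_apply (hA : IsExpansive A) (j : ℤ) (f : L2 d) :
    ((dilation hA) ^ j) (((dilation hA) ^ (-j)) f) = f := by
  rw [← zpow_dilation_add_apply, add_neg_cancel, zpow_zero]
  rfl

theorem zpow_dilation_natCast (hA : IsExpansive A) (n : ℕ) (f : L2 d) :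
    ((dilation hA) ^ (n : ℤ)) f = (dilation hA)^[n] f := by
  induction n with
  | zero => rfl
  | succ n ih =>
    rw [Function.iterate_succ_apply', ← ih, Nat.cast_succ, add_comm, zpow_dilation_add_apply,
      zpow_one]

theorem zpow_dilation_neg_natCast (hA : IsExpansive A) (n : ℕ) (f : L2 d) :
    ((dilation hA) ^ (-(n : ℤ))) f = (dilation hA).symm^[n] f := by
  induction n with
  | zero => rfl
  | succ n ih =>
    rw [Function.iterate_succ_apply', ← ih, Nat.cast_succ, neg_add, add_comm,
      zpow_dilation_add_apply, _root_.zpow_neg_one]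
    rfl

theorem inner_zpow_dilation (hA : IsExpansive A) (j : ℤ) (f g : L2 d) :
    ⟪((dilation hA) ^ j) f, g⟫_ℂ = ⟪f, ((dilation hA) ^ (-j)) g⟫_ℂ := by
  conv_lhs => rw [← zpow_dilation_neg_apply hA j g]
  exact ((dilation hA) ^ j).inner_map_map _ _

theorem mem_dilates_iff (hA : IsExpansive A) {V : Submodule ℂ (L2 d)} {j : ℤ} {f : L2 d} :
    f ∈ dilates hA V j ↔ ((dilation hA) ^ (-j)) f ∈ V := by
  constructor
  · rintro ⟨g, hg, rfl⟩
    change ((dilation hA) ^ (-j)) (((dilation hA) ^ j) g) ∈ V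
    have := zpow_dilation_neg_apply hA (-j) g
    rw [neg_neg] at this
    rwa [this]
  · intro h
    exact ⟨_, h, zpow_dilation_neg_apply hA j f⟩

theorem mem_coreSpace_translate {c : ℕ} {φ : Fin c → L2 d} (z : Fin d → ℤ) {f : L2 d}
    (hf : f ∈ coreSpace φ) : translate z f ∈ coreSpace φ := by
  have h1 : coreSpace φ ≤ (coreSpace φ).comap (translate z).toLinearMap := by
    refine Submodule.topologicalClosure_minimal _ ?_
      ((Submodule.isClosed_topologicalClosure _).preimage (translate z).continuous)
    rw [Submodule.span_le]
    rintro _ ⟨p, rfl⟩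
    refine Submodule.le_topologicalClosure _ (Submodule.subset_span ⟨(z + p.1, p.2), ?_⟩)
    exact translate_add _ _ _
  exact h1 hf

section Pyramid

variable {c c' : ℕ} {φ : Fin c → L2 d} {ψ : Fin c' → L2 d}

/-- The pyramid identity, with the limit of the scaling part at fine scales. -/
structure IsPyramid (hA : IsExpansive A) (φ : Fin c → L2 d) (ψ : Fin c' → L2 d) : Prop where
  besselScaling : IsBessel fun p : (Fin d → ℤ) × Fin c => translate p.1 (φ p.2)
  besselWavelet : IsBessel fun p : (Fin d → ℤ) × Fin c' => translate p.1 (ψ p.2)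
  step : ∀ f, ‖analysis besselScaling ((dilation hA).symm f)‖ ^ 2
    = ‖analysis besselScaling f‖ ^ 2 + ‖analysis besselWavelet f‖ ^ 2
  tendsto : ∀ f, Tendsto (fun n => ‖analysis besselScaling ((dilation hA).symm^[n] f)‖) atTop
    (𝓝 ‖f‖)

theorem norm_iterate_map (T : L2 d ≃ₗᵢ[ℂ] L2 d) (n : ℕ) (f : L2 d) : ‖T^[n] f‖ = ‖f‖ := by
  induction n with
  | zero => rfl
  | succ n ih => rw [Function.iterate_succ_apply', LinearIsometryEquiv.norm_map, ih]

theorem iterate_map_sub (T : L2 d ≃ₗᵢ[ℂ] L2 d) (n : ℕ) (f g : L2 d) :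
    T^[n] f - T^[n] g = T^[n] (f - g) := by
  induction n with
  | zero => rfl
  | succ n ih =>
    rw [Function.iterate_succ_apply', Function.iterate_succ_apply', Function.iterate_succ_apply',
      ← map_sub, ih]

theorem abs_norm_analysis_sub_le {κ : Type*} {e : κ → L2 d} (he : IsBessel e)
    (T : L2 d ≃ₗᵢ[ℂ] L2 d) (n : ℕ) (f g : L2 d) :
    |‖analysis he (T^[n] f)‖ - ‖analysis he (T^[n] g)‖| ≤ ‖f - g‖ := by
  refine (abs_norm_sub_norm_le _ _).trans ?_
  rw [← map_sub, iterate_map_sub]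
  exact (norm_analysis_le he _).trans_eq (norm_iterate_map T n _)

theorem tendsto_norm_of_tendsto_enorm_sq {E : Type*} [SeminormedAddCommGroup E] {x : ℕ → E}
    {a : ℝ} (ha : 0 ≤ a) (h : Tendsto (fun n => ‖x n‖ₑ ^ 2) atTop (𝓝 (ENNReal.ofReal a ^ 2))) :
    Tendsto (fun n => ‖x n‖) atTop (𝓝 a) := by
  have h1 := (ENNReal.tendsto_toReal (by simp)).comp h
  have h2 : Tendsto (fun n => ‖x n‖ ^ 2) atTop (𝓝 (a ^ 2)) := by
    simpa [Function.comp_def, ha] using h1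
  have h3 := h2.sqrt
  rw [Real.sqrt_sq ha] at h3
  exact h3.congr fun n => Real.sqrt_sq (norm_nonneg _)

/-- On `D` the scaling energy of `δ⁻ⁿ f` is nondecreasing in `n` with limit `‖f‖²`. This bounds the
scaling energy of `f`, and one further step bounds its wavelet energy. With both Bessel bounds the
analysis operators are continuous, and the identity and the limit extend to all of `L²`. -/
theorem isPyramid_of_dense (hA : IsExpansive A) {D : Set (L2 d)} (hD : Dense D)
    (hinv : ∀ f ∈ D, (dilation hA).symm f ∈ D)
    (hstep : ∀ f ∈ D, shiftSum φ ((dilation hA).symm f) = shiftSum φ f + shiftSum ψ f)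
    (hlim : ∀ f ∈ D, Tendsto (fun n => shiftSum φ ((dilation hA).symm^[n] f)) atTop
      (𝓝 (‖f‖ₑ ^ 2))) : IsPyramid hA φ ψ := by
  have hφ : ∀ f ∈ D, shiftSum φ f ≤ ‖f‖ₑ ^ 2 := by
    intro f hf
    refine ge_of_tendsto' (hlim f hf) fun n => ?_
    induction n generalizing f with
    | zero => exact le_rfl
    | succ n ih =>
      rw [Function.iterate_succ_apply]
      exact (le_add_right le_rfl).trans ((hstep f hf).symm.trans_le (ih _ (hinv f hf)))
  have hψ : ∀ f ∈ D, shiftSum ψ f ≤ ‖f‖ₑ ^ 2 := by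
    intro f hf
    refine (le_add_left le_rfl).trans ((hstep f hf).symm.trans_le ((hφ _ (hinv f hf)).trans_eq ?_))
    rw [← ofReal_norm, LinearIsometryEquiv.norm_map, ofReal_norm]
  have bφ : IsBessel fun p : (Fin d → ℤ) × Fin c => translate p.1 (φ p.2) :=
    isBessel_of_dense hD hφ
  have bψ : IsBessel fun p : (Fin d → ℤ) × Fin c' => translate p.1 (ψ p.2) :=
    isBessel_of_dense hD hψ
  refine ⟨bφ, bψ, fun f => ?_, fun f => ?_⟩
  · have h1 : Set.EqOn (fun f => ‖analysis bφ ((dilation hA).symm f)‖ ^ 2)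
        (fun f => ‖analysis bφ f‖ ^ 2 + ‖analysis bψ f‖ ^ 2) D := by
      intro f hf
      have h2 : ‖analysis bφ ((dilation hA).symm f)‖ₑ ^ 2
          = ‖analysis bφ f‖ₑ ^ 2 + ‖analysis bψ f‖ₑ ^ 2 := by
        rw [enorm_analysis_sq, enorm_analysis_sq, enorm_analysis_sq]
        exact hstep f hf
      rw [← ofReal_norm_sq, ← ofReal_norm_sq, ← ofReal_norm_sq,
        ← ENNReal.ofReal_add (sq_nonneg _) (sq_nonneg _),
        ENNReal.ofReal_eq_ofReal_iff (sq_nonneg _) (by positivity)] at h2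
      exact h2
    have h2 := Continuous.ext_on hD (by fun_prop) (by fun_prop) h1
    exact congrFun h2 f
  · have h1 := tendsto_zero_of_dense
      (a := fun n f => ‖analysis bφ ((dilation hA).symm^[n] f)‖ - ‖f‖) (fun n f g => ?_) hD
      (fun f hf => ?_) f
    · simpa using h1.add_const ‖f‖
    · have h2 := abs_norm_analysis_sub_le bφ (dilation hA).symm n f g
      have h3 := abs_norm_sub_norm_le f g
      rw [abs_le] at h2 h3 ⊢
      constructor <;> linarith [h2.1, h2.2, h3.1, h3.2]
    · have h2 : Tendsto (fun n => ‖analysis bφ ((dilation hA).symm^[n] f)‖) atTop (𝓝 ‖f‖) := by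
        refine tendsto_norm_of_tendsto_enorm_sq (norm_nonneg f) ?_
        rw [ofReal_norm]
        refine (hlim f hf).congr fun n => ?_
        rw [enorm_analysis_sq]
        rfl
      simpa using h2.sub_const ‖f‖

theorem tendsto_analysis_iterate_dilation [Nonempty (Fin d)] (hA : IsExpansive A)
    (hφ : IsBessel fun p : (Fin d → ℤ) × Fin c => translate p.1 (φ p.2)) (f : L2 d) :
    Tendsto (fun n => ‖analysis hφ ((dilation hA)^[n] f)‖) atTop (𝓝 0) := by
  refine tendsto_zero_of_dense (a := fun n f => ‖analysis hφ ((dilation hA)^[n] f)‖)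
    (fun n f g => ?_) dense_isBoundedBddSupport (fun f hf => ?_) f
  · refine (abs_norm_analysis_sub_le hφ (dilation hA) n f g).trans ?_
    linarith [norm_nonneg (f - g)]
  · refine tendsto_norm_of_tendsto_enorm_sq le_rfl ?_
    rw [ENNReal.ofReal_zero, zero_pow two_ne_zero]
    refine (tendsto_shiftSum_iterate_dilation hA φ hf).congr fun n => ?_
    rw [enorm_analysis_sq]
    rfl

theorem hasSum_int_of_telescope {a b : ℤ → ℝ} {L : ℝ} (hb : ∀ j, 0 ≤ b j)
    (hab : ∀ j, a (j + 1) = a j + b j) (h1 : Tendsto (fun n : ℕ => a n) atTop (𝓝 L))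
    (h2 : Tendsto (fun n : ℕ => a (-n)) atTop (𝓝 0)) : HasSum b L := by
  have h3 : HasSum (fun n : ℕ => b n) (L - a 0) := by
    rw [hasSum_iff_tendsto_nat_of_nonneg fun n => hb n]
    refine (h1.sub_const (a 0)).congr fun n => ?_
    have := Finset.sum_range_sub (fun n : ℕ => a n) n
    rw [← Nat.cast_zero, ← this]
    refine Finset.sum_congr rfl fun i _ => ?_
    rw [Nat.cast_succ, hab, add_sub_cancel_left]
  have h4 : HasSum (fun n : ℕ => b (-(n + 1 : ℤ))) (a 0) := by
    rw [hasSum_iff_tendsto_nat_of_nonneg fun n => hb _]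
    have h5 := h2.const_sub (a 0)
    rw [sub_zero] at h5
    refine h5.congr fun n => ?_
    have := Finset.sum_range_sub' (fun n : ℕ => a (-n)) n
    rw [Nat.cast_zero, neg_zero] at this
    rw [← this]
    refine Finset.sum_congr rfl fun i _ => ?_
    have h6 := hab (-(i + 1 : ℤ))
    rw [neg_add, neg_add_cancel_right] at h6
    rw [Nat.cast_succ, neg_add, h6, add_sub_cancel_left]
  have h5 := HasSum.of_nat_of_neg_add_one h3 h4
  rwa [sub_add_cancel] at h5

/-- The scaling energies of `δ⁻ʲ f`, `j ∈ ℤ`, telescope: their increments are the wavelet energies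
at scale `j`, and they run from `0` to `‖f‖²`. -/
theorem IsPyramid.isParsevalMultiwavelet [Nonempty (Fin d)] {hA : IsExpansive A}
    (hp : IsPyramid hA φ ψ) : IsParsevalMultiwavelet hA ψ := by
  intro f
  have h1 : HasSum (fun j : ℤ => ‖analysis hp.besselWavelet (((dilation hA) ^ (-j)) f)‖ ^ 2)
      (‖f‖ ^ 2) := by
    refine hasSum_int_of_telescope
      (a := fun j : ℤ => ‖analysis hp.besselScaling (((dilation hA) ^ (-j)) f)‖ ^ 2)
      (fun j => sq_nonneg _) (fun j => ?_) ?_ ?_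
    · rw [← hp.step, neg_add, add_comm, zpow_dilation_add_apply, _root_.zpow_neg_one]
      rfl
    · refine ((hp.tendsto f).pow 2).congr fun n => ?_
      rw [zpow_dilation_neg_natCast]
    · have h2 := (tendsto_analysis_iterate_dilation hA hp.besselScaling f).pow 2
      rw [zero_pow two_ne_zero] at h2
      refine h2.congr fun n => ?_
      rw [neg_neg, zpow_dilation_natCast]
  have h2 : ∀ j : ℤ, HasSum (fun p : (Fin d → ℤ) × Fin c' =>
      ‖⟪((dilation hA) ^ j) (translate p.1 (ψ p.2)), f⟫_ℂ‖ ^ 2)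
      (‖analysis hp.besselWavelet (((dilation hA) ^ (-j)) f)‖ ^ 2) := by
    intro j
    refine (hasSum_analysis hp.besselWavelet (((dilation hA) ^ (-j)) f)).congr_fun fun p => ?_
    rw [inner_zpow_dilation]
  have h3 : Summable fun p : ℤ × (Fin d → ℤ) × Fin c' =>
      ‖⟪((dilation hA) ^ p.1) (translate p.2.1 (ψ p.2.2)), f⟫_ℂ‖ ^ 2 := by
    refine (summable_prod_of_nonneg fun p => sq_nonneg _).mpr ⟨fun j => (h2 j).summable, ?_⟩
    refine h1.summable.congr fun j => ?_
    exact (h2 j).tsum_eq.symm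
  have h4 := h3.hasSum.prod_fiberwise h2
  rw [← h4.unique h1]
  exact h3.hasSum

theorem IsPyramid.isGMRA [Nonempty (Fin d)] {hA : IsExpansive A} (hp : IsPyramid hA φ ψ) :
    IsGMRA hA (dilates hA (coreSpace φ)) := by
  have hcl : IsClosed (coreSpace φ : Set (L2 d)) := Submodule.isClosed_topologicalClosure _
  have : CompleteSpace (coreSpace φ) := hcl.completeSpace_coe
  have horth : ∀ f, f ∈ (coreSpace φ)ᗮ ↔ analysis hp.besselScaling f = 0 := fun f =>
    (analysis_eq_zero_iff hp.besselScaling f).symm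
  have hsymm : ∀ f ∈ coreSpace φ, (dilation hA).symm f ∈ coreSpace φ := by
    intro f hf
    rw [← (coreSpace φ).orthogonal_orthogonal, Submodule.mem_orthogonal]
    intro w hw
    -- In the pyramid identity for `δ w` the left side is the scaling energy of `w`, which is zero;
    -- both nonnegative terms on the right must vanish.
    have h1 : dilation hA w ∈ (coreSpace φ)ᗮ := by
      rw [horth] at hw ⊢
      have h2 := hp.step (dilation hA w)
      rw [LinearIsometryEquiv.symm_apply_apply, hw, norm_zero] at h2
      have h3 := sq_nonneg ‖analysis hp.besselScaling (dilation hA w)‖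
      have h4 := sq_nonneg ‖analysis hp.besselWavelet (dilation hA w)‖
      rw [← norm_eq_zero, ← sq_eq_zero_iff]
      linarith
    rw [← (dilation hA).inner_map_map, LinearIsometryEquiv.apply_symm_apply]
    exact (coreSpace φ).mem_orthogonal' _ |>.mp h1 f hf
  have hsucc : ∀ j, dilates hA (coreSpace φ) j ≤ dilates hA (coreSpace φ) (j + 1) := by
    intro j f hf
    rw [mem_dilates_iff] at hf ⊢
    rw [neg_add, add_comm, zpow_dilation_add_apply, _root_.zpow_neg_one]
    exact hsymm _ hf
  refine ⟨fun j => ?_, hsucc, fun j => ?_, ?_, ?_, fun z f hf => ?_⟩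
  · have h1 : (dilates hA (coreSpace φ) j : Set (L2 d))
        = (fun f => ((dilation hA) ^ (-j)) f) ⁻¹' coreSpace φ :=
      Set.ext fun f => mem_dilates_iff hA
    rw [h1]
    exact hcl.preimage (LinearIsometryEquiv.continuous _)
  · ext f
    rw [mem_dilates_iff]
    have h1 : ((dilation hA) ^ (-(j + 1))) f = ((dilation hA) ^ (-j)) ((dilation hA).symm f) := by
      rw [neg_add, zpow_dilation_add_apply, _root_.zpow_neg_one]
      rfl
    rw [h1, ← mem_dilates_iff hA]
    constructor
    · intro h2
      exact ⟨_, h2, (dilation hA).apply_symm_apply f⟩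
    · rintro ⟨w, hw, rfl⟩
      change (dilation hA).symm (dilation hA w) ∈ _
      rwa [LinearIsometryEquiv.symm_apply_apply]
  · have hmono : Monotone (dilates hA (coreSpace φ)) := monotone_int_of_le_succ hsucc
    rw [← Submodule.coe_iSup_of_directed _ hmono.directed_le,
      Submodule.dense_iff_topologicalClosure_eq_top, Submodule.topologicalClosure_eq_top_iff,
      Submodule.eq_bot_iff]
    intro f hf
    rw [← norm_eq_zero]
    -- A vector orthogonal to every `V_n` has zero scaling energy at all scales, whereas these
    -- energies converge to its squared norm.
    refine tendsto_nhds_unique (hp.tendsto f) (tendsto_const_nhds.congr fun n => ?_)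
    rw [eq_comm, norm_eq_zero, ← horth, Submodule.mem_orthogonal]
    intro u hu
    have h1 : ((dilation hA) ^ (n : ℤ)) u ∈ dilates hA (coreSpace φ) n := ⟨u, hu, rfl⟩
    rw [← zpow_dilation_neg_natCast, ← inner_zpow_dilation]
    exact Submodule.mem_orthogonal _ _ |>.mp hf _
      (Submodule.mem_iSup_of_mem (n : ℤ) h1)
  · obtain ⟨e, he⟩ := exists_generators_coreSpace hp.besselScaling
    rw [Submodule.eq_bot_iff]
    intro f hf
    have hn : ∀ n : ℕ, (dilation hA)^[n] f ∈ coreSpace φ := by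
      intro n
      have h1 := (Submodule.mem_iInf _).mp hf (-(n : ℤ))
      rwa [mem_dilates_iff, neg_neg, zpow_dilation_natCast] at h1
    -- If `f` is in every `V_j`, then `δⁿ f` stays in `V_0`, and `⟪g, f⟫ = ⟪δⁿ g, δⁿ f⟫` is
    -- controlled by the shift sum of `δⁿ g` against fixed generators of `V_0`, which tends to zero.
    have h0 : ∀ g : L2 d, IsBoundedBddSupport g → ⟪g, f⟫_ℂ = 0 := by
      intro g hg
      have h1 : ∀ n, ‖⟪g, f⟫_ℂ‖ₑ ^ 2 ≤ ‖f‖ₑ ^ 2 * shiftSum e ((dilation hA)^[n] g) := by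
        intro n
        have h2 := he _ (hn n) ((dilation hA)^[n] g)
        rw [← zpow_dilation_natCast, ← zpow_dilation_natCast,
          LinearIsometryEquiv.inner_map_map] at h2
        rw [← zpow_dilation_natCast]
        refine h2.trans_eq ?_
        rw [← ofReal_norm, LinearIsometryEquiv.norm_map, ofReal_norm]
      have h3 := ENNReal.Tendsto.const_mul (a := ‖f‖ₑ ^ 2)
        (tendsto_shiftSum_iterate_dilation hA e hg) (Or.inr (by simp))
      rw [mul_zero] at h3
      have h4 := ge_of_tendsto' h3 h1
      simpa using h4
    have h1 : (fun g : L2 d => ⟪g, f⟫_ℂ) = fun _ => 0 :=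
      Continuous.ext_on dense_isBoundedBddSupport (by fun_prop) (by fun_prop) h0
    exact inner_self_eq_zero.mp (congrFun h1 f)
  · rw [mem_dilates_iff] at hf ⊢
    exact mem_coreSpace_translate z hf

end Pyramid

end GenFilter

end

/-! ### The pyramid identity for the functions built from the filters, and the conclusion -/

noncomputable section

namespace GenFilter

variable {d : ℕ} {A : Matrix (Fin d) (Fin d) ℤ}

theorem isPyramid_scalingFn_waveletFn {c c' : ℕ} [NeZero c] {m m' : Torus d → ℕ}
    {h : Fin c → Fin c → Torus d → ℂ} {g : Fin c' → Fin c → Torus d → ℂ} (hA : IsExpansive A)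
    {U : ℤ → Submodule ℂ (L2 d)} (hU : IsGMRA hA U) (hm : IsMultiplicityFunction (U 0) c m)
    (hm' : IsMultiplicityFunction (U 1 ⊓ (U 0)ᗮ) c' m') (hlow : IsLowPass A m h)
    (hlip : IsLipschitzNearZero h) (hhigh : IsHighPass A m m' h g) :
    IsPyramid hA (scalingFn hA hlow hlip hhigh) (waveletFn hA hlow hlip hhigh) := by
  have hinv : ∀ f : L2 d, IsBoundedBddSupport (𝓕 f : L2 d) →
      IsBoundedBddSupport (𝓕 ((dilation hA).symm f) : L2 d) := fun f hf =>
    (fourier_iterate_dilation_symm_bddSupport hA hf).1 1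
  exact isPyramid_of_dense hA dense_fourier_isBoundedBddSupport hinv
    (fun f hf => shiftSum_step hA hU hm hm' hlow hlip hhigh
      (hasBoundedSqSum_of_isBoundedBddSupport hf)
      (hasBoundedSqSum_of_isBoundedBddSupport (hinv f hf)))
    (fun f hf => tendsto_shiftSum_scalingFn hA hlow hlip hhigh hf)

end GenFilter

end

theorem theorem3p4 {d : ℕ} (A : Matrix (Fin d) (Fin d) ℤ) (hA : GenFilter.IsExpansive A)
    -- the GMRA `U` with multiplicity function `m ≤ c` and complementary one `m' ≤ c'`
    (U : ℤ → Submodule ℂ (GenFilter.L2 d)) (hU : GenFilter.IsGMRA hA U)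
    {c c' : ℕ} [NeZero c] (m m' : GenFilter.Torus d → ℕ)
    (hm : GenFilter.IsMultiplicityFunction (U 0) c m)
    (hm' : GenFilter.IsMultiplicityFunction (U 1 ⊓ (U 0)ᗮ) c' m')
    -- the filters
    (h : Fin c → Fin c → GenFilter.Torus d → ℂ) (hlow : GenFilter.IsLowPass A m h)
    (hlip : GenFilter.IsLipschitzNearZero h)
    (g : Fin c' → Fin c → GenFilter.Torus d → ℂ) (hhigh : GenFilter.IsHighPass A m m' h g) :
    ∃ (P : GenFilter.Rd d → Matrix (Fin c) (Fin c) ℂ)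
      (φ : Fin c → GenFilter.L2 d) (ψ : Fin c' → GenFilter.L2 d),
      -- `P` is the infinite product and `φ_i` is the inverse Fourier transform of `P_{i,1}`
      (∀ᵐ x, Tendsto (fun n => GenFilter.partialProd A h n x) atTop (𝓝 (P x))) ∧
      (∀ i, (𝓕 (φ i) : GenFilter.L2 d) =ᵐ[volume] fun x => P x i 0) ∧
      -- the definition of `ψ_k`
      (∀ k, (𝓕 (ψ k) : GenFilter.L2 d) =ᵐ[volume] fun x =>
        ((√(GenFilter.detN A) : ℝ) : ℂ)⁻¹ *
          ∑ j, g k j (GenFilter.toTorus (GenFilter.invB A x)) *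
            (𝓕 (φ j) : GenFilter.L2 d) (GenFilter.invB A x)) ∧
      GenFilter.IsParsevalMultiwavelet hA ψ ∧
      GenFilter.IsGMRA hA (GenFilter.dilates hA (GenFilter.coreSpace φ)) := by
  have := hU.nonempty
  have hp := GenFilter.isPyramid_scalingFn_waveletFn hA hU hm hm' hlow hlip hhigh
  refine ⟨GenFilter.infProd A h, GenFilter.scalingFn hA hlow hlip hhigh,
    GenFilter.waveletFn hA hlow hlip hhigh,
    Eventually.of_forall fun x => GenFilter.tendsto_infProd hA hlow hlip x,
    GenFilter.fourier_scalingFn hA hlow hlip hhigh, fun k => ?_,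
    hp.isParsevalMultiwavelet, hp.isGMRA⟩
  filter_upwards [GenFilter.fourier_waveletFn hA hlow hlip hhigh k, ae_all_iff.mpr fun j =>
    GenFilter.ae_invB hA (GenFilter.fourier_scalingFn hA hlow hlip hhigh j)] with x h1 h2
  rw [h1]
  simp_rw [h2]
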